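/- Let $M$ be a smooth manifold of dimension $n$ with a filtration $0=H^0\subseteq H^1\subseteq\dots\subseteq H^s=TM$ by smooth vector subbundles such that $[\Gamma(H^i),\Gamma(H^j)]\subseteq\Gamma(H^{i+j})$ (with $H^i=TM$ for $i>s$), and with a Riemannian metric $g$. A $k$-form $\alpha$ has weight $\ge w$ if $\alpha(V_1,\dots,V_k)=0$ whenever $V_l\in H^{i_l}$ and $i_1+\dots+i_k<w$; $\Omega^{k,\ge w}(M)$ is the space of these forms and $\Omega^{\bullet,\ge w}(M)$ is defined likewise. Let $\mathfrak g_xM=\bigoplus_j H^j_x/H^{j-1}_x$ with the Lie bracket induced by that of vector fields, and identify $\mathrm{gr}(\Omega^\bullet(M))=\bigoplus_w\Omega^{\bullet,\ge w}/\Omega^{\bullet,\ge w+1}$ with $\Gamma(\wedge^\bullet\mathfrak g^*M)$; an operator $D$ with $D\,\Omega^{\bullet,\ge w}\subseteq\Omega^{\bullet,\ge w}$ for all $w$ ($D$ respects the filtration) induces $\mathrm{gr}(D)$, and a subspace $E\subseteq\Omega^\bullet(M)$, with the filtration induced on it, has $\mathrm{gr}(E)\subseteq\Gamma(\wedge^\bullet\mathfrak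 g^*M)$. Let $d_{\mathfrak gM}$ be the fibrewise Chevalley--Eilenberg differential, $d_{\mathfrak gM}^t$ its fibrewise transpose for the metric on $\wedge^\bullet\mathfrak g^*M$ induced by $g$, $\Box_{\mathfrak gM}=d_{\mathfrak gM}d_{\mathfrak gM}^t+d_{\mathfrak gM}^td_{\mathfrak gM}$, and $\Pi_{\mathfrak gM}$ the fibrewise orthogonal projection onto $E_{\mathfrak gM}=\ker\Box_{\mathfrak gM}$; put $F_{\mathfrak gM}=\mathrm{Im}\,\Box_{\mathfrak gM}$. Assume that $\dim\ker\Box_{\mathfrak g_xM}$ is a locally constant function of $x\in M$. Let $(d_0,\delta_0)$ be a pair of base differential and codifferential: smooth algebraic (i.e. fibrewise linear) maps on $\Omega^\bullet(M)$ with $d_0^2=0=\delta_0^2$, $d_0(\Omega^{k,\ge w})\subseteq\Omega^{k+1,\ge w}$, $\delta_0(\Omega^{k+1,\ge w})\subseteq\Omega^{k,\ge w}$ and $\delta_0(\Omega^0)=0$; such that, for every form $\alpha$, $\delta_0d_0\alpha=0$ implies $d_0\alpha=0$, and $d_0\delta_0\alpha=0$ implies $\delta_0\alpha=0$; and with $\mathrm{gr}(d_0)=d_{\mathfrak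 gM}$, $\mathrm{gr}(\delta_0)=d_{\mathfrak gM}^t$. Let $\Box_0=d_0\delta_0+\delta_0d_0$, $\Box=d\delta_0+\delta_0d$, $E_0=\ker d_0\cap\ker\delta_0$ and $F_0=\mathrm{Im}\,d_0+\mathrm{Im}\,\delta_0$. There is an integer $N_0$ such that $D^{N_0}=0$ for every linear map $D$ on $\Omega^\bullet(M)$ satisfying $D\,\Omega^{\bullet,\ge w}\subseteq\Omega^{\bullet,\ge w+1}$ for all $w$; fix any such $N_0$. There are a unique smooth algebraic map $\Pi_0$ and a unique linear map $P$ on $\Omega^\bullet(M)$ such that, for every $x\in M$ and all small enough $\varepsilon>0$ (depending on $x$), $z-\Box_{0,x}$ is invertible on $\wedge^\bullet T_x^*M\otimes\mathbb C$ and $z-\Box$ is invertible on the complexified germs at $x$ of forms whenever $|z|=\varepsilon$, and $$\Pi_{0,x}=\frac1{2\pi i}\oint_{|z|=\varepsilon}(z-\Box_{0,x})^{-1}dz,\qquad (P\alpha)(x)=\frac1{2\pi i}\oint_{|z|=\varepsilon}\big((z-\Box)^{-1}\alpha\big)(x)\,dz\quad(\alpha\in\Omega^\bullet(M)).$$ If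 some $\varepsilon>0$ is smaller than all non-zero eigenvalues of all $\Box_{\mathfrak g_xM}$, $x\in M$, then $z-\Box$ is invertible on $\Omega^\bullet(M)\otimes\mathbb C$ for $|z|=\varepsilon$, and the formula for $P$ holds with the resolvent on $\Omega^\bullet(M)\otimes\mathbb C$. Moreover: 1. $P$ is a differential operator that respects the filtration and the degree of forms, with $\mathrm{gr}(P)=\Pi_{\mathfrak gM}$. It commutes with $\Box$, $d$ and $\delta_0$. 2. $\Box^{N_0}P=0$, while $\Box$ acts on $\mathrm{Im}\,\Box^{N_0}$, where it is invertible. $P$ is the projection onto $E:=\ker\delta_0\cap\ker(\delta_0d)=\mathrm{Im}\,P=\ker\Box^{N_0}$ along $F:=\mathrm{Im}\,\delta_0+\mathrm{Im}\,d\delta_0=\ker P=\mathrm{Im}\,\Box^{N_0}$. Moreover $\mathrm{gr}(E)=\mathrm{gr}(E_0)=\Gamma(E_{\mathfrak gM})$ and $\mathrm{gr}(F)=\mathrm{gr}(F_0)=\Gamma(F_{\mathfrak gM})$. 3. $L:=P\Pi_0+(I-P)(I-\Pi_0)$ is a differential operator that respects the filtration and the degree of forms, with $\mathrm{gr}(L)=I$.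 It is invertible and its inverse is a differential operator. One has $PL=P\Pi_0=L\Pi_0$, $P=L\Pi_0L^{-1}$, $(L^{-1}\Box L)\Pi_0=\Pi_0(L^{-1}\Box L)$, $F=\ker P=L(\ker\Pi_0)=L(F_0)$ and $E=\mathrm{Im}\,P=L(\mathrm{Im}\,\Pi_0)=L(E_0)$. -/

import Mathlib

open scoped Manifold ContDiff Topology TensorProduct

noncomputable section

set_option linter.unusedSectionVars false
namespace FilteredManifold

section Forms
variable (n : ℕ) {M : Type*} [TopologicalSpace M] [ChartedSpace (EuclideanSpace ℝ (Fin n)) M]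

/-- The tangent space `T_x M`. -/
abbrev Tan (x : M) : Type := TangentSpace (𝓡 n) x

/-- `∧^k T_x^* M`, as alternating forms on `T_x M`. -/
abbrev Cov (k : ℕ) (x : M) : Type := (Tan n x) [⋀^Fin k]→L[ℝ] ℝ

/-- `∧^• T_x^* M`; the components of degree `k > n` are trivial. -/
abbrev FormFiber (x : M) : Type := ∀ k : ℕ, Cov n k x

variable {n}

/-- The pull-back of a `k`-form to the target of the chart around `c`. -/
def chartRep {k : ℕ} (α : ∀ x : M, Cov n k x) (c : M) (y : EuclideanSpace ℝ (Fin n)) :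
    (EuclideanSpace ℝ (Fin n)) [⋀^Fin k]→L[ℝ] ℝ :=
  (α ((extChartAt (𝓡 n) c).symm y)).compContinuousLinearMap
    (mfderiv (𝓡 n) (𝓡 n)
      (extChartAt (𝓡 n) c).symm y)

/-- Smoothness of a `k`-form: its expression in every chart is smooth. -/
def IsSmoothForm {k : ℕ} (α : ∀ x : M, Cov n k x) : Prop :=
  ∀ c : M, ContDiffOn ℝ ∞ (chartRep α c) (extChartAt (𝓡 n) c).target

/-- The exterior derivative of a `k`-form, computed at `x` in the chart around `x`. -/
def extDer {k : ℕ} (α : ∀ x : M, Cov n k x) (x : M) : Cov n (k + 1) x :=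
  (extDeriv (chartRep α x)
    (extChartAt (𝓡 n) x x)).compContinuousLinearMap
      (mfderiv (𝓡 n) (𝓡 n)
        (extChartAt (𝓡 n) x) x)

lemma chartRep_add {k : ℕ} (α η : ∀ x : M, Cov n k x) (c : M) :
    chartRep (α + η) c = chartRep α c + chartRep η c := by
  ext y v; rfl

lemma chartRep_smul {k : ℕ} (f : M → ℝ) (α : ∀ x : M, Cov n k x) (c : M) :
    chartRep (fun x => f x • α x) c =
      fun y => f ((extChartAt (𝓡 n) c).symm y) • chartRep α c y := by
  ext y v; rfl

lemma IsSmoothForm.zero {k : ℕ} : IsSmoothForm (fun x : M => (0 : Cov n k x)) := by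
  intro c
  have : chartRep (fun x : M => (0 : Cov n k x)) c = fun _ => 0 := by ext y v; rfl
  rw [this]; exact contDiffOn_const

lemma IsSmoothForm.add {k : ℕ} {α η : ∀ x : M, Cov n k x} (h : IsSmoothForm α)
    (h' : IsSmoothForm η) : IsSmoothForm (α + η) := by
  intro c; rw [chartRep_add]; exact (h c).add (h' c)

lemma IsSmoothForm.const_smul {k : ℕ} {α : ∀ x : M, Cov n k x} (r : ℝ) (h : IsSmoothForm α) :
    IsSmoothForm (fun x => r • α x) := by
  intro c; rw [chartRep_smul (fun _ => r)]; exact (h c).const_smul r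

lemma IsSmoothForm.smul [IsManifold (𝓡 n) ∞ M]
    {k : ℕ} {α : ∀ x : M, Cov n k x} {f : M → ℝ}
    (hf : ContMDiff (𝓡 n) 𝓘(ℝ, ℝ) ∞ f) (h : IsSmoothForm α) :
    IsSmoothForm (fun x => f x • α x) := by
  intro c; rw [chartRep_smul]
  have h1 : ContDiffOn ℝ ∞ (fun y => f ((extChartAt (𝓡 n) c).symm y))
      (extChartAt (𝓡 n) c).target := by
    rw [← contMDiffOn_iff_contDiffOn]
    exact hf.comp_contMDiffOn (contMDiffOn_extChartAt_symm c)
  exact h1.smul (h c)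

variable [IsManifold (𝓡 n) ∞ M]

lemma mdifferentiableAt_chart_symm (c : M) {y : EuclideanSpace ℝ (Fin n)}
    (hy : y ∈ (extChartAt (𝓡 n) c).target) :
    MDifferentiableAt (𝓡 n) (𝓡 n)
      (extChartAt (𝓡 n) c).symm y :=
  ((contMDiffOn_extChartAt_symm (n := ∞) c).contMDiffAt
    ((isOpen_extChartAt_target c).mem_nhds hy)).mdifferentiableAt (by simp)

lemma mdifferentiableAt_chart (c : M) {x : M}
    (hx : x ∈ (extChartAt (𝓡 n) c).source) :
    MDifferentiableAt (𝓡 n) (𝓡 n)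
      (extChartAt (𝓡 n) c) x :=
  ((contMDiffOn_extChartAt (n := ∞) (x := c)).contMDiffAt
    (by rw [← extChartAt_source (𝓡 n)]; exact (isOpen_extChartAt_source c).mem_nhds hx)).mdifferentiableAt (by simp)

/-- The chart expression of `d α` is the Euclidean exterior derivative of that of `α`. -/
lemma chartRep_extDer {k : ℕ} {α : ∀ x : M, Cov n k x} (h : IsSmoothForm α) (c : M)
    {y : EuclideanSpace ℝ (Fin n)}
    (hy : y ∈ (extChartAt (𝓡 n) c).target) :
    chartRep (extDer α) c y = extDeriv (chartRep α c) y := by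
  set I := (𝓡 n)
  set p : M := (extChartAt I c).symm y with hp
  set f : EuclideanSpace ℝ (Fin n) → EuclideanSpace ℝ (Fin n) :=
    fun z => extChartAt I p ((extChartAt I c).symm z) with hf
  have hpsrc : p ∈ (extChartAt I p).source := mem_extChartAt_source p
  have hnear : ∀ᶠ z in 𝓝 y, z ∈ (extChartAt I c).target ∧
      (extChartAt I c).symm z ∈ (extChartAt I p).source := by
    refine Filter.Eventually.and ((isOpen_extChartAt_target c).mem_nhds hy) ?_
    exact (continuousAt_extChartAt_symm'' hy).preimage_mem_nhds
      ((isOpen_extChartAt_source p).mem_nhds hpsrc)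
  have hderiv : ∀ z, z ∈ (extChartAt I c).target →
      (extChartAt I c).symm z ∈ (extChartAt I p).source →
      fderiv ℝ f z = (mfderiv I I (extChartAt I p) ((extChartAt I c).symm z)).comp
        (mfderiv I I (extChartAt I c).symm z) := by
    intro z hz hz'
    rw [← mfderiv_eq_fderiv]
    exact mfderiv_comp z (mdifferentiableAt_chart p hz') (mdifferentiableAt_chart_symm c hz)
  have hsymm : ∀ z, z ∈ (extChartAt I c).target →
      (extChartAt I c).symm z ∈ (extChartAt I p).source →
      mfderiv I I (extChartAt I c).symm z =
        (mfderiv I I (extChartAt I p).symm (f z)).comp (fderiv ℝ f z) := by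
    intro z hz hz'
    have e : (extChartAt I c).symm =ᶠ[𝓝 z] (extChartAt I p).symm ∘ f := by
      have h1 : ∀ᶠ u in 𝓝 z, (extChartAt I c).symm u ∈ (extChartAt I p).source :=
        (continuousAt_extChartAt_symm'' hz).preimage_mem_nhds
          ((isOpen_extChartAt_source p).mem_nhds hz')
      filter_upwards [h1] with u hu
      exact ((extChartAt I p).left_inv hu).symm
    have hfz : f z ∈ (extChartAt I p).target := (extChartAt I p).map_source hz'
    have hfd : MDifferentiableAt I I f z :=
      (mdifferentiableAt_chart p hz').comp z (mdifferentiableAt_chart_symm c hz)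
    rw [e.mfderiv_eq, mfderiv_comp z (mdifferentiableAt_chart_symm p hfz) hfd, mfderiv_eq_fderiv]
    rfl
  have hloc : chartRep α c =ᶠ[𝓝 y]
      fun z => (chartRep α p (f z)).compContinuousLinearMap (fderiv ℝ f z) := by
    filter_upwards [hnear] with z hz
    have hl : (extChartAt I p).symm (f z) = (extChartAt I c).symm z :=
      (extChartAt I p).left_inv hz.2
    have h2 := hsymm z hz.1 hz.2
    have h3 : ∀ v, (mfderiv I I (extChartAt I c).symm z : _ → _) v =
        (mfderiv I I (extChartAt I p).symm (f z)) (fderiv ℝ f z v) :=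
      fun v => by rw [h2]; rfl
    let α' : M → (EuclideanSpace ℝ (Fin n)) [⋀^Fin k]→L[ℝ] ℝ := α
    ext v
    change α' ((extChartAt I c).symm z) (fun i => mfderiv I I (extChartAt I c).symm z (v i)) =
      α' ((extChartAt I p).symm (f z))
        (fun i => mfderiv I I (extChartAt I p).symm (f z) (fderiv ℝ f z (v i)))
    rw [hl]
    exact congrArg _ (funext fun i => h3 (v i))
  have hfy : f y ∈ (extChartAt I p).target := (extChartAt I p).map_source hpsrc
  have hα : DifferentiableAt ℝ (chartRep α p) (f y) :=
    ((h p).contDiffAt ((isOpen_extChartAt_target p).mem_nhds hfy)).differentiableAt (by simp)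
  have hfs : ContDiffAt ℝ ∞ f y := by
    rw [← contMDiffAt_iff_contDiffAt]
    refine ContMDiffAt.comp y (contMDiffAt_extChartAt (x := p)) ?_
    exact (contMDiffOn_extChartAt_symm c).contMDiffAt ((isOpen_extChartAt_target c).mem_nhds hy)
  rw [hloc.extDeriv_eq, extDeriv_pullback hα hfs (by simpa using! (WithTop.coe_le_coe.2 (le_top : (2 : ℕ∞) ≤ ⊤)))]
  rw [hderiv y hy hpsrc]
  rfl


lemma IsSmoothForm.extDer {k : ℕ} {α : ∀ x : M, Cov n k x} (h : IsSmoothForm α) :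
    IsSmoothForm (extDer α) := by
  intro c
  have h1 : ContDiffOn ℝ ∞ (extDeriv (chartRep α c)) (extChartAt (𝓡 n) c).target := by
    have h2 : ContDiffOn ℝ ∞ (fderiv ℝ (chartRep α c)) (extChartAt (𝓡 n) c).target :=
      (h c).fderiv_of_isOpen (isOpen_extChartAt_target c) (by simp)
    exact (ContinuousAlternatingMap.alternatizeUncurryFinCLM ℝ _ ℝ).contDiff.comp_contDiffOn h2
  exact h1.congr fun y hy => chartRep_extDer h c hy

variable (n M) in
/-- The smooth sections of `∧^• T^* M`. -/
def smoothForms : Submodule ℝ (∀ x : M, FormFiber n x) where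
  carrier := {α | ∀ k, IsSmoothForm fun x => α x k}
  zero_mem' := fun _ => IsSmoothForm.zero
  add_mem' := fun h h' k => (h k).add (h' k)
  smul_mem' := fun r _ h k => (h k).const_smul r

variable (n M) in
/-- The space `Ω^•(M)` of smooth forms. -/
def Forms : Type _ := ↥(smoothForms n M)

instance : AddCommGroup (Forms n M) := Submodule.addCommGroup (smoothForms n M)

instance : Module ℝ (Forms n M) := Submodule.module (smoothForms n M)

/-- The value `α_x ∈ ∧^• T_x^* M` of a form. -/
def Forms.val (α : Forms n M) (x : M) : FormFiber n x := α.1 x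

@[ext]
lemma Forms.ext {α β : Forms n M} (h : ∀ x, α.val x = β.val x) : α = β :=
  Subtype.ext (funext h)

variable (n) in
/-- Evaluation of forms at `x`. -/
def evalAt (x : M) : Forms n M →ₗ[ℝ] FormFiber n x where
  toFun α := α.val x
  map_add' _ _ := rfl
  map_smul' _ _ := rfl

/-- Multiplication of forms by a smooth function. -/
def mulFun (f : C^∞⟮𝓡 n, M; ℝ⟯) : Module.End ℝ (Forms n M) where
  toFun α := ⟨fun x => f x • α.val x, fun k => (α.2 k).smul f.contMDiff⟩
  map_add' α β := by ext x k : 2; exact smul_add (f x) (α.val x k) (β.val x k)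
  map_smul' r α := by ext x k : 2; exact smul_comm (f x) r (α.val x k)

lemma extDer_add {k : ℕ} {α β : ∀ x : M, Cov n k x} (h : IsSmoothForm α) (h' : IsSmoothForm β) :
    extDer (α + β) = extDer α + extDer β := by
  funext x
  have hx := (isOpen_extChartAt_target (I := 𝓡 n) x).mem_nhds (mem_extChartAt_target x)
  have h1 := ((h x).contDiffAt hx).differentiableAt (by simp)
  have h2 := ((h' x).contDiffAt hx).differentiableAt (by simp)
  simp only [FilteredManifold.extDer, chartRep_add, extDeriv_add h1 h2]
  rfl

lemma extDer_smul {k : ℕ} (r : ℝ) (α : ∀ x : M, Cov n k x) :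
    extDer (fun x => r • α x) = fun x => r • extDer α x := by
  funext x
  have : chartRep (fun x => r • α x) x = r • chartRep α x := rfl
  simp only [FilteredManifold.extDer, this]
  erw [extDeriv_smul]
  rfl

/-- The de Rham differential on `Ω^•(M)`. -/
def deRham : Module.End ℝ (Forms n M) where
  toFun α := ⟨fun x k => match k with
      | 0 => 0
      | k + 1 => extDer (fun y => α.val y k) x,
    fun k => match k with
      | 0 => IsSmoothForm.zero
      | k + 1 => (α.2 k).extDer⟩
  map_add' α β := by
    ext x k : 2
    match k with
    | 0 => exact (add_zero (0 : Cov n 0 x)).symm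
    | k + 1 => exact congrFun (extDer_add (α.2 k) (β.2 k)) x
  map_smul' r α := by
    ext x k : 2
    match k with
    | 0 => exact (smul_zero r : r • (0 : Cov n 0 x) = 0).symm
    | k + 1 => exact congrFun (extDer_smul r fun y => α.val y k) x

/-- Differential operators of order at most `r` acting on `Ω^•(M)`: an operator of order zero
commutes with functions, and one has order at most `r + 1` when its commutators with functions
have order at most `r`. -/
def HasOrderLE : ℕ → Module.End ℝ (Forms n M) → Prop
  | 0, D => ∀ f : C^∞⟮𝓡 n, M; ℝ⟯, D * mulFun f = mulFun f * D
  | r + 1, D => ∀ f : C^∞⟮𝓡 n, M; ℝ⟯, HasOrderLE r (D * mulFun f - mulFun f * D)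

def IsDifferentialOperator (D : Module.End ℝ (Forms n M)) : Prop := ∃ r, HasOrderLE r D

variable (n) in
/-- Smooth forms vanishing near `x`. -/
def vanishingNear (x : M) : Submodule ℝ (Forms n M) where
  carrier := {α | ∀ᶠ y in 𝓝 x, α.val y = 0}
  zero_mem' := Filter.Eventually.of_forall fun _ => rfl
  add_mem' := fun {α β} h h' => by
    filter_upwards [h, h'] with y hy hy'
    change α.val y + β.val y = 0
    rw [hy, hy', add_zero]
  smul_mem' := fun r α h => by
    filter_upwards [h] with y hy
    change r • α.val y = 0
    rw [hy, smul_zero]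

lemma deRham_vanishingNear (x : M) : vanishingNear n x ≤ (vanishingNear n x).comap deRham := by
  intro α h
  have h' : ∀ᶠ y in 𝓝 x, ∀ᶠ z in 𝓝 y, α.val z = 0 := eventually_eventually_nhds.2 h
  change ∀ᶠ y in 𝓝 x, (deRham α).val y = 0
  filter_upwards [h'] with y hy
  funext k
  match k with
  | 0 => rfl
  | k + 1 =>
    change extDer (fun z => α.val z k) y = 0
    have h1 : chartRep (fun z => α.val z k) y =ᶠ[𝓝 (extChartAt (𝓡 n) y y)] fun _ => 0 := by
      have h2 : ContinuousAt (extChartAt (𝓡 n) y).symm (extChartAt (𝓡 n) y y) :=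
        continuousAt_extChartAt_symm y
      rw [ContinuousAt, extChartAt_to_inv] at h2
      filter_upwards [h2.eventually hy] with z hz
      simp only [chartRep, hz]
      rfl
    rw [FilteredManifold.extDer, h1.extDeriv_eq]
    have h3 : extDeriv (fun _ : EuclideanSpace ℝ (Fin n) =>
        (0 : EuclideanSpace ℝ (Fin n) [⋀^Fin k]→L[ℝ] ℝ)) (extChartAt (𝓡 n) y y) = 0 := by
      ext v; simp [extDeriv, ContinuousAlternatingMap.alternatizeUncurryFin_apply]
    rw [h3]
    rfl

variable (n) in
/-- Germs at `x` of smooth forms. -/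
abbrev FormGerm (x : M) : Type _ := Forms n M ⧸ vanishingNear n x

variable (n) in
/-- The value at `x` of a germ at `x`. -/
def germValue (x : M) : FormGerm n x →ₗ[ℝ] FormFiber n x :=
  (vanishingNear n x).liftQ (evalAt n x)
    fun α h => Filter.Eventually.self_of_nhds (p := fun y => α.val y = 0) h

variable (n M) in
/-- Smooth algebraic maps acting on `Ω^•(M)`: fibrewise linear maps preserving smoothness. -/
structure AlgebraicMap where
  fib : ∀ x : M, Module.End ℝ (FormFiber n x)
  smooth : ∀ α ∈ smoothForms n M, (fun x => fib x (α x)) ∈ smoothForms n M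

/-- The operator on `Ω^•(M)` given by an algebraic map. -/
def AlgebraicMap.op (A : AlgebraicMap n M) : Module.End ℝ (Forms n M) where
  toFun α := ⟨fun x => A.fib x (α.val x), A.smooth α.1 α.2⟩
  map_add' α β := by ext x : 1; exact map_add (A.fib x) _ _
  map_smul' r α := by ext x : 1; exact map_smul (A.fib x) _ _

/-- `d δ + δ d` for an algebraic map `δ`. -/
def box (δ : AlgebraicMap n M) : Module.End ℝ (Forms n M) := deRham * δ.op + δ.op * deRham

lemma op_vanishingNear (A : AlgebraicMap n M) (x : M) :
    vanishingNear n x ≤ (vanishingNear n x).comap A.op := by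
  intro α h
  change ∀ᶠ y in 𝓝 x, A.fib y (α.val y) = 0
  have h' : ∀ᶠ y in 𝓝 x, α.val y = 0 := h
  filter_upwards [h'] with y hy
  rw [hy, map_zero]

lemma box_vanishingNear (δ : AlgebraicMap n M) (x : M) :
    vanishingNear n x ≤ (vanishingNear n x).comap (box δ) := fun _ h =>
  (vanishingNear n x).add_mem (deRham_vanishingNear x (op_vanishingNear δ x h))
    (op_vanishingNear δ x (deRham_vanishingNear x h))

/-- The operator induced by `box δ` on germs at `x`. -/
def boxGerm (δ : AlgebraicMap n M) (x : M) : Module.End ℝ (FormGerm n x) :=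
  (vanishingNear n x).mapQ (vanishingNear n x) (box δ) (box_vanishingNear δ x)

end Forms

section Contour
variable {V W : Type*} [AddCommGroup V] [Module ℝ V] [AddCommGroup W] [Module ℝ W]

/-- `z - A` is invertible on `V ⊗ ℂ` for every `z` on the circle `|z| = ε`. -/
def CircleInResolventSet (A : Module.End ℝ V) (ε : ℝ) : Prop :=
  ∀ z : ℂ, ‖z‖ = ε → z ∈ resolventSet ℂ (A.baseChange ℂ : Module.End ℂ (ℂ ⊗[ℝ] V))

/-- `w = (2πi)⁻¹ ∮_{|z| = ε} T ((z - A)⁻¹ v) dz`, where `T : V → W` is linear and the integral of a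
function with values in `W ⊗ ℂ` is tested against the linear functionals of `W`. -/
def IsContourValue (A : Module.End ℝ V) (ε : ℝ) (T : V →ₗ[ℝ] W) (v : V) (w : W) : Prop :=
  ∀ l : Module.Dual ℝ W,
    CircleIntegrable (fun z : ℂ => Module.Dual.baseChange ℂ (l ∘ₗ T)
      (resolvent (A.baseChange ℂ : Module.End ℂ (ℂ ⊗[ℝ] V)) z (1 ⊗ₜ v))) 0 ε ∧
    (2 * Real.pi * Complex.I)⁻¹ * (∮ z in C(0, ε), Module.Dual.baseChange ℂ (l ∘ₗ T)
      (resolvent (A.baseChange ℂ : Module.End ℂ (ℂ ⊗[ℝ] V)) z (1 ⊗ₜ v))) = ((l w : ℝ) : ℂ)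

end Contour

section ChevalleyEilenberg
variable {L : Type*} [AddCommGroup L] [Module ℝ L]

/-- The Chevalley-Eilenberg differential `∧^{k+1} L^* → ∧^{k+2} L^*` associated with an
antisymmetric bilinear map `b` on `L`; see `chevalleyEilenberg_apply` for the usual formula. -/
def chevalleyEilenberg (b : L →ₗ[ℝ] L →ₗ[ℝ] L) (k : ℕ) :
    (L [⋀^Fin (k + 1)]→ₗ[ℝ] ℝ) →ₗ[ℝ] (L [⋀^Fin (k + 2)]→ₗ[ℝ] ℝ) where
  toFun β := -(2⁻¹ : ℝ) • AlternatingMap.alternatizeUncurryFin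
    (AlternatingMap.alternatizeUncurryFinLM ∘ₗ b.compr₂ β.curryLeft)
  map_add' β γ := by
    ext v
    simp only [AlternatingMap.smul_apply, AlternatingMap.add_apply,
      AlternatingMap.alternatizeUncurryFin_alternatizeUncurryFinLM_comp_apply,
      LinearMap.compr₂_apply, AlternatingMap.curryLeft_apply_apply, ← smul_add,
      ← Finset.sum_add_distrib]
    congr 1
    refine Finset.sum_congr rfl fun i _ => Finset.sum_congr rfl fun j _ => ?_
    congr 1
    ring
  map_smul' r β := by
    ext v
    simp only [AlternatingMap.smul_apply, RingHom.id_apply,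
      AlternatingMap.alternatizeUncurryFin_alternatizeUncurryFinLM_comp_apply,
      LinearMap.compr₂_apply, AlternatingMap.curryLeft_apply_apply, ← smul_sub,
      smul_comm _ r, ← Finset.smul_sum]

/-- `(dβ)(v_0, …, v_{k+1}) = ∑_{i < j'} (-1)^{i + j'} β([v_i, v_{j'}], v_0, …, v_{k+1})`, where
`v_i` and `v_{j'}` are omitted after the bracket, and `j' = j + 1` with `i ≤ j`. -/
lemma chevalleyEilenberg_apply {b : L →ₗ[ℝ] L →ₗ[ℝ] L} (hb : ∀ u v, b u v = -b v u) (k : ℕ)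
    (β : L [⋀^Fin (k + 1)]→ₗ[ℝ] ℝ) (v : Fin (k + 2) → L) :
    chevalleyEilenberg b k β v =
      ∑ i : Fin (k + 1), ∑ j ≥ i, (-1 : ℝ) ^ ((i : ℕ) + (j + 1)) *
        β (Matrix.vecCons (b (v i.castSucc) (v j.succ)) (j.removeNth (i.castSucc.removeNth v))) := by
  have hn : ∀ (u w : L) (t : Fin k → L),
      β (Matrix.vecCons (b u w) t) = -β (Matrix.vecCons (b w u) t) := by
    intro u w t
    rw [hb u w, ← AlternatingMap.curryLeft_apply_apply, map_neg]
    rfl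
  change -(2⁻¹ : ℝ) • AlternatingMap.alternatizeUncurryFin
    (AlternatingMap.alternatizeUncurryFinLM ∘ₗ b.compr₂ β.curryLeft) v = _
  simp only [AlternatingMap.alternatizeUncurryFin_alternatizeUncurryFinLM_comp_apply,
      LinearMap.compr₂_apply, AlternatingMap.curryLeft_apply_apply, Finset.smul_sum]
  refine Finset.sum_congr rfl fun i _ => Finset.sum_congr rfl fun j _ => ?_
  rw [hn (v j.succ)]
  simp only [zsmul_eq_mul, smul_eq_mul]
  push_cast
  ring

end ChevalleyEilenberg

section Filtration
variable {n : ℕ} {M : Type*} [TopologicalSpace M] [ChartedSpace (EuclideanSpace ℝ (Fin n)) M]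
  [IsManifold (𝓡 n) ∞ M]

/-- Smoothness on `U` of a vector field. -/
def IsSmoothFieldOn (V : ∀ x : M, Tan n x) (U : Set M) : Prop :=
  ContMDiffOn (𝓡 n) (𝓡 n).tangent ∞ (fun x => (⟨x, V x⟩ : TangentBundle (𝓡 n) M)) U

/-- `V` is a smooth section of the family `K` of subspaces of the tangent spaces. -/
def IsSmoothSection (K : ∀ x : M, Submodule ℝ (Tan n x)) (V : ∀ x : M, Tan n x) : Prop :=
  IsSmoothFieldOn V Set.univ ∧ ∀ x, V x ∈ K x

/-- `K` is a smooth vector subbundle of `TM`: it has smooth local frames. -/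
def IsSubbundle (K : ∀ x : M, Submodule ℝ (Tan n x)) : Prop :=
  ∀ x₀ : M, ∃ (r : ℕ) (X : Fin r → ∀ x : M, Tan n x), ∃ U ∈ 𝓝 x₀,
    (∀ j, IsSmoothFieldOn (X j) U) ∧
    ∀ x ∈ U, LinearIndependent ℝ (fun j => X j x) ∧
      Submodule.span ℝ (Set.range fun j => X j x) = K x

variable (n M) in
/-- The structure of a filtered manifold:
`0 = H⁰ ⊆ H¹ ⊆ ⋯ ⊆ Hˢ = TM`, with `[Γ(Hⁱ), Γ(Hʲ)] ⊆ Γ(Hⁱ⁺ʲ)` and `Hⁱ = TM` for `i > s`. -/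
structure TangentFiltration where
  s : ℕ
  H : ℕ → ∀ x : M, Submodule ℝ (Tan n x)
  subbundle : ∀ i, IsSubbundle (H i)
  zero : ∀ x, H 0 x = ⊥
  mono : ∀ i x, H i x ≤ H (i + 1) x
  top : ∀ i, s ≤ i → ∀ x, H i x = ⊤
  bracket : ∀ i j (V W : ∀ x : M, Tan n x), IsSmoothSection (H i) V → IsSmoothSection (H j) W →
    ∀ x, VectorField.mlieBracket (𝓡 n) V W x ∈ H (i + j) x

namespace TangentFiltration
variable (F : TangentFiltration n M)

/-- Elements of `∧^• T_x^* M` of weight at least `w`. -/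
def fiberGE (w : ℕ) (x : M) : Submodule ℝ (FormFiber n x) where
  carrier := {a | ∀ (k : ℕ) (i : Fin k → ℕ) (v : Fin k → Tan n x),
    (∀ l, v l ∈ F.H (i l) x) → ∑ l, i l < w → a k v = 0}
  zero_mem' := fun _ _ _ _ _ => rfl
  add_mem' := fun {a b} ha hb k i v hv hw => by
    change a k v + b k v = 0
    rw [ha k i v hv hw, hb k i v hv hw, add_zero]
  smul_mem' := fun r a ha k i v hv hw => by
    change r • a k v = 0
    rw [ha k i v hv hw, smul_zero]

/-- `g_x M = gr(T_x M) = ⊕_{j=1}^s Hʲ_x / Hʲ⁻¹_x`; the summand `j` sits at the index `j - 1`. -/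
abbrev Osc (x : M) : Type :=
  ∀ j : Fin F.s, (F.H (j + 1) x) ⧸ (F.H j x).submoduleOf (F.H (j + 1) x)

/-- The class in `Hʲ⁺¹_x / Hʲ_x` of a vector of `Hʲ⁺¹_x`, as an element of `g_x M`. -/
def cls (x : M) (j : Fin F.s) (v : F.H (j + 1) x) : F.Osc x :=
  Pi.single j (Submodule.Quotient.mk v)

lemma bracket_mem {V W : ∀ x : M, Tan n x} {i j : ℕ} (hV : IsSmoothSection (F.H (i + 1)) V)
    (hW : IsSmoothSection (F.H (j + 1)) W) (x : M) :
    VectorField.mlieBracket (𝓡 n) V W x ∈ F.H (i + j + 1 + 1) x := by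
  have h := F.bracket _ _ V W hV hW x
  rwa [show i + 1 + (j + 1) = i + j + 1 + 1 by ring] at h

/-- The defining property of the Lie bracket of `g_x M`: for `V ∈ Γ(Hⁱ)` and `W ∈ Γ(Hʲ)`,
`[V(x) mod Hⁱ⁻¹, W(x) mod Hʲ⁻¹] = [V, W](x) mod Hⁱ⁺ʲ⁻¹`. -/
def IsOscBracket (x : M) (b : F.Osc x →ₗ[ℝ] F.Osc x →ₗ[ℝ] F.Osc x) : Prop :=
  ∀ (i j : Fin F.s) (V W : ∀ x : M, Tan n x) (hV : IsSmoothSection (F.H (i + 1)) V)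
    (hW : IsSmoothSection (F.H (j + 1)) W),
    b (F.cls x i ⟨V x, hV.2 x⟩) (F.cls x j ⟨W x, hW.2 x⟩) =
      if h : (i : ℕ) + j + 1 < F.s then
        F.cls x ⟨i + j + 1, h⟩ ⟨VectorField.mlieBracket (𝓡 n) V W x, F.bracket_mem hV hW x⟩
      else 0

/-- The Lie bracket of `g_x M`: the unique bilinear map with the above property. -/
def oscBracket (x : M) : F.Osc x →ₗ[ℝ] F.Osc x →ₗ[ℝ] F.Osc x :=
  Classical.epsilon (F.IsOscBracket x)

/-- `∧^• g_x^* M`, as alternating forms on `g_x M`. -/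
abbrev OscForms (x : M) : Type := ∀ k : ℕ, (F.Osc x) [⋀^Fin k]→ₗ[ℝ] ℝ

/-- The osculating Chevalley-Eilenberg differential at `x`. -/
def oscD (x : M) : Module.End ℝ (F.OscForms x) where
  toFun β := fun k => match k with
    | 0 => 0
    | 1 => 0
    | k + 2 => chevalleyEilenberg (F.oscBracket x) k (β (k + 1))
  map_add' β γ := by
    funext k
    match k with
    | 0 => exact (add_zero _).symm
    | 1 => exact (add_zero _).symm
    | k + 2 => exact map_add (chevalleyEilenberg (F.oscBracket x) k) _ _
  map_smul' r β := by
    funext k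
    match k with
    | 0 => exact (smul_zero r).symm
    | 1 => exact (smul_zero r).symm
    | k + 2 => exact map_smul (chevalleyEilenberg (F.oscBracket x) k) _ _

/-- `β` is the class of `a`, an element of `∧^• T_x^* M` of weight at least `w`, in the weight `w`
part of `gr(∧^• T_x^* M) = ∧^• g_x^* M`. -/
def IsClass (w : ℕ) (x : M) (a : FormFiber n x) (β : F.OscForms x) : Prop :=
  ∀ (k : ℕ) (j : Fin k → Fin F.s) (v : ∀ l, F.H (j l + 1) x),
    β k (fun l => F.cls x (j l) (v l)) =
      if ∑ l, ((j l : ℕ) + 1) = w then a k (fun l => (v l : Tan n x)) else 0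

/-- `Ω^{•, ≥ w}(M)`. -/
def formsGE (w : ℕ) : Submodule ℝ (Forms n M) where
  carrier := {α | ∀ x, α.val x ∈ F.fiberGE w x}
  zero_mem' := fun x => (F.fiberGE w x).zero_mem
  add_mem' := fun h h' x => (F.fiberGE w x).add_mem (h x) (h' x)
  smul_mem' := fun r _ h x => (F.fiberGE w x).smul_mem r (h x)

/-- `Ω^{k, ≥ w}(M)`. -/
def degFormsGE (k w : ℕ) : Submodule ℝ (Forms n M) where
  carrier := {α | α ∈ F.formsGE w ∧ ∀ x l, l ≠ k → α.val x l = 0}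
  zero_mem' := ⟨(F.formsGE w).zero_mem, fun _ _ _ => rfl⟩
  add_mem' := fun {α β} h h' => ⟨(F.formsGE w).add_mem h.1 h'.1, fun x l hl => by
    change α.val x l + β.val x l = 0
    rw [h.2 x l hl, h'.2 x l hl, add_zero]⟩
  smul_mem' := fun r α h => ⟨(F.formsGE w).smul_mem r h.1, fun x l hl => by
    change r • α.val x l = 0
    rw [h.2 x l hl, smul_zero]⟩

/-- `D` maps `Ω^{k, ≥ w}(M)` into itself. -/
def RespectsDegreeAndFiltration (D : Module.End ℝ (Forms n M)) : Prop :=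
  ∀ k w, ∀ α ∈ F.degFormsGE k w, D α ∈ F.degFormsGE k w

/-- `D` respects the filtration and `gr(D)` is the algebraic map `T` of osculating forms. -/
def HasGr (D : Module.End ℝ (Forms n M)) (T : ∀ x : M, Module.End ℝ (F.OscForms x)) : Prop :=
  ∀ w, ∀ α ∈ F.formsGE w, D α ∈ F.formsGE w ∧
    ∀ x, ∃ β, F.IsClass w x (α.val x) β ∧ F.IsClass w x ((D α).val x) (T x β)

/-- `gr(E)`, for the filtration of `E` induced by that of `Ω^•(M)`, is the space of smooth sections
of the graded subspaces `S x ⊆ ∧^• g_x^* M`: in each weight `w`, the class of a form lies in `S` at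
every point if and only if it is the class of an element of `E`. -/
def HasGrSubspace (E : Submodule ℝ (Forms n M)) (S : ∀ x : M, Submodule ℝ (F.OscForms x)) : Prop :=
  ∀ w, ∀ α ∈ F.formsGE w,
    (∃ α' ∈ E, α' ∈ F.formsGE w ∧ α - α' ∈ F.formsGE (w + 1)) ↔
      ∀ x, ∃ β ∈ S x, F.IsClass w x (α.val x) β

/-- `N` is such that `D ^ N = 0` for every linear map `D` that increases the weights of forms. -/
def IsNilpotencyBound (N : ℕ) : Prop :=
  ∀ D : Module.End ℝ (Forms n M), (∀ w, ∀ α ∈ F.formsGE w, D α ∈ F.formsGE (w + 1)) → D ^ N = 0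

section Metric

variable (g : Bundle.ContMDiffRiemannianMetric (𝓡 n) ∞ (EuclideanSpace ℝ (Fin n))
  (fun x : M => Tan n x))

variable {F} in
lemma isCompl_orthogonal (x : M) (K : Submodule ℝ (Tan n x)) :
    IsCompl K ((g.inner x).toBilinForm.orthogonal K) := by
  have : FiniteDimensional ℝ (Tan n x) :=
    inferInstanceAs (FiniteDimensional ℝ (EuclideanSpace ℝ (Fin n)))
  have hr : (g.inner x).toBilinForm.IsRefl := fun v w h => by
    rw [ContinuousLinearMap.toBilinForm_apply] at h ⊢
    rw [g.symm, h]
  rw [LinearMap.BilinForm.isCompl_orthogonal_iff_disjoint hr, Submodule.disjoint_def]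
  intro v hv hv'
  by_contra hne
  exact (g.pos x v hne).ne' (hv' v hv)

/-- The isomorphism of `Hʲ⁺¹_x / Hʲ_x` with the orthogonal complement of `Hʲ_x` in `Hʲ⁺¹_x`. -/
def orthLift (x : M) (j : Fin F.s) :
    ((F.H (j + 1) x) ⧸ (F.H j x).submoduleOf (F.H (j + 1) x)) →ₗ[ℝ] Tan n x :=
  Submodule.liftQ _
    ((((g.inner x).toBilinForm.orthogonal (F.H j x)).projection (F.H j x)
      (isCompl_orthogonal g x (F.H j x)).symm) ∘ₗ (F.H (j + 1) x).subtype)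
    fun v hv => by
      have hv' : (v : Tan n x) ∈ F.H j x := hv
      simpa using! hv'

/-- The scalar product of `g_x M = gr(T_x M)`: the summands are orthogonal, and each of them
carries the quotient scalar product. -/
def oscInner (x : M) (u v : F.Osc x) : ℝ :=
  ∑ j, g.inner x (F.orthLift g x j (u j)) (F.orthLift g x j (v j))

/-- An orthonormal basis of `g_x M`. -/
def oscFrame (x : M) : Fin n → F.Osc x :=
  Classical.epsilon fun f => ∀ a b, F.oscInner g x (f a) (f b) = if a = b then 1 else 0

open Classical in
/-- The scalar product of `∧^• g_x^* M` for which the degrees are orthogonal and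
`⟨α_1 ∧ ⋯ ∧ α_k, β_1 ∧ ⋯ ∧ β_k⟩ = det ⟨α_i, β_j⟩`: the `k`-vectors `e_{i_1} ∧ ⋯ ∧ e_{i_k}`,
`i_1 < ⋯ < i_k`, given by an orthonormal basis of `g_x M` are dual to an orthonormal basis. -/
def oscFormInner (x : M) (β γ : F.OscForms x) : ℝ :=
  ∑ k ∈ Finset.range (n + 1), ∑ I : Fin k → Fin n,
    if StrictMono I then
      β k (fun l => F.oscFrame g x (I l)) * γ k (fun l => F.oscFrame g x (I l))
    else 0

/-- The transpose of an endomorphism of `∧^• g_x^* M`. -/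
def transpose (x : M) (T : Module.End ℝ (F.OscForms x)) : Module.End ℝ (F.OscForms x) :=
  Classical.epsilon fun T' =>
    ∀ β γ, F.oscFormInner g x (T β) γ = F.oscFormInner g x β (T' γ)

/-- The osculating box at `x`. -/
def oscBox (x : M) : Module.End ℝ (F.OscForms x) :=
  F.oscD x * F.transpose g x (F.oscD x) + F.transpose g x (F.oscD x) * F.oscD x

/-- The orthogonal projection of `∧^• g_x^* M` onto the kernel of the osculating box. -/
def oscProj (x : M) : Module.End ℝ (F.OscForms x) :=
  Classical.epsilon fun Q =>
    (∀ β, F.oscBox g x (Q β) = 0) ∧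
    ∀ β γ, F.oscBox g x γ = 0 → F.oscFormInner g x (β - Q β) γ = 0

end Metric
end TangentFiltration

/-- A pair of base differential and codifferential on a filtered manifold with a metric. -/
structure BasePair (F : TangentFiltration n M)
    (g : Bundle.ContMDiffRiemannianMetric (𝓡 n) ∞ (EuclideanSpace ℝ (Fin n))
      (fun x : M => Tan n x)) where
  d₀ : AlgebraicMap n M
  δ₀ : AlgebraicMap n M
  d₀_sq : d₀.op * d₀.op = 0
  δ₀_sq : δ₀.op * δ₀.op = 0
  d₀_mem : ∀ k w, ∀ α ∈ F.degFormsGE k w, d₀.op α ∈ F.degFormsGE (k + 1) w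
  δ₀_mem : ∀ k w, ∀ α ∈ F.degFormsGE (k + 1) w, δ₀.op α ∈ F.degFormsGE k w
  δ₀_zero : ∀ α ∈ F.degFormsGE 0 0, δ₀.op α = 0
  disjoint_d₀ : ∀ α, δ₀.op (d₀.op α) = 0 → d₀.op α = 0
  disjoint_δ₀ : ∀ α, d₀.op (δ₀.op α) = 0 → δ₀.op α = 0
  gr_d₀ : F.HasGr d₀.op F.oscD
  gr_δ₀ : F.HasGr δ₀.op fun x => F.transpose g x (F.oscD x)

namespace BasePair
variable {F : TangentFiltration n M}
  {g : Bundle.ContMDiffRiemannianMetric (𝓡 n) ∞ (EuclideanSpace ℝ (Fin n)) (fun x : M => Tan n x)}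
  (B : BasePair F g)

/-- The pointwise restriction of the base box `d₀ δ₀ + δ₀ d₀`. -/
def box₀ (x : M) : Module.End ℝ (FormFiber n x) :=
  B.d₀.fib x * B.δ₀.fib x + B.δ₀.fib x * B.d₀.fib x

/-- The base kernel projection: `Π_{0,x} = (2πi)⁻¹ ∮_{|z| = ε} (z - □_{0,x})⁻¹ dz` for every `x`
and every small enough `ε > 0`. -/
def IsBaseKernelProjection (A : AlgebraicMap n M) : Prop :=
  ∀ x, ∀ᶠ ε in 𝓝[>] (0 : ℝ), CircleInResolventSet (B.box₀ x) ε ∧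
    ∀ v, IsContourValue (B.box₀ x) ε LinearMap.id v (A.fib x v)

/-- `□ = d δ₀ + δ₀ d`. -/
abbrev box : Module.End ℝ (Forms n M) := FilteredManifold.box B.δ₀

/-- `P = (2πi)⁻¹ ∮_{|z| = ε} (z - □)⁻¹ dz`, locally at every point: at `x`, the resolvent is that
of `□` acting on germs of forms at `x`, and `ε > 0` is small enough. -/
def IsContourProjection (P : Module.End ℝ (Forms n M)) : Prop :=
  ∀ x, ∀ᶠ ε in 𝓝[>] (0 : ℝ), CircleInResolventSet (boxGerm B.δ₀ x) ε ∧
    ∀ α, IsContourValue (boxGerm B.δ₀ x) ε (germValue n x)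
      (Submodule.Quotient.mk α) ((P α).val x)

/-- `E₀ = ker d₀ ∩ ker δ₀`. -/
def E₀ : Submodule ℝ (Forms n M) := LinearMap.ker B.d₀.op ⊓ LinearMap.ker B.δ₀.op

/-- `F₀ = Im d₀ + Im δ₀`. -/
def F₀ : Submodule ℝ (Forms n M) := LinearMap.range B.d₀.op ⊔ LinearMap.range B.δ₀.op

end BasePair

/-- `L = P Π₀ + (I - P) (I - Π₀)`. -/
def opL (Q₀ : AlgebraicMap n M) (P : Module.End ℝ (Forms n M)) : Module.End ℝ (Forms n M) :=
  P * Q₀.op + (1 - P) * (1 - Q₀.op)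

end Filtration

end FilteredManifold
end

open FilteredManifold

/-! The box `□ = d δ₀ + δ₀ d` and the algebraic base box have the same associated graded, the
fibrewise operator `oscBox` (`hasGr_box`, `hasGr_box₀Map`; for `□` this rests on `hasGr_deRham`).
Each `oscBox x` is symmetric, hence has real spectrum and no nilpotent part at `0`. Operators that
raise weights are nilpotent, so a fibrewise identity for `oscBox`, once lifted with smooth
coefficients, holds for `□` up to a nilpotent error. Both projections are built without integration,
as Fitting projections onto `ker A ^ a` along `Im A ^ a`, and are recognized as contour integrals
afterwards.

Existence. The characteristic polynomial of `oscBox x` equals that of the base box at `x`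
(`charpoly_eq_of_sub_raises`), so its coefficients are smooth in `x`. Local constancy of the kernel
dimension makes its order of vanishing at `0` locally constant. Dividing by the lowest nonzero
coefficient, Cayley-Hamilton gives `T ^ d = T ^ (d + 1) τ(T)` fibrewise with smooth coefficients,
and `HasGr.stabilize` deduces that the kernels and images of the powers of `□` stabilize.

Locality. If `p` is the characteristic polynomial of `oscBox x`, a fixed power of `p(□)` produces
forms that vanish at `x` (`HasGr.val_aeval_pow_eq_zero`); the proof measures forms by order of
vanishing at `x` and weight simultaneously. Hence at `x` the form `P α` agrees with `π(□) α`, where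
the polynomial `π`, depending on `x`, is `1` modulo `X ^ a` and divisible by the part of a power of
`p` with nonzero roots. The degrees of these polynomials are bounded, so `P` is a differential
operator, and its associated graded is `π(oscBox x) = oscProj x`. The same annihilation turns the
resolvent integral into a residue computation (`isContourValue_of_annihilating`). Invertibility of
`z - □` is reduced to that of the real polynomial `|X - z| ^ 2` at `□`, which `exists_quasi_inverse`
inverts up to a smooth function and weight-raising terms.

Consequences. `P` commutes with whatever commutes with `□`, in particular with `d` and `δ₀`. As `P`
and `Π₀` have the same associated graded, `L` is unipotent, and it intertwines them. The
disjointness of `d₀` and `δ₀` gives `ker □₀ = E₀` and shows that `Π₀` kills the images of `d₀` and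
`δ₀`; then `L δ₀ P = 0`, so `δ₀ P = 0` (`δ₀_projection`), from which the descriptions of `E` and `F`
follow. Finally `□ P` has associated graded zero, hence `□ ^ N₀ P = 0`. -/

noncomputable section
set_option linter.unusedSectionVars false

section
open scoped Manifold ContDiff Topology TensorProduct

namespace FilteredManifold

/-! ### Fitting projections of an endomorphism, without finite dimension. -/

section LinearAlgebra
open Polynomial
variable {V W : Type*} [AddCommGroup V] [Module ℝ V] [AddCommGroup W] [Module ℝ W]

/-- `P` is the projection onto `ker (A ^ a)` along `Im (A ^ a)`. -/
structure IsFittingProjection (A P : Module.End ℝ V) (a : ℕ) : Prop where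
  idem : P * P = P
  range_eq : LinearMap.range P = LinearMap.ker (A ^ a)
  ker_eq : LinearMap.ker P = LinearMap.range (A ^ a)

/-- One step of stabilization propagates to all later exponents. At the exponent `2a` it shows that
kernel and image of `A ^ a` meet trivially, and writing `A ^ a v = A ^ (2a) u` gives `v - A ^ a u ∈
ker A ^ a`, so together they span. -/
lemma exists_isFittingProjection {A : Module.End ℝ V} {a : ℕ}
    (hk : ∀ v, (A ^ (a + 1)) v = 0 → (A ^ a) v = 0) (hr : ∀ v, ∃ u, (A ^ a) v = (A ^ (a + 1)) u) :
    ∃ P, IsFittingProjection A P a := by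
  have hk' : ∀ j v, (A ^ (a + j)) v = 0 → (A ^ a) v = 0 := by
    intro j
    induction j with
    | zero => exact fun v h => h
    | succ j ih =>
      intro v h
      apply ih
      rw [show a + (j + 1) = j + (a + 1) by ring, pow_add, ] at h
      have h2 : (A ^ (a + 1)) ((A ^ j) v) = 0 := by
        rw [← Module.End.mul_apply, ← pow_add, show a + 1 + j = j + (a + 1) by ring, pow_add]
        exact h
      have := hk _ h2
      rwa [← Module.End.mul_apply, ← pow_add] at this
  have hr' : ∀ j v, ∃ u, (A ^ a) v = (A ^ (a + j)) u := by
    intro j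
    induction j with
    | zero => exact fun v => ⟨v, rfl⟩
    | succ j ih =>
      intro v
      obtain ⟨u, hu⟩ := ih v
      obtain ⟨w, hw⟩ := hr u
      refine ⟨w, ?_⟩
      rw [hu, show a + j = j + a by ring, pow_add, Module.End.mul_apply, hw,
        ← Module.End.mul_apply, ← pow_add]
      congr 2; omega
  have hc : IsCompl (LinearMap.ker (A ^ a)) (LinearMap.range (A ^ a)) := by
    constructor
    · rw [Submodule.disjoint_def]
      rintro _ hx ⟨u, rfl⟩
      rw [LinearMap.mem_ker, ← Module.End.mul_apply, ← pow_add] at hx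
      exact hk' a u hx
    · rw [codisjoint_iff, eq_top_iff]
      intro v _
      obtain ⟨u, hu⟩ := hr' a v
      rw [← sub_add_cancel v ((A ^ a) u)]
      refine Submodule.add_mem_sup ?_ ⟨u, rfl⟩
      rw [LinearMap.mem_ker, map_sub, hu, pow_add]
      simp
  refine ⟨(LinearMap.ker (A ^ a)).projection _ hc, ?_, ?_, ?_⟩
  · exact Submodule.isIdempotentElem_projection hc
  · exact Submodule.range_projection hc
  · exact Submodule.ker_projection hc

namespace IsFittingProjection
variable {A P : Module.End ℝ V} {a : ℕ} (h : IsFittingProjection A P a)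
include h

lemma apply_idem (v : V) : P (P v) = P v := LinearMap.congr_fun h.idem v

lemma mem_ker_pow (v : V) : (A ^ a) (P v) = 0 := by
  have : P v ∈ LinearMap.ker (A ^ a) := h.range_eq ▸ ⟨v, rfl⟩
  exact this

lemma apply_pow (v : V) : P ((A ^ a) v) = 0 := by
  have : (A ^ a) v ∈ LinearMap.ker P := h.ker_eq ▸ ⟨v, rfl⟩
  exact this

lemma apply_of_pow_eq_zero {v : V} (hv : (A ^ a) v = 0) : P v = v := by
  have : v ∈ LinearMap.range P := h.range_eq ▸ hv
  obtain ⟨u, rfl⟩ := this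
  exact h.apply_idem u

lemma exists_pow_eq_sub (v : V) : ∃ u, v - P v = (A ^ a) u := by
  have : v - P v ∈ LinearMap.ker P := by rw [LinearMap.mem_ker, map_sub, h.apply_idem, sub_self]
  rw [h.ker_eq] at this
  obtain ⟨u, hu⟩ := this
  exact ⟨u, hu.symm⟩

/-- `C` preserves both the kernel and the image of `A ^ a`, the two summands that determine `P`. -/
lemma commute {C : Module.End ℝ V} (hC : Commute C A) : Commute P C := by
  ext v
  have hCa : ∀ u, C ((A ^ a) u) = (A ^ a) (C u) := fun u =>
    LinearMap.congr_fun (hC.pow_right a).eq u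
  obtain ⟨u, hu⟩ := h.exists_pow_eq_sub v
  rw [sub_eq_iff_eq_add] at hu
  rw [Module.End.mul_apply, Module.End.mul_apply]
  conv_lhs => rw [hu]
  rw [map_add, map_add, hCa, h.apply_pow, zero_add, h.apply_of_pow_eq_zero]
  rw [← hCa, h.mem_ker_pow, map_zero]

/-- On `ker A ^ a` the operator `π(A)` is the identity since `π` is `1` modulo `X ^ a`; on `Im A ^
a` it is a multiple of `X ^ a ρ` evaluated at `A`, which `T` kills. The annihilation is required
only after applying `T`, because for differential operators it holds only after evaluation at a
point. -/
lemma eq_aeval {T : V →ₗ[ℝ] W} {ρ π : ℝ[X]} (hT : ∀ v, T (aeval A (X ^ a * ρ) v) = 0)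
    (h0 : X ^ a ∣ π - 1) (h1 : ρ ∣ π) (v : V) : T (P v) = T (aeval A π v) := by
  obtain ⟨u, hu⟩ := h.exists_pow_eq_sub v
  rw [sub_eq_iff_eq_add] at hu
  have e0 : aeval A π (P v) = P v := by
    obtain ⟨q, hq⟩ := h0
    rw [sub_eq_iff_eq_add] at hq
    rw [hq, mul_comm]
    simp [h.mem_ker_pow]
  have e1 : T (aeval A π ((A ^ a) u)) = 0 := by
    obtain ⟨q, rfl⟩ := h1
    have := hT (aeval A q u)
    rw [← Module.End.mul_apply, ← map_mul] at this
    rw [show A ^ a = aeval A (X ^ a : ℝ[X]) by simp, ← Module.End.mul_apply, ← map_mul]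
    rw [show X ^ a * ρ * q = ρ * q * X ^ a by ring] at this
    exact this
  conv_rhs => rw [hu, map_add, map_add, e1, zero_add, e0]

end IsFittingProjection

/-- After base change the real quadratic polynomial splits as `(z - A) (conj z - A)`, and a factor
of a unit is a unit when the factors commute. Invertibility over `ℂ` is thus decided by a real
operator. -/
lemma isUnit_sub_baseChange {A : Module.End ℝ V} {z : ℂ}
    (h : IsUnit (aeval A (X ^ 2 - C (2 * z.re) * X + C (Complex.normSq z) : ℝ[X]))) :
    z ∈ resolventSet ℂ (A.baseChange ℂ : Module.End ℂ (ℂ ⊗[ℝ] V)) := by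
  rw [spectrum.mem_resolventSet_iff]
  have h1 := h.map (Module.End.baseChangeHom ℝ ℂ V)
  set A' : Module.End ℂ (ℂ ⊗[ℝ] V) := A.baseChange ℂ with hA'
  have e : Module.End.baseChangeHom ℝ ℂ V A = A' := rfl
  rw [← aeval_algHom_apply, e] at h1
  have h2 : aeval A' (X ^ 2 - C (2 * z.re) * X + C (Complex.normSq z) : ℝ[X]) =
      (algebraMap ℂ _ z - A') * (algebraMap ℂ _ (starRingEnd ℂ z) - A') := by
    have hz : z * starRingEnd ℂ z = (Complex.normSq z : ℂ) := Complex.mul_conj z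
    have hz2 : z + starRingEnd ℂ z = ((2 * z.re : ℝ) : ℂ) := Complex.add_conj z
    simp only [map_add, map_sub, map_mul, map_pow, aeval_X, aeval_C]
    rw [IsScalarTower.algebraMap_apply ℝ ℂ _ (Complex.normSq z), Complex.coe_algebraMap, ← hz,
      ← map_mul (algebraMap ℝ _), IsScalarTower.algebraMap_apply ℝ ℂ _ (2 * z.re),
      Complex.coe_algebraMap, ← hz2]
    simp only [map_add, map_mul]
    rw [sub_mul, mul_sub, mul_sub, ← Algebra.commutes (starRingEnd ℂ z) A', add_mul]
    noncomm_ring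
  rw [h2] at h1
  have hc : Commute (algebraMap ℂ _ z - A') (algebraMap ℂ _ (starRingEnd ℂ z) - A') := by
    apply Commute.sub_left
    · exact Algebra.commute_algebraMap_left _ _
    · exact (Algebra.commute_algebraMap_right _ _).sub_right (Commute.refl A')
  exact (hc.isUnit_mul_iff.1 h1).1

end LinearAlgebra

/-! ### Contour integrals of resolvents as residues. -/

section Contour
open Polynomial
variable {V W : Type*} [AddCommGroup V] [Module ℝ V] [AddCommGroup W] [Module ℝ W]

lemma Module.Dual.baseChange_tmul_one (l : Module.Dual ℝ V) (v : V) :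
    Module.Dual.baseChange ℂ l ((1 : ℂ) ⊗ₜ v) = (l v : ℂ) := by simp

lemma resolvent_apply_eq_iff {U : Type*} [AddCommGroup U] [Module ℂ U] {A : Module.End ℂ U} {z : ℂ}
    (hz : z ∈ resolventSet ℂ A) (u v : U) :
    resolvent A z u = v ↔ u = z • v - A v := by
  have h1 : resolvent A z * (algebraMap ℂ _ z - A) = 1 := Ring.inverse_mul_cancel _ hz
  have h2 : (algebraMap ℂ _ z - A) * resolvent A z = 1 := Ring.mul_inverse_cancel _ hz
  have e : ∀ w, z • w - A w = (algebraMap ℂ (Module.End ℂ U) z - A) w := fun w => by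
    simp [Module.algebraMap_end_apply]
  rw [e]
  constructor
  · rintro rfl
    rw [← Module.End.mul_apply, h2]; rfl
  · rintro rfl
    rw [← Module.End.mul_apply, h1]; rfl

/-- The Neumann series of the resolvent at `0` terminates on a vector killed by `A ^ a`; multiplying
the partial sums by `z - A` telescopes. -/
lemma resolvent_apply_of_pow_eq_zero {A : Module.End ℝ V} {a : ℕ} {v : V} (hv : (A ^ a) v = 0)
    {z : ℂ} (hz : z ∈ resolventSet ℂ (A.baseChange ℂ : Module.End ℂ (ℂ ⊗[ℝ] V))) (hz0 : z ≠ 0) :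
    resolvent (A.baseChange ℂ : Module.End ℂ (ℂ ⊗[ℝ] V)) z (1 ⊗ₜ v) =
      ∑ j ∈ Finset.range a, (z ^ (-(j + 1 : ℤ))) ⊗ₜ[ℝ] (A ^ j) v := by
  rw [resolvent_apply_eq_iff hz]
  have key : ∀ b : ℕ, z • ∑ j ∈ Finset.range b, (z ^ (-(j + 1 : ℤ))) ⊗ₜ[ℝ] (A ^ j) v -
      (A.baseChange ℂ) (∑ j ∈ Finset.range b, (z ^ (-(j + 1 : ℤ))) ⊗ₜ[ℝ] (A ^ j) v) =
      1 ⊗ₜ v - (z ^ (-(b : ℤ))) ⊗ₜ[ℝ] (A ^ b) v := by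
    intro b
    induction b with
    | zero => simp
    | succ b ih =>
      rw [Finset.sum_range_succ, smul_add, map_add, add_sub_add_comm, ih]
      have e1 : z • ((z ^ (-(b + 1 : ℤ))) ⊗ₜ[ℝ] (A ^ b) v) = (z ^ (-(b : ℤ))) ⊗ₜ[ℝ] (A ^ b) v := by
        rw [TensorProduct.smul_tmul', smul_eq_mul, ← zpow_one_add₀ hz0]
        congr 2; omega
      rw [e1, LinearMap.baseChange_tmul, pow_succ' A, Module.End.mul_apply]
      push_cast
      abel
  rw [key, hv]
  simp

/-- The value of the contour integral of a resolvent, for a functional that only sees a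
finite-dimensional quotient on which the spectrum inside the contour is `{0}`. -/
lemma isContourValue_of_annihilating {A : Module.End ℝ V} {ε : ℝ} (hε : 0 < ε)
    (hA : CircleInResolventSet A ε) {T : V →ₗ[ℝ] W} {a : ℕ} {ρ : ℝ[X]}
    (hρ : ∀ z : ℂ, ‖z‖ ≤ ε → aeval z ρ ≠ 0) (hT : ∀ v, T (aeval A (X ^ a * ρ) v) = 0)
    {v v₀ u : V} (h0 : (A ^ a) v₀ = 0) (hv : v - v₀ = (A ^ a) u) :
    IsContourValue A ε T v (T v₀) := by
  intro l
  set A' : Module.End ℂ (ℂ ⊗[ℝ] V) := A.baseChange ℂ with hA'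
  set lam := l ∘ₗ T with hlam
  have hlamC : ∀ x, Module.Dual.baseChange ℂ lam (aeval A' (X ^ a * ρ) x) = 0 := by
    intro x
    have e : aeval A' (X ^ a * ρ) = (aeval A (X ^ a * ρ)).baseChange ℂ := by
      change aeval (Module.End.baseChangeHom ℝ ℂ V A) _ = Module.End.baseChangeHom ℝ ℂ V _
      rw [aeval_algHom_apply]
    rw [e]
    induction x with
    | zero => simp
    | tmul c w =>
      rw [LinearMap.baseChange_tmul, Module.Dual.baseChange_apply_tmul, hlam, LinearMap.comp_apply,
        hT, map_zero, zero_smul]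
    | add x y hx hy => rw [map_add, map_add, hx, hy, add_zero]
  -- `g z` is the functional applied to the divided difference `(ρ(z) - ρ(A)) / (z - A)` at `v -
  -- v₀`, a polynomial in `z`.
  set g : ℂ → ℂ := fun z => ∑ i ∈ Finset.range (ρ.natDegree + 1), (ρ.coeff i : ℂ) *
    ∑ j ∈ Finset.range i, z ^ j * (lam ((A ^ (i - 1 - j)) (v - v₀)) : ℂ) with hg
  set h : ℂ → ℂ := fun z => (∑ j ∈ Finset.range a, (z ^ (-(j + 1 : ℤ))) * (lam ((A ^ j) v₀) : ℂ)) +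
    g z / aeval z ρ with hh
  have hz0 : ∀ z : ℂ, ‖z‖ = ε → z ≠ 0 := fun z hz h => by
    rw [h, norm_zero] at hz; exact hε.ne hz
  have hval : ∀ z : ℂ, ‖z‖ = ε → Module.Dual.baseChange ℂ lam (resolvent A' z (1 ⊗ₜ v)) = h z := by
    intro z hz
    have hzr := hA z hz
    have hsplit : (1 : ℂ) ⊗ₜ[ℝ] v = 1 ⊗ₜ v₀ + 1 ⊗ₜ (v - v₀) := by
      rw [← TensorProduct.tmul_add]; congr 1; abel
    rw [hsplit, map_add, map_add, resolvent_apply_of_pow_eq_zero h0 hzr (hz0 z hz)]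
    simp only [hh]
    congr 1
    · rw [map_sum]
      refine Finset.sum_congr rfl fun j _ => ?_
      simp [hlam, mul_comm]
    · rw [eq_div_iff (hρ z hz.le)]
      set D : Module.End ℂ (ℂ ⊗[ℝ] V) := algebraMap ℂ _ z - A' with hD
      set R := resolvent A' z with hR
      have hRD : R * D = 1 := Ring.inverse_mul_cancel _ hzr
      have hDR : D * R = 1 := Ring.mul_inverse_cancel _ hzr
      have hcomm : Commute A' R := by
        have : Commute A' D := (Algebra.commute_algebraMap_right _ _).sub_right (Commute.refl A')
        calc A' * R = R * D * A' * R := by rw [hRD, one_mul]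
          _ = R * (A' * D) * R := by rw [this.eq, mul_assoc R]
          _ = R * A' := by rw [mul_assoc, mul_assoc, hDR, mul_one]
      have hcommp : ∀ p : ℝ[X], Commute (aeval A' p) R := fun p => by
        induction p using Polynomial.induction_on' with
        | add p q hp hq => rw [map_add]; exact hp.add_left hq
        | monomial n r =>
          rw [aeval_monomial]
          refine Commute.mul_left ?_ (hcomm.pow_left n)
          rw [IsScalarTower.algebraMap_apply ℝ ℂ]
          exact Algebra.commute_algebraMap_left _ _
      -- Since `v - v₀ = A ^ a u`, the factor `ρ(A)` becomes `X ^ a ρ` evaluated at `A`, which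
      -- commutes with the resolvent and is killed by the functional. So the resolvent on `v - v₀`
      -- is seen only as `g z / ρ(z)`.
      have hzero : Module.Dual.baseChange ℂ lam (R (aeval A' ρ (1 ⊗ₜ (v - v₀)))) = 0 := by
        have e1 : (1 : ℂ) ⊗ₜ[ℝ] (v - v₀) = (A' ^ a) (1 ⊗ₜ u) := by
          rw [hv]
          have : A' ^ a = (A ^ a).baseChange ℂ := by
            change (Module.End.baseChangeHom ℝ ℂ V A) ^ a = Module.End.baseChangeHom ℝ ℂ V (A ^ a)
            rw [map_pow]
          rw [this, LinearMap.baseChange_tmul]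
        have := hlamC (R (1 ⊗ₜ u))
        rw [← Module.End.mul_apply, (hcommp _).eq, Module.End.mul_apply] at this
        rw [e1, ← Module.End.mul_apply (aeval A' ρ)]
        convert this using 4
        rw [map_mul, map_pow, aeval_X]
        have := (Commute.all ρ (X ^ a : ℝ[X])).map (aeval A')
        rw [map_pow, aeval_X] at this
        exact this.eq
      have hdiff : algebraMap ℂ (Module.End ℂ (ℂ ⊗[ℝ] V)) (aeval z ρ) - aeval A' ρ =
          D * ∑ i ∈ Finset.range (ρ.natDegree + 1), (ρ.coeff i : ℂ) •
            ∑ j ∈ Finset.range i, (algebraMap ℂ (Module.End ℂ (ℂ ⊗[ℝ] V)) z) ^ j * A' ^ (i - 1 - j) := by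
        rw [aeval_eq_sum_range, aeval_eq_sum_range, map_sum, ← Finset.sum_sub_distrib,
          Finset.mul_sum]
        refine Finset.sum_congr rfl fun i _ => ?_
        rw [mul_smul_comm, (Algebra.commute_algebraMap_left z A').mul_geom_sum₂, smul_sub]
        congr 1
        rw [← map_pow, Algebra.smul_def, map_mul]
        rfl
      have h3 : R (aeval z ρ • (1 : ℂ) ⊗ₜ[ℝ] (v - v₀)) - R (aeval A' ρ (1 ⊗ₜ (v - v₀))) =
          (∑ i ∈ Finset.range (ρ.natDegree + 1), (ρ.coeff i : ℂ) •
            ∑ j ∈ Finset.range i, (algebraMap ℂ (Module.End ℂ (ℂ ⊗[ℝ] V)) z) ^ j * A' ^ (i - 1 - j))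
            (1 ⊗ₜ (v - v₀)) := by
        rw [← map_sub]
        have : aeval z ρ • (1 : ℂ) ⊗ₜ[ℝ] (v - v₀) - aeval A' ρ (1 ⊗ₜ (v - v₀)) =
            (algebraMap ℂ (Module.End ℂ (ℂ ⊗[ℝ] V)) (aeval z ρ) - aeval A' ρ) (1 ⊗ₜ (v - v₀)) := by
          rw [LinearMap.sub_apply, Module.algebraMap_end_apply]
        rw [this, hdiff, ← Module.End.mul_apply, ← mul_assoc, hRD, one_mul]
      have h4 := congrArg (Module.Dual.baseChange ℂ lam) h3
      rw [map_sub, hzero, sub_zero, map_smul, map_smul, smul_eq_mul, mul_comm] at h4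
      rw [h4, hg]
      simp only [LinearMap.sum_apply, map_sum, LinearMap.smul_apply, map_smul, smul_eq_mul]
      refine Finset.sum_congr rfl fun i _ => ?_
      congr 1
      refine Finset.sum_congr rfl fun j _ => ?_
      have : A' ^ (i - 1 - j) = (A ^ (i - 1 - j)).baseChange ℂ := by
        change (Module.End.baseChangeHom ℝ ℂ V A) ^ _ = Module.End.baseChangeHom ℝ ℂ V _
        rw [map_pow]
      rw [Module.End.mul_apply, this, LinearMap.baseChange_tmul, ← map_pow,
        Module.algebraMap_end_apply, map_smul, Module.Dual.baseChange_tmul_one, smul_eq_mul]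
  have hgd : Differentiable ℂ g := by rw [hg]; fun_prop
  have hρd : Differentiable ℂ fun z : ℂ => aeval z ρ := Polynomial.differentiable_aeval ρ
  have hgρ : ∀ z : ℂ, ‖z‖ ≤ ε → DifferentiableAt ℂ (fun z => g z / aeval z ρ) z := fun z hz =>
    (hgd z).div (hρd z) (hρ z hz)
  have hsph : ∀ z ∈ Metric.sphere (0 : ℂ) ε, ‖z‖ = ε := fun z hz => by simpa using hz
  have hci0 : ∀ j ∈ Finset.range a, CircleIntegrable
      (fun z : ℂ => (z ^ (-(j + 1 : ℤ))) * (lam ((A ^ j) v₀) : ℂ)) 0 ε := by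
    intro j _
    refine ContinuousOn.circleIntegrable hε.le fun z hz => ?_
    exact ((continuousAt_zpow₀ z _ (Or.inl (hz0 z (hsph z hz)))).mul
      continuousAt_const).continuousWithinAt
  have hci1 : CircleIntegrable (fun z => g z / aeval z ρ) 0 ε :=
    ContinuousOn.circleIntegrable hε.le fun z hz =>
      (hgρ z (hsph z hz).le).continuousAt.continuousWithinAt
  have hcis : CircleIntegrable (fun z : ℂ => ∑ j ∈ Finset.range a,
      (z ^ (-(j + 1 : ℤ))) * (lam ((A ^ j) v₀) : ℂ)) 0 ε := by
    have := CircleIntegrable.sum (Finset.range a) hci0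
    convert this using 1
    ext z; simp
  have hcih : CircleIntegrable h 0 ε := hcis.add hci1
  have heq : Set.EqOn (fun z : ℂ => Module.Dual.baseChange ℂ lam (resolvent A' z (1 ⊗ₜ v))) h
      (Metric.sphere 0 ε) := fun z hz => hval z (hsph z hz)
  refine ⟨?_, ?_⟩
  · refine hcih.congr fun θ _ => (heq ?_).symm
    exact circleMap_mem_sphere 0 hε.le θ
  · rw [circleIntegral.integral_congr hε.le heq, hh, circleIntegral.integral_add hcis hci1]
    -- Cauchy's theorem: `ρ` has no zero in the closed disc.
    have h2 : (∮ z in C(0, ε), g z / aeval z ρ) = 0 :=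
      Complex.circleIntegral_eq_zero_of_differentiable_on_off_countable hε.le
        Set.countable_empty
        (fun z hz => (hgρ z (by simpa using hz)).continuousAt.continuousWithinAt)
        (fun z hz => hgρ z (by have := hz.1; simp at this; exact this.le))
    rw [h2, add_zero]
    -- Only the simple pole `j = 0` of the terminating series has a residue, and that residue gives
    -- `v₀`.
    have h3 : ∀ j : ℕ, (∮ z in C(0, ε), (z ^ (-(j + 1 : ℤ))) * (lam ((A ^ j) v₀) : ℂ)) =
        if j = 0 then 2 * Real.pi * Complex.I * (lam v₀ : ℂ) else 0 := by
      intro j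
      have e : ∀ z : ℂ, (z ^ (-(j + 1 : ℤ))) * (lam ((A ^ j) v₀) : ℂ) =
          (lam ((A ^ j) v₀) : ℂ) • (z - 0) ^ (-(j + 1 : ℤ)) := fun z => by
        rw [smul_eq_mul, sub_zero, mul_comm]
      simp only [e, circleIntegral.integral_smul]
      split_ifs with hj
      · subst hj
        have := circleIntegral.integral_sub_center_inv (0 : ℂ) hε.ne'
        simp only [Nat.cast_zero, zero_add, zpow_neg_one, this]
        simp [mul_comm]
      · rw [circleIntegral.integral_sub_zpow_of_ne (by omega), smul_zero]
    have h4 : (∮ z in C(0, ε), ∑ j ∈ Finset.range a,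
        (z ^ (-(j + 1 : ℤ))) * (lam ((A ^ j) v₀) : ℂ)) = 2 * Real.pi * Complex.I * (lam v₀ : ℂ) := by
      rw [circleIntegral.integral_fun_sum hci0]
      simp only [h3]
      rw [Finset.sum_ite_eq' ]
      split_ifs with ha
      · rfl
      -- For `a = 0` the sum is empty, and the hypothesis `h0` reads `v₀ = 0`.
      · have : a = 0 := by simpa using ha
        subst this
        have : v₀ = 0 := h0
        simp [this]
    rw [h4]
    have : (2 * Real.pi * Complex.I : ℂ) ≠ 0 := by
      simp [Real.pi_ne_zero]
    rw [inv_mul_cancel_left₀ this]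
    rfl

lemma IsContourValue.unique {A : Module.End ℝ V} {ε : ℝ} {T : V →ₗ[ℝ] W} {v : V} {w w' : W}
    (h : IsContourValue A ε T v w) (h' : IsContourValue A ε T v w') : w = w' := by
  refine Module.forall_dual_apply_eq_zero_iff ℝ (w - w') |>.1 (fun l => ?_) |> sub_eq_zero.1
  have := (h l).2.symm.trans (h' l).2
  rw [map_sub, sub_eq_zero]
  exact_mod_cast this

end Contour

/-! ### Symmetric endomorphisms for a positive definite form. -/

section PositiveDefinite
variable {V : Type*} [AddCommGroup V] [Module ℝ V]

/-- The inner product space structure of a positive definite symmetric form. -/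
abbrev innerCore (b : LinearMap.BilinForm ℝ V) (hs : ∀ v w, b v w = b w v)
    (hp : ∀ v, v ≠ 0 → 0 < b v v) : InnerProductSpace.Core ℝ V where
  inner v w := b v w
  conj_inner_symm v w := hs w v
  re_inner_nonneg v := by
    by_cases hv : v = 0
    · simp [hv]
    · exact (hp v hv).le
  add_left u v w := by simp
  smul_left u v r := by simp
  definite v h := by
    by_contra hv
    exact (hp v hv).ne' h

variable [FiniteDimensional ℝ V] {b : LinearMap.BilinForm ℝ V} (hs : ∀ v w, b v w = b w v)
    (hp : ∀ v, v ≠ 0 → 0 < b v v)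
include hs hp

lemma exists_adjoint (T : Module.End ℝ V) : ∃ T' : Module.End ℝ V, ∀ v w, b (T v) w = b v (T' w) := by
  let c := innerCore b hs hp
  let := c.toNormedAddCommGroup
  let : InnerProductSpace ℝ V := .ofCore c.toCore
  exact ⟨LinearMap.adjoint T, fun v w => (LinearMap.adjoint_inner_right T v w).symm⟩

lemma splits_charpoly_of_symmetric {B : Module.End ℝ V} (hB : ∀ v w, b (B v) w = b v (B w)) :
    B.charpoly.Splits := by
  let c := innerCore b hs hp
  let := c.toNormedAddCommGroup
  let : InnerProductSpace ℝ V := .ofCore c.toCore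
  exact LinearMap.IsSymmetric.splits_charpoly (T := B) hB

lemma exists_orthonormal {n : ℕ} (hn : Module.finrank ℝ V = n) :
    ∃ f : Fin n → V, ∀ i j, b (f i) (f j) = if i = j then 1 else 0 := by
  let c := innerCore b hs hp
  let := c.toNormedAddCommGroup
  let : InnerProductSpace ℝ V := .ofCore c.toCore
  subst hn
  exact ⟨stdOrthonormalBasis ℝ V, orthonormal_iff_ite.1 (stdOrthonormalBasis ℝ V).orthonormal⟩

/-- If `B (B u) = 0`, symmetry gives `b (B u) (B u) = b u (B (B u)) = 0`; disjointness suffices by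
rank-nullity. -/
lemma isCompl_ker_range_of_symmetric {B : Module.End ℝ V} (hB : ∀ v w, b (B v) w = b v (B w)) :
    IsCompl (LinearMap.ker B) (LinearMap.range B) := by
  have hd : Disjoint (LinearMap.ker B) (LinearMap.range B) := by
    rw [Submodule.disjoint_def]
    rintro _ hv ⟨u, rfl⟩
    by_contra hne
    have := hp _ hne
    rw [hB, LinearMap.mem_ker.1 hv, map_zero] at this
    exact this.false
  refine (Submodule.isCompl_iff_disjoint _ _ ?_).2 hd
  have := LinearMap.finrank_range_add_finrank_ker B
  omega

lemma ker_pow_eq_of_symmetric {B : Module.End ℝ V} (hB : ∀ v w, b (B v) w = b v (B w)) (k : ℕ) :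
    LinearMap.ker (B ^ (k + 1)) = LinearMap.ker B := by
  apply le_antisymm
  · intro v hv
    induction k with
    | zero => simpa using hv
    | succ k ih =>
      apply ih
      rw [LinearMap.mem_ker, pow_succ', Module.End.mul_apply] at hv
      have h2 : (B ^ (k + 1)) v ∈ LinearMap.range B := by
        rw [pow_succ', Module.End.mul_apply]; exact ⟨_, rfl⟩
      exact Submodule.disjoint_def.1 (isCompl_ker_range_of_symmetric hs hp hB).disjoint _ hv h2
  · intro v hv
    rw [LinearMap.mem_ker, pow_succ, Module.End.mul_apply, LinearMap.mem_ker.1 hv, map_zero]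

/-- The trailing degree is the dimension of the generalized kernel, which for symmetric `B` is the
kernel. This is how a hypothesis on kernel dimensions controls the characteristic polynomial. -/
lemma natTrailingDegree_charpoly_of_symmetric {B : Module.End ℝ V}
    (hB : ∀ v w, b (B v) w = b v (B w)) :
    B.charpoly.natTrailingDegree = Module.finrank ℝ (LinearMap.ker B) := by
  have : B.maxGenEigenspace 0 = LinearMap.ker B := by
    ext v
    rw [Module.End.mem_maxGenEigenspace, zero_smul, sub_zero]
    refine ⟨fun ⟨k, hk⟩ => ?_, fun h => ⟨1, by simpa using h⟩⟩
    rw [← ker_pow_eq_of_symmetric hs hp hB k, LinearMap.mem_ker, pow_succ', Module.End.mul_apply,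
      hk, map_zero]
  rw [← LinearMap.finrank_maxGenEigenspace_zero_eq, this]

end PositiveDefinite
end FilteredManifold

end

section
open scoped Manifold ContDiff Topology TensorProduct

namespace FilteredManifold

/-! ### Alternating forms, and perturbation of a graded operator. -/

section Generic

lemma multilinear_continuous {E : Type*} [NormedAddCommGroup E] [NormedSpace ℝ E]
    [FiniteDimensional ℝ E] {k : ℕ} (f : MultilinearMap ℝ (fun _ : Fin k => E) ℝ) :
    Continuous f := by
  let b := Module.finBasis ℝ E
  have e : ∀ v : Fin k → E, f v = ∑ r : Fin k → Fin (Module.finrank ℝ E),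
      (∏ i, b.repr (v i) (r i)) • f fun i => b (r i) := by
    intro v
    conv_lhs => rw [show v = fun i => ∑ j, b.repr (v i) j • b j from
      funext fun i => (b.sum_repr (v i)).symm]
    rw [MultilinearMap.map_sum]
    exact Finset.sum_congr rfl fun r _ => MultilinearMap.map_smul_univ _ _ _
  rw [show (f : (Fin k → E) → ℝ) = _ from funext e]
  refine continuous_finsetSum _ fun r _ => Continuous.mul ?_ continuous_const
  refine continuous_finsetProd _ fun i _ => ?_
  have h1 : Continuous fun u : E => b.repr u (r i) :=
    (b.coord (r i)).continuous_of_finiteDimensional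
  exact h1.comp (continuous_apply i)

lemma alternating_sum_apply {L ι : Type*} [AddCommGroup L] [Module ℝ L] {k : ℕ}
    (S : Finset ι) (f : ι → L [⋀^Fin k]→ₗ[ℝ] ℝ) (v : Fin k → L) :
    (∑ i ∈ S, f i) v = ∑ i ∈ S, f i v := by
  classical
  induction S using Finset.induction_on with
  | empty => simp
  | insert i S hi ih => rw [Finset.sum_insert hi, Finset.sum_insert hi, AlternatingMap.add_apply, ih]

lemma alternating_eq_zero_of_finrank_lt {L : Type*} [AddCommGroup L] [Module ℝ L]
    [FiniteDimensional ℝ L] {k : ℕ} (hk : Module.finrank ℝ L < k) (f : L [⋀^Fin k]→ₗ[ℝ] ℝ) :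
    f = 0 := by
  ext v
  refine f.map_linearDependent v fun h => ?_
  have := h.fintype_card_le_finrank
  simp at this
  omega

/-- Adding an operator that raises the weights does not change the characteristic polynomial of an
operator that preserves a grading. -/
lemma charpoly_eq_of_sub_raises {U : Type*} [AddCommGroup U] [Module ℝ U] [FiniteDimensional ℝ U]
    {T S : Module.End ℝ U} {E : ℕ → Module.End ℝ U} {N : ℕ} (hE : ∀ w, Commute T (E w))
    (htop : ∀ β, (∀ w < N, E w β = 0) → β = 0)
    (hR : ∀ w β, (∀ w' < w, E w' β = 0) → ∀ w' < w + 1, E w' ((S - T) β) = 0) :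
    S.charpoly = T.charpoly := by
  -- It is enough to compare `det (t - S)` and `det (t - T)` for `t` outside the finite set of
  -- roots, where `t - T` is invertible.
  refine Polynomial.eq_of_infinite_eval_eq _ _ (Set.Infinite.mono ?_
    (Set.Finite.infinite_compl (T.charpoly.roots.toFinset.finite_toSet)))
  intro t ht
  have ht' : T.charpoly.eval t ≠ 0 := by
    intro h0
    apply ht
    simp [T.charpoly_monic.ne_zero, h0]
  rw [LinearMap.eval_charpoly] at ht'
  have hu : IsUnit (algebraMap ℝ (Module.End ℝ U) t - T) :=
    (LinearMap.isUnit_iff_isUnit_det _).2 (isUnit_iff_ne_zero.2 ht')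
  obtain ⟨D, hD⟩ := hu
  have hcomm : ∀ w, Commute (↑D⁻¹ : Module.End ℝ U) (E w) := by
    intro w
    have : Commute (D : Module.End ℝ U) (E w) := by
      rw [hD]; exact (Algebra.commute_algebraMap_left _ _).sub_left (hE w)
    exact this.units_inv_left
  -- `t - S = (t - T) (1 - K)`. The inverse of `t - T` commutes with the weight projections, so `K`
  -- raises weights; being nilpotent, it satisfies `det (1 - K) = 1`.
  set K : Module.End ℝ U := ↑D⁻¹ * (S - T) with hK
  have hKw : ∀ j β, ∀ w < j, E w ((K ^ j) β) = 0 := by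
    intro j
    induction j with
    | zero => simp
    | succ j ih =>
      intro β w hw
      rw [pow_succ', hK, Module.End.mul_apply, Module.End.mul_apply, ← Module.End.mul_apply (E w),
        ← (hcomm w).eq, Module.End.mul_apply, hR j _ (ih β) w hw, map_zero]
  have hnil : IsNilpotent K := ⟨N, by ext β; exact htop _ (hKw N β)⟩
  have h1 := congrArg (Polynomial.eval 1) hnil.charpoly_eq_X_pow_finrank
  rw [LinearMap.eval_charpoly] at h1
  simp only [map_one, Polynomial.eval_pow, Polynomial.eval_X, one_pow] at h1
  change S.charpoly.eval t = T.charpoly.eval t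
  rw [LinearMap.eval_charpoly, LinearMap.eval_charpoly]
  have h2 : algebraMap ℝ (Module.End ℝ U) t - S = (algebraMap ℝ (Module.End ℝ U) t - T) * (1 - K) := by
    rw [mul_sub, mul_one, hK, ← mul_assoc, ← hD, Units.mul_inv, one_mul, hD]
    abel
  rw [h2, map_mul, h1, mul_one]

end Generic

/-! ### Weights on a single fibre of the bundle of forms. -/

section Fibre
variable {n : ℕ} {M : Type*} [TopologicalSpace M] [ChartedSpace (EuclideanSpace ℝ (Fin n)) M]
  [IsManifold (𝓡 n) ∞ M]

instance finiteDimensional_tan (x : M) : FiniteDimensional ℝ (Tan n x) :=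
  inferInstanceAs (FiniteDimensional ℝ (EuclideanSpace ℝ (Fin n)))

lemma finrank_tan (x : M) : Module.finrank ℝ (Tan n x) = n :=
  (finrank_euclideanSpace_fin : Module.finrank ℝ (EuclideanSpace ℝ (Fin n)) = n)

lemma cov_eq_zero {k : ℕ} (hk : n < k) {x : M} (a : Cov n k x) : a = 0 := by
  have := alternating_eq_zero_of_finrank_lt (L := Tan n x) (by rwa [finrank_tan]) a.toAlternatingMap
  ext v
  exact DFunLike.congr_fun this v

namespace TangentFiltration
variable (F : TangentFiltration n M)

lemma H_mono {i j : ℕ} (h : i ≤ j) (x : M) : F.H i x ≤ F.H j x :=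
  monotone_nat_of_le_succ (f := fun i => F.H i x) (fun i => F.mono i x) h

variable {F} in
-- The arguments are exchanged one at a time: each exchange changes the value by `a` on a tuple in
-- which one weight has dropped by one, so that the total is below `w`.
lemma apply_eq_of_mem_fiberGE {w : ℕ} {x : M} {a : FormFiber n x} (ha : a ∈ F.fiberGE w x) {k : ℕ}
    {i : Fin k → ℕ} {v v' : Fin k → Tan n x} (hv : ∀ l, v l ∈ F.H (i l + 1) x)
    (hv' : ∀ l, v' l - v l ∈ F.H (i l) x) (hw : ∑ l, (i l + 1) ≤ w) : a k v' = a k v := by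
  classical
  have key : ∀ S : Finset (Fin k), a k (S.piecewise v' v) = a k v := by
    intro S
    induction S using Finset.induction_on with
    | empty => simp
    | insert l S hl ih =>
      rw [Finset.piecewise_insert, ← ih]
      have hu : S.piecewise v' v = Function.update (S.piecewise v' v) l (v l) := by
        conv_lhs => rw [← Function.update_eq_self l (S.piecewise v' v)]
        rw [Finset.piecewise_eq_of_notMem _ _ _ hl]
      rw [← sub_eq_zero]
      conv_lhs => rw [hu]
      rw [Function.update_idem, ← ContinuousAlternatingMap.map_update_sub]
      have hmem : ∀ m, S.piecewise v' v m ∈ F.H (i m + 1) x := by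
        intro m
        by_cases hm : m ∈ S
        · rw [Finset.piecewise_eq_of_mem _ _ _ hm, ← sub_add_cancel (v' m) (v m)]
          exact Submodule.add_mem _ (F.mono _ _ (hv' m)) (hv m)
        · rw [Finset.piecewise_eq_of_notMem _ _ _ hm]; exact hv m
      refine ha k (Function.update (fun m => i m + 1) l (i l)) _ ?_ ?_
      · intro m
        by_cases hm : m = l
        · subst hm; simpa using hv' m
        · simpa [Function.update_of_ne hm] using hmem m
      · refine lt_of_lt_of_le (Finset.sum_lt_sum ?_ ⟨l, Finset.mem_univ _, ?_⟩) hw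
        · intro m _
          by_cases hm : m = l
          · subst hm; simp
          · simp [Function.update_of_ne hm]
        · simp
  have := key Finset.univ
  rwa [Finset.piecewise_univ] at this

/-- Only tuples of total weight exactly `w` matter. A weight `0` forces a zero vector, and a weight
above `s` may be lowered to `s`, which brings the total below `w`; on the remaining tuples the value
is read off from the class. -/
lemma mem_fiberGE_succ {w : ℕ} {x : M} {a : FormFiber n x} (ha : a ∈ F.fiberGE w x)
    (h0 : F.IsClass w x a 0) : a ∈ F.fiberGE (w + 1) x := by
  intro k i v hv hw
  rcases Nat.lt_succ_iff_lt_or_eq.1 hw with hw | hw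
  · exact ha k i v hv hw
  by_cases h1 : ∃ l, i l = 0
  · obtain ⟨l, hl⟩ := h1
    have := hv l
    rw [hl, F.zero, Submodule.mem_bot] at this
    exact (a k).map_coord_zero l this
  push Not at h1
  by_cases h2 : ∃ l, F.s < i l
  · obtain ⟨l, hl⟩ := h2
    refine ha k (Function.update i l F.s) v ?_ ?_
    · intro m
      by_cases hm : m = l
      · subst hm; simp [F.top F.s le_rfl]
      · rw [Function.update_of_ne hm]; exact hv m
    · rw [← hw]
      refine Finset.sum_lt_sum ?_ ⟨l, Finset.mem_univ _, by simpa using hl⟩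
      intro m _
      by_cases hm : m = l
      · subst hm; simpa using hl.le
      · simp [Function.update_of_ne hm]
  push Not at h2
  have hi : ∀ l, i l - 1 + 1 = i l := fun l => Nat.succ_pred (h1 l)
  have := h0 k (fun l => ⟨i l - 1, by have := h2 l; have := hi l; omega⟩)
    (fun l => ⟨v l, by change v l ∈ F.H (i l - 1 + 1) x; rw [hi]; exact hv l⟩)
  rw [if_pos (by simpa only [hi] using hw)] at this
  exact this.symm

lemma sum_weights_le {k : ℕ} (hk : k ≤ n) (j : Fin k → Fin F.s) :
    ∑ l, ((j l : ℕ) + 1) ≤ n * F.s :=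
  calc ∑ l, ((j l : ℕ) + 1) ≤ ∑ _l : Fin k, F.s := Finset.sum_le_sum fun l _ => (j l).2
    _ = k * F.s := by simp
    _ ≤ n * F.s := Nat.mul_le_mul_right _ hk

lemma fiberGE_anti {w w' : ℕ} (h : w ≤ w') (x : M) : F.fiberGE w' x ≤ F.fiberGE w x :=
  fun _ ha k i v hv hw => ha k i v hv (hw.trans_le h)

lemma fiberGE_zero (x : M) : F.fiberGE 0 x = ⊤ :=
  eq_top_iff.2 fun _ _ _ _ _ _ hw => absurd hw (Nat.not_lt_zero _)

/-- No form of degree above `n` is nonzero and every vector has weight at most `s`, so `n * s`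
bounds all weights. This is the source of the recurring `n * F.s + 1`. -/
lemma fiberGE_top (x : M) : F.fiberGE (n * F.s + 1) x = ⊥ := by
  rw [eq_bot_iff]
  intro a ha
  rw [Submodule.mem_bot]
  funext k
  by_cases hk : n < k
  · exact cov_eq_zero hk _
  · ext v
    refine ha k (fun _ => F.s) v (fun l => by rw [F.top F.s le_rfl]; trivial) ?_
    simp only [Finset.sum_const, Finset.card_univ, Fintype.card_fin, smul_eq_mul]
    exact Nat.lt_succ_of_le (Nat.mul_le_mul_right _ (not_lt.1 hk))

/-! ### The splitting of the filtration and the grading of osculating forms. -/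

section Osc
variable (g : Bundle.ContMDiffRiemannianMetric (𝓡 n) ∞ (EuclideanSpace ℝ (Fin n))
  (fun x : M => Tan n x)) (x : M)

/-- The isomorphism `g_x M → T_x M` given by the orthogonal splitting of the filtration. -/
def oscToTan : F.Osc x →ₗ[ℝ] Tan n x := ∑ j, F.orthLift g x j ∘ₗ LinearMap.proj j

lemma oscToTan_apply (u : F.Osc x) : F.oscToTan g x u = ∑ j, F.orthLift g x j (u j) := by
  simp [oscToTan]

lemma orthLift_orthogonal (j : Fin F.s) (u : (F.H (j + 1) x) ⧸ (F.H j x).submoduleOf (F.H (j + 1) x))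
    {h : Tan n x} (hh : h ∈ F.H j x) : g.inner x h (F.orthLift g x j u) = 0 := by
  obtain ⟨v, rfl⟩ := Submodule.Quotient.mk_surjective _ u
  exact Submodule.projection_apply_mem (isCompl_orthogonal g x (F.H j x)).symm _ h hh

lemma orthLift_mk_sub_mem (j : Fin F.s) (v : F.H (j + 1) x) :
    F.orthLift g x j (Submodule.Quotient.mk v) - v ∈ F.H j x := by
  have h := (isCompl_orthogonal g x (F.H j x)).symm
  have h1 := Submodule.projection_add_projection_eq_self h (v : Tan n x)
  have h2 := Submodule.projection_apply_mem h.symm (v : Tan n x)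
  have h3 : F.orthLift g x j (Submodule.Quotient.mk v) =
    ((g.inner x).toBilinForm.orthogonal (F.H j x)).projection (F.H j x) h (v : Tan n x) := rfl
  rw [h3]
  have h4 : ((g.inner x).toBilinForm.orthogonal (F.H j x)).projection (F.H j x) h (v : Tan n x) - v =
    - (F.H j x).projection _ h.symm (v : Tan n x) := by
    rw [sub_eq_iff_eq_add, ← sub_eq_neg_add, eq_sub_iff_add_eq]
    exact h1
  rw [h4]
  exact Submodule.neg_mem _ h2

lemma orthLift_mem (j : Fin F.s) (u : (F.H (j + 1) x) ⧸ (F.H j x).submoduleOf (F.H (j + 1) x)) :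
    F.orthLift g x j u ∈ F.H (j + 1) x := by
  obtain ⟨v, rfl⟩ := Submodule.Quotient.mk_surjective _ u
  rw [← sub_add_cancel (F.orthLift g x j (Submodule.Quotient.mk v)) (v : Tan n x)]
  exact Submodule.add_mem _ (F.mono _ _ (F.orthLift_mk_sub_mem g x j v)) v.2

lemma inner_orthLift_of_ne {i j : Fin F.s} (hij : i ≠ j) (u v) :
    g.inner x (F.orthLift g x i u) (F.orthLift g x j v) = 0 := by
  rcases lt_or_gt_of_ne hij with h | h
  · exact F.orthLift_orthogonal g x j v (F.H_mono (by exact h) x (F.orthLift_mem g x i u))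
  · rw [g.symm]
    exact F.orthLift_orthogonal g x i u (F.H_mono (by exact h) x (F.orthLift_mem g x j v))

lemma oscInner_eq (u v : F.Osc x) :
    F.oscInner g x u v = g.inner x (F.oscToTan g x u) (F.oscToTan g x v) := by
  rw [oscToTan_apply, oscToTan_apply, oscInner]
  simp only [map_sum, sum_apply]
  refine Finset.sum_congr rfl fun i _ => ?_
  rw [Finset.sum_eq_single i]
  · intro j _ hj; exact F.inner_orthLift_of_ne g x hj _ _
  · simp

lemma orthLift_injective (j : Fin F.s) : Function.Injective (F.orthLift g x j) := by
  rw [← LinearMap.ker_eq_bot, eq_bot_iff]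
  intro u hu
  obtain ⟨v, rfl⟩ := Submodule.Quotient.mk_surjective _ u
  have := F.orthLift_mk_sub_mem g x j v
  rw [LinearMap.mem_ker.1 hu, zero_sub, Submodule.neg_mem_iff] at this
  rw [Submodule.mem_bot, Submodule.Quotient.mk_eq_zero]
  exact this

lemma oscInner_self_pos {u : F.Osc x} (hu : u ≠ 0) : 0 < F.oscInner g x u u := by
  have hnn : ∀ j, 0 ≤ g.inner x (F.orthLift g x j (u j)) (F.orthLift g x j (u j)) := by
    intro j
    by_cases h : F.orthLift g x j (u j) = 0
    · simp [h]
    · exact (g.pos x _ h).le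
  obtain ⟨j, hj⟩ := Function.ne_iff.1 hu
  refine Finset.sum_pos' (fun j _ => hnn j) ⟨j, Finset.mem_univ _, g.pos x _ fun h => hj ?_⟩
  apply F.orthLift_injective g x j
  rw [h]; exact (map_zero _).symm

lemma oscToTan_injective : Function.Injective (F.oscToTan g x) := by
  rw [← LinearMap.ker_eq_bot, eq_bot_iff]
  intro u hu
  by_contra hne
  have := F.oscInner_self_pos g x hne
  rw [oscInner_eq, LinearMap.mem_ker.1 hu] at this
  simp at this

lemma oscToTan_cls_sub_mem (j : Fin F.s) (v : F.H (j + 1) x) :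
    F.oscToTan g x (F.cls x j v) - v ∈ F.H j x := by
  have : F.oscToTan g x (F.cls x j v) = F.orthLift g x j (Submodule.Quotient.mk v) := by
    rw [oscToTan_apply, Finset.sum_eq_single j]
    · simp [cls]
    · intro i _ hi
      simp [cls, hi]
    · simp
  rw [this]
  exact F.orthLift_mk_sub_mem g x j v

lemma H_le_range_oscToTan (i : ℕ) : F.H i x ≤ LinearMap.range (F.oscToTan g x) := by
  induction i with
  | zero => rw [F.zero]; exact bot_le
  | succ i ih =>
    intro v hv
    by_cases hi : i < F.s
    · have h1 := ih (F.oscToTan_cls_sub_mem g x ⟨i, hi⟩ ⟨v, hv⟩)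
      have h2 := Submodule.sub_mem _ (LinearMap.mem_range_self (F.oscToTan g x)
        (F.cls x ⟨i, hi⟩ ⟨v, hv⟩)) h1
      simpa using h2
    · apply ih
      rw [F.top i (not_lt.1 hi)]; trivial

lemma oscToTan_surjective : Function.Surjective (F.oscToTan g x) := fun v =>
  F.H_le_range_oscToTan g x F.s (by rw [F.top F.s le_rfl]; trivial)

/-- `oscToTan` as a linear isomorphism. -/
def oscEquiv : F.Osc x ≃ₗ[ℝ] Tan n x :=
  LinearEquiv.ofBijective _ ⟨F.oscToTan_injective g x, F.oscToTan_surjective g x⟩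

include g in
lemma finrank_osc : Module.finrank ℝ (F.Osc x) = n := by
  rw [(F.oscEquiv g x).finrank_eq, finrank_tan]

/-- The pull-back `∧^• T_x^* M → ∧^• g_x^* M` by `oscToTan`. -/
def pullOsc : FormFiber n x ≃ₗ[ℝ] F.OscForms x where
  toFun a k := (a k).toAlternatingMap.compLinearMap (F.oscToTan g x)
  map_add' a b := rfl
  map_smul' r a := rfl
  invFun β k :=
    { (β k).compLinearMap (F.oscEquiv g x).symm.toLinearMap with
      cont := multilinear_continuous (E := EuclideanSpace ℝ (Fin n))
        ((β k).compLinearMap (F.oscEquiv g x).symm.toLinearMap).toMultilinearMap }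
  left_inv a := by
    funext k
    ext v
    change a k (fun l => F.oscEquiv g x ((F.oscEquiv g x).symm (v l))) = a k v
    simp
  right_inv β := by
    funext k
    ext v
    change β k (fun l => (F.oscEquiv g x).symm (F.oscEquiv g x (v l))) = β k v
    simp

lemma pullOsc_apply (a : FormFiber n x) (k : ℕ) (u : Fin k → F.Osc x) :
    F.pullOsc g x a k u = a k fun l => F.oscToTan g x (u l) := rfl

instance finiteDimensional_osc : FiniteDimensional ℝ (F.Osc x) := inferInstance

variable {F x} in
lemma oscForms_ext {β γ : F.OscForms x} (h : ∀ (k : ℕ) (j : Fin k → Fin F.s)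
    (v : ∀ l, F.H (j l + 1) x), β k (fun l => F.cls x (j l) (v l)) =
      γ k (fun l => F.cls x (j l) (v l))) : β = γ := by
  funext k
  ext u
  have hu : u = fun l => ∑ j, Pi.single j (u l j) := by
    funext l; exact (Finset.univ_sum_single (u l)).symm
  rw [hu]
  change (β k).toMultilinearMap _ = (γ k).toMultilinearMap _
  rw [MultilinearMap.map_sum, MultilinearMap.map_sum]
  refine Finset.sum_congr rfl fun j _ => ?_
  choose v hv using fun l => Submodule.Quotient.mk_surjective _ (u l (j l))
  have := h k j v
  simp only [cls, hv] at this
  exact this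

instance finiteDimensional_oscForms : FiniteDimensional ℝ (F.OscForms x) := by
  have : ∀ k, FiniteDimensional ℝ ((F.Osc x) [⋀^Fin k]→ₗ[ℝ] ℝ) := fun k =>
    Module.Finite.of_injective
      (AlternatingMap.toMultilinearMapLM (S := ℝ) :
        (F.Osc x) [⋀^Fin k]→ₗ[ℝ] ℝ →ₗ[ℝ] MultilinearMap ℝ (fun _ : Fin k => F.Osc x) ℝ)
      AlternatingMap.coe_multilinearMap_injective
  refine Module.Finite.of_injective (LinearMap.pi fun k : Fin (Module.finrank ℝ (F.Osc x) + 1) =>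
    (LinearMap.proj (k : ℕ) : F.OscForms x →ₗ[ℝ] _)) ?_
  intro β γ h
  funext k
  by_cases hk : k < Module.finrank ℝ (F.Osc x) + 1
  · exact congrFun h ⟨k, hk⟩
  · rw [alternating_eq_zero_of_finrank_lt (by omega) (β k),
      alternating_eq_zero_of_finrank_lt (by omega) (γ k)]

/-- The dilation of `g_x M` by `t`. -/
def dilation (t : ℝ) : F.Osc x →ₗ[ℝ] F.Osc x :=
  LinearMap.pi fun j => t ^ ((j : ℕ) + 1) • LinearMap.proj j

lemma dilation_cls (t : ℝ) (j : Fin F.s) (v : F.H (j + 1) x) :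
    F.dilation x t (F.cls x j v) = t ^ ((j : ℕ) + 1) • F.cls x j v := by
  funext i
  by_cases hi : i = j
  · subst hi; rfl
  · simp [dilation, cls, hi]

/-- The weight `w` component on `∧^• g_x^* M`, obtained from the dilations by interpolation. -/
def weightPart (w : ℕ) : Module.End ℝ (F.OscForms x) where
  toFun β k := ∑ i ∈ Finset.range (n * F.s + 1),
    (Lagrange.basis (Finset.range (n * F.s + 1)) (fun i : ℕ => (i : ℝ)) i).coeff w •
      (β k).compLinearMap (F.dilation x i)
  map_add' β γ := by
    funext k
    simp only [Pi.add_apply, AlternatingMap.add_compLinearMap, smul_add, Finset.sum_add_distrib]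
  map_smul' r β := by
    funext k
    simp only [Pi.smul_apply, RingHom.id_apply, Finset.smul_sum]
    refine Finset.sum_congr rfl fun i _ => ?_
    rw [smul_comm]
    rfl

/-- A monomial of degree at most `N` is its own interpolant at the nodes `0, …, N`; the coefficients
of degree `w` are compared. -/
lemma sum_lagrange_coeff_mul_pow {N w e : ℕ} (he : e ≤ N) :
    ∑ i ∈ Finset.range (N + 1),
      (Lagrange.basis (Finset.range (N + 1)) (fun i : ℕ => (i : ℝ)) i).coeff w * (i : ℝ) ^ e =
      if e = w then 1 else 0 := by
  have h := Lagrange.eq_interpolate (s := Finset.range (N + 1)) (v := fun i : ℕ => (i : ℝ))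
    (f := (Polynomial.X ^ e : Polynomial ℝ)) (Nat.cast_injective.injOn)
    (by rw [Polynomial.degree_X_pow, Finset.card_range]; exact_mod_cast Nat.lt_succ_of_le he)
  have h2 := congrArg (fun p => Polynomial.coeff p w) h
  simp only [Lagrange.interpolate_apply, Polynomial.coeff_X_pow, Polynomial.finsetSum_coeff,
    Polynomial.coeff_C_mul, Polynomial.eval_pow, Polynomial.eval_X] at h2
  simp only [mul_comm _ ((_ : ℝ) ^ e), ← h2, eq_comm]

-- The dilation by `i` multiplies the value on a tuple of classes by `i` to the power of its total
-- weight, so interpolation singles out the weight `w`. The nodes suffice because in degrees up to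
-- `n` total weights are at most `n * s`, while higher degrees vanish.
include g in
lemma weightPart_cls (w : ℕ) (β : F.OscForms x) {k : ℕ} (j : Fin k → Fin F.s)
    (v : ∀ l, F.H (j l + 1) x) :
    F.weightPart x w β k (fun l => F.cls x (j l) (v l)) =
      if ∑ l, ((j l : ℕ) + 1) = w then β k (fun l => F.cls x (j l) (v l)) else 0 := by
  by_cases hk : n < k
  · rw [alternating_eq_zero_of_finrank_lt (by rwa [F.finrank_osc g x]) (F.weightPart x w β k),
      alternating_eq_zero_of_finrank_lt (by rwa [F.finrank_osc g x]) (β k)]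
    simp
  have hs : ∑ l, ((j l : ℕ) + 1) ≤ n * F.s := F.sum_weights_le (not_lt.1 hk) j
  have e : ∀ i : ℕ, (β k).compLinearMap (F.dilation x i) (fun l => F.cls x (j l) (v l)) =
      (i : ℝ) ^ (∑ l, ((j l : ℕ) + 1)) * β k (fun l => F.cls x (j l) (v l)) := by
    intro i
    rw [AlternatingMap.compLinearMap_apply]
    simp only [dilation_cls]
    rw [← Finset.prod_pow_eq_pow_sum]
    exact (β k).map_smul_univ _ _
  have h2 : F.weightPart x w β k (fun l => F.cls x (j l) (v l)) = ∑ i ∈ Finset.range (n * F.s + 1),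
    (Lagrange.basis (Finset.range (n * F.s + 1)) (fun i : ℕ => (i : ℝ)) i).coeff w *
      (β k).compLinearMap (F.dilation x i) (fun l => F.cls x (j l) (v l)) := by
    simp [weightPart, alternating_sum_apply]
  rw [h2]
  simp only [e, ← mul_assoc, ← Finset.sum_mul]
  rw [sum_lagrange_coeff_mul_pow hs]
  split_ifs <;> simp

include g in
lemma weightPart_weightPart (w w' : ℕ) (β : F.OscForms x) :
    F.weightPart x w (F.weightPart x w' β) = if w = w' then F.weightPart x w β else 0 := by
  refine oscForms_ext fun k j v => ?_
  rw [F.weightPart_cls g, F.weightPart_cls g]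
  split_ifs with h1 h2 h3 h3 h3
  · rw [F.weightPart_cls g, if_pos h1]
  · exact absurd (h1.symm.trans h2) h3
  · exact absurd (h1.trans h3) h2
  · rfl
  · rw [F.weightPart_cls g, if_neg h1]
  · rfl

include g in
lemma sum_weightPart (β : F.OscForms x) :
    ∑ w ∈ Finset.range (n * F.s + 1), F.weightPart x w β = β := by
  refine oscForms_ext fun k j v => ?_
  by_cases hk : n < k
  · rw [alternating_eq_zero_of_finrank_lt (by rwa [F.finrank_osc g x])
      ((∑ w ∈ Finset.range (n * F.s + 1), F.weightPart x w β) k),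
      alternating_eq_zero_of_finrank_lt (by rwa [F.finrank_osc g x]) (β k)]
  have hs : ∑ l, ((j l : ℕ) + 1) ≤ n * F.s := F.sum_weights_le (not_lt.1 hk) j
  rw [Finset.sum_apply, alternating_sum_apply]
  simp only [F.weightPart_cls g]
  rw [Finset.sum_ite_eq, if_pos (Finset.mem_range.2 (Nat.lt_succ_of_le hs))]

/-- The metric splitting moves a vector only by terms one step lower in the filtration, and a form
of weight at least `w` does not see these on tuples of total weight `w`. So the class can be
computed with the splitting although its definition does not involve the metric. -/
lemma isClass_weightPart_pullOsc {w : ℕ} {x : M} {a : FormFiber n x} (ha : a ∈ F.fiberGE w x) :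
    F.IsClass w x a (F.weightPart x w (F.pullOsc g x a)) := by
  intro k j v
  rw [F.weightPart_cls g]
  split_ifs with h
  · rw [pullOsc_apply]
    exact apply_eq_of_mem_fiberGE ha (fun l => (v l).2)
      (fun l => F.oscToTan_cls_sub_mem g x (j l) (v l)) h.le
  · rfl

variable {F x} in
lemma IsClass.unique {w : ℕ} {a : FormFiber n x} {β γ : F.OscForms x} (h : F.IsClass w x a β)
    (h' : F.IsClass w x a γ) : β = γ :=
  oscForms_ext fun k j v => (h k j v).trans (h' k j v).symm

variable {x} in
lemma isClass_iff {w : ℕ} {a : FormFiber n x} (ha : a ∈ F.fiberGE w x) (β : F.OscForms x) :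
    F.IsClass w x a β ↔ F.weightPart x w (F.pullOsc g x a) = β :=
  ⟨fun h => (F.isClass_weightPart_pullOsc g ha).unique h,
    fun h => h ▸ F.isClass_weightPart_pullOsc g ha⟩

lemma IsClass.add {F : TangentFiltration n M} {x : M} {w : ℕ} {a b : FormFiber n x}
    {β γ : F.OscForms x} (h : F.IsClass w x a β) (h' : F.IsClass w x b γ) :
    F.IsClass w x (a + b) (β + γ) := by
  intro k j v
  have h1 := h k j v
  have h2 := h' k j v
  simp only [Pi.add_apply, AlternatingMap.add_apply, ContinuousAlternatingMap.add_apply, h1, h2]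
  split_ifs <;> simp

lemma IsClass.smul {F : TangentFiltration n M} {x : M} {w : ℕ} {a : FormFiber n x}
    {β : F.OscForms x} (r : ℝ) (h : F.IsClass w x a β) :
    F.IsClass w x (r • a) (r • β) := by
  intro k j v
  have h1 := h k j v
  simp only [Pi.smul_apply, AlternatingMap.smul_apply, ContinuousAlternatingMap.smul_apply, h1]
  split_ifs <;> simp

lemma isClass_zero_of_mem {w : ℕ} {x : M} {a : FormFiber n x} (ha : a ∈ F.fiberGE (w + 1) x) :
    F.IsClass w x a 0 := by
  intro k j v
  split_ifs with h
  · exact (ha k (fun l => j l + 1) _ (fun l => (v l).2) (by omega)).symm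
  · rfl

include g in
lemma mem_fiberGE_iff_weightPart (w : ℕ) (a : FormFiber n x) :
    a ∈ F.fiberGE w x ↔ ∀ w' < w, F.weightPart x w' (F.pullOsc g x a) = 0 := by
  constructor
  · intro ha w' hw'
    exact (F.isClass_iff g (F.fiberGE_anti hw'.le x ha) 0).1
      (F.isClass_zero_of_mem (F.fiberGE_anti hw' x ha))
  · induction w with
    | zero => intro _; rw [fiberGE_zero]; trivial
    | succ w ih =>
      intro h
      have ha := ih fun w' hw' => h w' (hw'.trans (Nat.lt_succ_self w))
      exact F.mem_fiberGE_succ ha ((F.isClass_iff g ha 0).2 (h w (Nat.lt_succ_self w)))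

include g in
lemma weightPart_eq_zero {w : ℕ} (hw : n * F.s < w) (β : F.OscForms x) :
    F.weightPart x w β = 0 := by
  refine oscForms_ext fun k j v => ?_
  rw [F.weightPart_cls g]
  split_ifs with h
  · by_cases hk : n < k
    · rw [alternating_eq_zero_of_finrank_lt (by rwa [F.finrank_osc g x]) (β k)]; rfl
    · have := F.sum_weights_le (not_lt.1 hk) j
      omega
  · rfl

variable {x} in
/-- `T` is the associated graded of the filtered endomorphism `A` of `∧^• T_x^* M`. -/
def IsFiberGr (A : Module.End ℝ (FormFiber n x)) (T : Module.End ℝ (F.OscForms x)) : Prop :=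
  ∀ w, ∀ a ∈ F.fiberGE w x, A a ∈ F.fiberGE w x ∧
      ∀ β, F.IsClass w x a β → F.IsClass w x (A a) (T β)

variable {F x} in
lemma IsFiberGr.weightPart_comm {A : Module.End ℝ (FormFiber n x)} {T : Module.End ℝ (F.OscForms x)}
    (h : F.IsFiberGr A T) {w : ℕ} {a : FormFiber n x} (ha : a ∈ F.fiberGE w x) :
    F.weightPart x w (F.pullOsc g x (A a)) = T (F.weightPart x w (F.pullOsc g x a)) :=
  (F.isClass_iff g (h w a ha).1 _).1 ((h w a ha).2 _ (F.isClass_weightPart_pullOsc g ha))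

-- A homogeneous element of weight `w` is the class of a form of that weight, and `T` sends it to
-- the class of the image, again homogeneous of weight `w`. Splitting an arbitrary element into
-- homogeneous ones gives the commutation.
include g in
variable {F x} in
lemma IsFiberGr.commute_weightPart {A : Module.End ℝ (FormFiber n x)}
    {T : Module.End ℝ (F.OscForms x)} (h : F.IsFiberGr A T) (w : ℕ) :
    Commute T (F.weightPart x w) := by
  have hhom : ∀ w β, F.weightPart x w (T (F.weightPart x w β)) = T (F.weightPart x w β) := by
    intro w β
    obtain ⟨a, haΦ⟩ := (F.pullOsc g x).surjective (F.weightPart x w β)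
    have ham : a ∈ F.fiberGE w x := by
      rw [F.mem_fiberGE_iff_weightPart g, haΦ]
      intro w' hw'
      rw [F.weightPart_weightPart g, if_neg hw'.ne]
    have h1 := h.weightPart_comm g ham
    rw [haΦ, F.weightPart_weightPart g, if_pos rfl] at h1
    rw [← h1, F.weightPart_weightPart g, if_pos rfl]
  ext β : 1
  rw [Module.End.mul_apply, Module.End.mul_apply]
  conv_rhs => rw [← F.sum_weightPart g x β, map_sum, map_sum]
  have : ∀ w', F.weightPart x w (T (F.weightPart x w' β)) =
      if w = w' then T (F.weightPart x w β) else 0 := by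
    intro w'
    rw [← hhom w', F.weightPart_weightPart g]
    split_ifs with h1
    · subst h1; exact hhom w β
    · rfl
  simp only [this]
  rw [Finset.sum_ite_eq]
  split_ifs with hw
  · rfl
  · rw [F.weightPart_eq_zero g x (by simpa using hw), map_zero]

include g in
variable {F x} in
/-- A filtered endomorphism and its associated graded have the same characteristic polynomial. -/
lemma IsFiberGr.charpoly_eq {A : Module.End ℝ (FormFiber n x)} {T : Module.End ℝ (F.OscForms x)}
    [FiniteDimensional ℝ (FormFiber n x)] (h : F.IsFiberGr A T) : A.charpoly = T.charpoly := by
  rw [← LinearEquiv.charpoly_conj (F.pullOsc g x) A]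
  refine charpoly_eq_of_sub_raises (h.commute_weightPart g) (N := n * F.s + 1) ?_ ?_
  · intro β hβ
    rw [← F.sum_weightPart g x β]
    exact Finset.sum_eq_zero fun w hw => hβ w (Finset.mem_range.1 hw)
  · intro w β hβ w' hw'
    obtain ⟨a, rfl⟩ := (F.pullOsc g x).surjective β
    have ham : a ∈ F.fiberGE w' x :=
      F.fiberGE_anti (Nat.lt_succ_iff.1 hw') x ((F.mem_fiberGE_iff_weightPart g x w a).2 hβ)
    have hT : F.weightPart x w' (T (F.pullOsc g x a)) = T (F.weightPart x w' (F.pullOsc g x a)) :=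
      (LinearMap.congr_fun (h.commute_weightPart g w').eq _).symm
    have hconj : (LinearEquiv.conj (F.pullOsc g x) A) (F.pullOsc g x a) = F.pullOsc g x (A a) := by
      rw [LinearEquiv.conj_apply_apply, LinearEquiv.symm_apply_apply]
    rw [LinearMap.sub_apply, map_sub, hconj, hT, h.weightPart_comm g ham, sub_self]

end Osc
end TangentFiltration
end Fibre
end FilteredManifold

end

section
open scoped Manifold ContDiff Topology TensorProduct

namespace FilteredManifold

lemma finite_pi_of_eq_zero {V : ℕ → Type*} [∀ k, AddCommGroup (V k)] [∀ k, Module ℝ (V k)]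
    [∀ k, FiniteDimensional ℝ (V k)] {m : ℕ} (h : ∀ k, m < k → ∀ v : V k, v = 0) :
    FiniteDimensional ℝ (∀ k, V k) := by
  refine Module.Finite.of_injective (LinearMap.pi fun k : Fin (m + 1) =>
    (LinearMap.proj (k : ℕ) : (∀ k, V k) →ₗ[ℝ] _)) ?_
  intro β γ hβ
  funext k
  by_cases hk : k < m + 1
  · exact congrFun hβ ⟨k, hk⟩
  · rw [h k (by omega) (β k), h k (by omega) (γ k)]

/-- An injective multi-index becomes strictly increasing after sorting, at the cost of a sign. Used
for the positivity of `oscFormInner`, which sums over increasing multi-indices. -/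
lemma alternating_eq_zero_of_strictMono {L : Type*} [AddCommGroup L] [Module ℝ L] {m k : ℕ}
    (e : Module.Basis (Fin m) ℝ L) {f : L [⋀^Fin k]→ₗ[ℝ] ℝ}
    (h : ∀ I : Fin k → Fin m, StrictMono I → f (fun l => e (I l)) = 0) : f = 0 := by
  refine Module.Basis.ext_alternating e fun v hv => ?_
  have h1 := h (v ∘ Tuple.sort v) ((Tuple.monotone_sort v).strictMono_of_injective
    (hv.comp (Equiv.injective _)))
  have h2 := f.map_perm (fun l => e (v l)) (Tuple.sort v)
  rw [show (fun l => e (v l)) ∘ Tuple.sort v = fun l => e ((v ∘ Tuple.sort v) l) from rfl, h1] at h2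
  rcases Int.units_eq_one_or (Equiv.Perm.sign (Tuple.sort v)) with hs | hs
  · rw [hs, one_smul] at h2; exact h2.symm
  · rw [hs] at h2
    simpa using h2.symm

/-! ### The scalar product of osculating forms; symmetry of the osculating box. -/

section Fibre
variable {n : ℕ} {M : Type*} [TopologicalSpace M] [ChartedSpace (EuclideanSpace ℝ (Fin n)) M]
  [IsManifold (𝓡 n) ∞ M]

instance finiteDimensional_cov (k : ℕ) (x : M) : FiniteDimensional ℝ (Cov n k x) :=
  Module.Finite.of_injective
    ((AlternatingMap.toMultilinearMapLM (S := ℝ) :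
        (Tan n x) [⋀^Fin k]→ₗ[ℝ] ℝ →ₗ[ℝ] MultilinearMap ℝ (fun _ : Fin k => Tan n x) ℝ) ∘ₗ
      ({ toFun := fun a => a.toAlternatingMap
         map_add' := fun _ _ => rfl
         map_smul' := fun _ _ => rfl } : Cov n k x →ₗ[ℝ] (Tan n x) [⋀^Fin k]→ₗ[ℝ] ℝ))
    (AlternatingMap.coe_multilinearMap_injective.comp
      ContinuousAlternatingMap.toAlternatingMap_injective)

instance finiteDimensional_formFiber (x : M) : FiniteDimensional ℝ (FormFiber n x) :=
  finite_pi_of_eq_zero fun _ hk a => cov_eq_zero hk a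

namespace TangentFiltration
variable (F : TangentFiltration n M) (g : Bundle.ContMDiffRiemannianMetric (𝓡 n) ∞
  (EuclideanSpace ℝ (Fin n)) (fun x : M => Tan n x)) (x : M)

/-- `oscInner` as a bilinear form. -/
def oscInnerForm : LinearMap.BilinForm ℝ (F.Osc x) :=
  LinearMap.mk₂ ℝ (F.oscInner g x)
    (fun u u' v => by simp [oscInner_eq]) (fun c u v => by simp [oscInner_eq])
    (fun u v v' => by simp [oscInner_eq]) (fun c u v => by simp [oscInner_eq])

lemma oscFrame_spec (a b : Fin n) :
    F.oscInner g x (F.oscFrame g x a) (F.oscFrame g x b) = if a = b then 1 else 0 := by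
  have h : ∃ f : Fin n → F.Osc x, ∀ a b, F.oscInner g x (f a) (f b) = if a = b then 1 else 0 :=
    exists_orthonormal (b := F.oscInnerForm g x)
      (fun v w => by simp [oscInnerForm, oscInner_eq, g.symm x (F.oscToTan g x v)])
      (fun v hv => F.oscInner_self_pos g x hv) (F.finrank_osc g x)
  exact Classical.epsilon_spec h a b

/-- The orthonormal frame of `g_x M` as a basis. -/
def oscBasis : Module.Basis (Fin n) ℝ (F.Osc x) :=
  have hli : LinearIndependent ℝ (F.oscFrame g x) := by
    rw [Fintype.linearIndependent_iff]
    intro c hc i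
    have h1 : F.oscInnerForm g x (F.oscFrame g x i) (∑ j, c j • F.oscFrame g x j) = c i := by
      simp only [map_sum, map_smul, smul_eq_mul]
      have : ∀ j, F.oscInnerForm g x (F.oscFrame g x i) (F.oscFrame g x j) =
        if i = j then 1 else 0 := F.oscFrame_spec g x i
      simp [this]
    rw [← h1, hc, map_zero]
  basisOfLinearIndependentOfCardEqFinrank' _ hli (by rw [F.finrank_osc g x, Fintype.card_fin])

lemma oscBasis_apply (i : Fin n) : F.oscBasis g x i = F.oscFrame g x i := by
  simp [oscBasis]

/-- `oscFormInner` as a bilinear form. -/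
def oscFormForm : LinearMap.BilinForm ℝ (F.OscForms x) :=
  LinearMap.mk₂ ℝ (F.oscFormInner g x)
    (fun u u' v => by
      simp only [oscFormInner, ← Finset.sum_add_distrib]
      refine Finset.sum_congr rfl fun k _ => Finset.sum_congr rfl fun I _ => ?_
      split_ifs <;> simp [add_mul])
    (fun c u v => by
      simp only [oscFormInner, Finset.smul_sum]
      refine Finset.sum_congr rfl fun k _ => Finset.sum_congr rfl fun I _ => ?_
      split_ifs <;> simp [mul_assoc])
    (fun u v v' => by
      simp only [oscFormInner, ← Finset.sum_add_distrib]
      refine Finset.sum_congr rfl fun k _ => Finset.sum_congr rfl fun I _ => ?_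
      split_ifs <;> simp [mul_add])
    (fun c u v => by
      simp only [oscFormInner, Finset.smul_sum]
      refine Finset.sum_congr rfl fun k _ => Finset.sum_congr rfl fun I _ => ?_
      split_ifs <;> simp [mul_left_comm])

lemma oscFormForm_apply (β γ : F.OscForms x) :
    F.oscFormForm g x β γ = F.oscFormInner g x β γ := rfl

lemma oscFormForm_symm (β γ : F.OscForms x) :
    F.oscFormForm g x β γ = F.oscFormForm g x γ β := by
  simp only [oscFormForm_apply, oscFormInner, mul_comm]

lemma oscFormForm_pos (β : F.OscForms x) (hβ : β ≠ 0) : 0 < F.oscFormForm g x β β := by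
  classical
  rw [oscFormForm_apply, oscFormInner]
  have hnn : ∀ k (I : Fin k → Fin n), 0 ≤ if StrictMono I then
      β k (fun l => F.oscFrame g x (I l)) * β k (fun l => F.oscFrame g x (I l)) else 0 := by
    intro k I
    split_ifs
    · exact mul_self_nonneg _
    · exact le_rfl
  by_contra hneg
  apply hβ
  have h0 : ∑ k ∈ Finset.range (n + 1), ∑ I : Fin k → Fin n,
    (if StrictMono I then
      β k (fun l => F.oscFrame g x (I l)) * β k (fun l => F.oscFrame g x (I l))
    else 0) = 0 := le_antisymm (not_lt.1 hneg)
      (Finset.sum_nonneg fun k _ => Finset.sum_nonneg fun I _ => hnn k I)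
  rw [Finset.sum_eq_zero_iff_of_nonneg fun k _ => Finset.sum_nonneg fun I _ => hnn k I] at h0
  funext k
  by_cases hk : k < n + 1
  · refine alternating_eq_zero_of_strictMono (F.oscBasis g x) fun I hI => ?_
    have h1 := h0 k (Finset.mem_range.2 hk)
    rw [Finset.sum_eq_zero_iff_of_nonneg fun I _ => hnn k I] at h1
    have h2 := h1 I (Finset.mem_univ _)
    rw [if_pos hI, mul_self_eq_zero] at h2
    simpa only [oscBasis_apply] using h2
  · exact alternating_eq_zero_of_finrank_lt (by rw [F.finrank_osc g x]; omega) _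

lemma transpose_spec (T : Module.End ℝ (F.OscForms x)) (β γ : F.OscForms x) :
    F.oscFormForm g x (T β) γ = F.oscFormForm g x β (F.transpose g x T γ) := by
  have h : ∃ T' : Module.End ℝ (F.OscForms x), ∀ β γ,
      F.oscFormInner g x (T β) γ = F.oscFormInner g x β (T' γ) :=
    exists_adjoint (F.oscFormForm_symm g x) (F.oscFormForm_pos g x) T
  exact Classical.epsilon_spec h β γ

lemma oscBox_symmetric (β γ : F.OscForms x) :
    F.oscFormForm g x (F.oscBox g x β) γ = F.oscFormForm g x β (F.oscBox g x γ) := by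
  have h : ∀ β γ, F.oscFormForm g x (F.transpose g x (F.oscD x) β) γ =
      F.oscFormForm g x β (F.oscD x γ) := fun β γ => by
    rw [F.oscFormForm_symm, ← transpose_spec, F.oscFormForm_symm]
  simp only [oscBox, LinearMap.add_apply, Module.End.mul_apply, map_add, transpose_spec, h]

lemma isCompl_oscBox : IsCompl (LinearMap.ker (F.oscBox g x)) (LinearMap.range (F.oscBox g x)) :=
  isCompl_ker_range_of_symmetric (F.oscFormForm_symm g x) (F.oscFormForm_pos g x)
    (F.oscBox_symmetric g x)

lemma oscProj_spec : (∀ β, F.oscBox g x (F.oscProj g x β) = 0) ∧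
    ∀ β γ, F.oscBox g x γ = 0 → F.oscFormForm g x (β - F.oscProj g x β) γ = 0 := by
  have h : ∃ Q : Module.End ℝ (F.OscForms x), (∀ β, F.oscBox g x (Q β) = 0) ∧
      ∀ β γ, F.oscBox g x γ = 0 → F.oscFormInner g x (β - Q β) γ = 0 := by
    refine ⟨(LinearMap.ker (F.oscBox g x)).projection _ (F.isCompl_oscBox g x),
      fun β => Submodule.projection_apply_mem (F.isCompl_oscBox g x) β, fun β γ hγ => ?_⟩
    have h1 := Submodule.projection_add_projection_eq_self (F.isCompl_oscBox g x) β
    obtain ⟨η, hη⟩ := Submodule.projection_apply_mem (F.isCompl_oscBox g x).symm β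
    rw [← eq_sub_iff_add_eq'] at h1
    rw [← h1, ← hη, ← oscFormForm_apply, oscBox_symmetric, hγ, map_zero]
  exact Classical.epsilon_spec h

/-- By symmetry the image of the box is orthogonal to its kernel, so `oscProj (oscBox η)`, which
lies in the kernel, has norm zero. Hence the orthogonal projection is the spectral one, and the
exponent `1` suffices. -/
lemma isFittingProjection_oscProj :
    IsFittingProjection (F.oscBox g x) (F.oscProj g x) 1 := by
  obtain ⟨h1, h2⟩ := F.oscProj_spec g x
  have hker : ∀ γ, F.oscBox g x γ = 0 → F.oscProj g x γ = γ := by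
    intro γ hγ
    by_contra hne
    have h3 := F.oscFormForm_pos g x (γ - F.oscProj g x γ) (sub_ne_zero.2 (Ne.symm hne))
    rw [h2 _ _ (by rw [map_sub, hγ, h1, sub_zero])] at h3
    exact h3.false
  have hran : ∀ η, F.oscProj g x (F.oscBox g x η) = 0 := by
    intro η
    by_contra hne
    have h3 := F.oscFormForm_pos g x _ hne
    have h4 := h2 (F.oscBox g x η) _ (h1 (F.oscBox g x η))
    rw [map_sub, LinearMap.sub_apply, oscBox_symmetric, h1, map_zero, zero_sub, neg_eq_zero] at h4
    rw [h4] at h3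
    exact h3.false
  refine ⟨?_, ?_, ?_⟩
  · ext β : 1
    exact hker _ (h1 β)
  · rw [pow_one]
    apply le_antisymm
    · rintro _ ⟨β, rfl⟩; exact h1 β
    · intro β hβ; exact ⟨β, hker β hβ⟩
  · rw [pow_one]
    apply le_antisymm
    · intro β hβ
      have h5 : β ∈ LinearMap.ker (F.oscBox g x) ⊔ LinearMap.range (F.oscBox g x) := by
        rw [(F.isCompl_oscBox g x).sup_eq_top]; trivial
      obtain ⟨y, hy, z, ⟨η, rfl⟩, rfl⟩ := Submodule.mem_sup.1 h5
      rw [LinearMap.mem_ker, map_add, hran, add_zero, hker y hy] at hβ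
      rw [hβ, zero_add]
      exact ⟨η, rfl⟩
    · rintro _ ⟨η, rfl⟩; exact hran η

lemma splits_charpoly_oscBox : (F.oscBox g x).charpoly.Splits :=
  splits_charpoly_of_symmetric (F.oscFormForm_symm g x) (F.oscFormForm_pos g x)
    (F.oscBox_symmetric g x)

lemma natTrailingDegree_charpoly_oscBox : (F.oscBox g x).charpoly.natTrailingDegree =
    Module.finrank ℝ (LinearMap.ker (F.oscBox g x)) :=
  natTrailingDegree_charpoly_of_symmetric (F.oscFormForm_symm g x) (F.oscFormForm_pos g x)
    (F.oscBox_symmetric g x)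

end TangentFiltration
end Fibre
end FilteredManifold

end

section
open scoped Manifold ContDiff Topology TensorProduct

namespace FilteredManifold

/-! ### Smooth dependence of alternating forms on a parameter. -/

section Smooth
variable {E : Type*} [NormedAddCommGroup E] [NormedSpace ℝ E] [FiniteDimensional ℝ E]
  {E' : Type*} [NormedAddCommGroup E'] [NormedSpace ℝ E'] {k : ℕ}

lemma cam_apply_eq_sum (f : E [⋀^Fin k]→L[ℝ] ℝ) (v : Fin k → E) :
    f v = ∑ r : Fin k → Fin (Module.finrank ℝ E),
      (∏ i, (Module.finBasis ℝ E).repr (v i) (r i)) * f fun i => Module.finBasis ℝ E (r i) := by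
  let b := Module.finBasis ℝ E
  conv_lhs => rw [show v = fun i => ∑ j, b.repr (v i) j • b j from
    funext fun i => (b.sum_repr (v i)).symm]
  change f.toMultilinearMap _ = _
  rw [MultilinearMap.map_sum]
  exact Finset.sum_congr rfl fun r _ => MultilinearMap.map_smul_univ _ _ _

variable {f : E' → E [⋀^Fin k]→L[ℝ] ℝ} {y : E'}

lemma _root_.ContDiffAt.cam_apply (hf : ContDiffAt ℝ ∞ f y) (v : Fin k → E) :
    ContDiffAt ℝ ∞ (fun z => f z v) y :=
  (ContinuousAlternatingMap.apply ℝ E ℝ v).contDiff.contDiffAt.comp y hf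

lemma _root_.ContDiffAt.cam_apply_fields (hf : ContDiffAt ℝ ∞ f y) {V : Fin k → E' → E}
    (hV : ∀ i, ContDiffAt ℝ ∞ (V i) y) : ContDiffAt ℝ ∞ (fun z => f z fun i => V i z) y := by
  simp only [fun z => cam_apply_eq_sum (f z) fun i => V i z]
  refine ContDiffAt.sum fun r _ => ContDiffAt.mul ?_ (hf.cam_apply _)
  refine contDiffAt_prod fun i _ => ?_
  have h1 : ContDiff ℝ ∞ fun u : E => (Module.finBasis ℝ E).repr u (r i) :=
    (LinearMap.toContinuousLinearMap ((Module.finBasis ℝ E).coord (r i))).contDiff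
  exact h1.contDiffAt.comp y (hV i)

/-- Evaluation on tuples of basis vectors embeds the forms linearly into a finite-dimensional
coordinate space, and a linear left inverse recovers `f` from its components. -/
lemma contDiffAt_cam_iff : ContDiffAt ℝ ∞ f y ↔ ∀ v, ContDiffAt ℝ ∞ (fun z => f z v) y := by
  refine ⟨fun h v => h.cam_apply v, fun h => ?_⟩
  have : FiniteDimensional ℝ (E [⋀^Fin k]→L[ℝ] ℝ) :=
    Module.Finite.of_injective
      ((AlternatingMap.toMultilinearMapLM (S := ℝ) :
          E [⋀^Fin k]→ₗ[ℝ] ℝ →ₗ[ℝ] MultilinearMap ℝ (fun _ : Fin k => E) ℝ) ∘ₗ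
        ({ toFun := fun a => a.toAlternatingMap
           map_add' := fun _ _ => rfl
           map_smul' := fun _ _ => rfl } : E [⋀^Fin k]→L[ℝ] ℝ →ₗ[ℝ] E [⋀^Fin k]→ₗ[ℝ] ℝ))
      (AlternatingMap.coe_multilinearMap_injective.comp
        ContinuousAlternatingMap.toAlternatingMap_injective)
  let ev : (E [⋀^Fin k]→L[ℝ] ℝ) →ₗ[ℝ] ((Fin k → Fin (Module.finrank ℝ E)) → ℝ) :=
    { toFun := fun a r => a fun i => Module.finBasis ℝ E (r i)
      map_add' := fun _ _ => rfl
      map_smul' := fun _ _ => rfl }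
  have hinj : LinearMap.ker ev = ⊥ := by
    rw [LinearMap.ker_eq_bot']
    intro a ha
    ext v
    rw [cam_apply_eq_sum]
    refine Finset.sum_eq_zero fun r _ => ?_
    have : (a fun i => Module.finBasis ℝ E (r i)) = 0 := congrFun ha r
    rw [this, mul_zero]
  obtain ⟨l, hl⟩ := ev.exists_leftInverse_of_injective hinj
  have h1 : f = fun z => LinearMap.toContinuousLinearMap l (ev (f z)) := by
    funext z
    exact (LinearMap.congr_fun hl (f z)).symm
  rw [h1]
  refine (LinearMap.toContinuousLinearMap l).contDiff.contDiffAt.comp y ?_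
  exact contDiffAt_pi.2 fun r => h _

lemma _root_.ContDiffAt.cam_comp (hf : ContDiffAt ℝ ∞ f y) {A : E' → E →L[ℝ] E}
    (hA : ContDiffAt ℝ ∞ A y) :
    ContDiffAt ℝ ∞ (fun z => (f z).compContinuousLinearMap (A z)) y :=
  contDiffAt_cam_iff.2 fun v => hf.cam_apply_fields (V := fun i z => A z (v i))
    fun _ => hA.clm_apply contDiffAt_const

end Smooth

/-! ### Forms, vector fields and Lie brackets in a chart. -/

section Charts
variable {n : ℕ} {M : Type*} [TopologicalSpace M] [ChartedSpace (EuclideanSpace ℝ (Fin n)) M]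

/-- The derivative of the inverse of the chart around `c`. -/
def chartD (c : M) (y : EuclideanSpace ℝ (Fin n)) :
    EuclideanSpace ℝ (Fin n) →L[ℝ] Tan n ((extChartAt (𝓡 n) c).symm y) :=
  mfderiv (𝓡 n) (𝓡 n) (extChartAt (𝓡 n) c).symm y

/-- The derivative of the chart around `c`. -/
def chartDInv (c p : M) : Tan n p →L[ℝ] EuclideanSpace ℝ (Fin n) :=
  mfderiv (𝓡 n) (𝓡 n) (extChartAt (𝓡 n) c) p

/-- The expression of a vector field in the chart around `c`. -/
def chartField (c : M) (V : ∀ x : M, Tan n x) (y : EuclideanSpace ℝ (Fin n)) :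
    EuclideanSpace ℝ (Fin n) :=
  chartDInv c ((extChartAt (𝓡 n) c).symm y) (V ((extChartAt (𝓡 n) c).symm y))

/-- The vector field on the chart around `c` with a given expression. -/
def localField (c : M) (v : EuclideanSpace ℝ (Fin n) → EuclideanSpace ℝ (Fin n)) (p : M) : Tan n p :=
  (chartDInv c p).inverse (v (extChartAt (𝓡 n) c p))

/-- The form on the chart around `c` with a given expression. -/
def localForm {k : ℕ} (c : M)
    (η : EuclideanSpace ℝ (Fin n) → (EuclideanSpace ℝ (Fin n)) [⋀^Fin k]→L[ℝ] ℝ) (p : M) : Cov n k p :=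
  (η (extChartAt (𝓡 n) c p)).compContinuousLinearMap (chartDInv c p)

variable [IsManifold (𝓡 n) ∞ M]

lemma chartDInv_chartD (c : M) {y : EuclideanSpace ℝ (Fin n)}
    (hy : y ∈ (extChartAt (𝓡 n) c).target) (v : EuclideanSpace ℝ (Fin n)) :
    chartDInv c ((extChartAt (𝓡 n) c).symm y) (chartD c y v) = v := by
  have : IsManifold (𝓡 n) 1 M := IsManifold.of_le (n := ∞) (by simp)
  have h := mfderiv_extChartAt_comp_mfderivWithin_extChartAt_symm (I := 𝓡 n) hy
  rw [ModelWithCorners.range_eq_univ, mfderivWithin_univ] at h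
  exact DFunLike.congr_fun h v

lemma chartD_chartDInv (c : M) {y : EuclideanSpace ℝ (Fin n)}
    (hy : y ∈ (extChartAt (𝓡 n) c).target) (v : Tan n ((extChartAt (𝓡 n) c).symm y)) :
    chartD c y (chartDInv c ((extChartAt (𝓡 n) c).symm y) v) = v := by
  have : IsManifold (𝓡 n) 1 M := IsManifold.of_le (n := ∞) (by simp)
  have h := mfderivWithin_extChartAt_symm_comp_mfderiv_extChartAt (I := 𝓡 n) hy
  rw [ModelWithCorners.range_eq_univ, mfderivWithin_univ] at h
  exact DFunLike.congr_fun h v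

lemma chartDInv_isInvertible (c : M) {p : M} (hp : p ∈ (extChartAt (𝓡 n) c).source) :
    (chartDInv (n := n) c p).IsInvertible :=
  have : IsManifold (𝓡 n) 1 M := IsManifold.of_le (n := ∞) (by simp)
  isInvertible_mfderiv_extChartAt (I := 𝓡 n) (M := M) (H := EuclideanSpace ℝ (Fin n)) hp

lemma chartDInv_inverse (c : M) {p : M} (hp : p ∈ (extChartAt (𝓡 n) c).source)
    (v : EuclideanSpace ℝ (Fin n)) : chartDInv c p ((chartDInv c p).inverse v) = v :=
  (chartDInv_isInvertible c hp).self_apply_inverse v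

lemma inverse_chartDInv (c : M) {p : M} (hp : p ∈ (extChartAt (𝓡 n) c).source)
    (v : Tan n p) : (chartDInv c p).inverse (chartDInv c p v) = v :=
  (chartDInv_isInvertible c hp).inverse_apply_self v

lemma chartField_localField (c : M) (v : EuclideanSpace ℝ (Fin n) → EuclideanSpace ℝ (Fin n))
    {y : EuclideanSpace ℝ (Fin n)} (hy : y ∈ (extChartAt (𝓡 n) c).target) :
    chartField c (localField c v) y = v y := by
  rw [chartField, localField, chartDInv_inverse c ((extChartAt (𝓡 n) c).map_target hy),
    (extChartAt (𝓡 n) c).right_inv hy]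

lemma chartRep_localForm {k : ℕ} (c : M)
    (η : EuclideanSpace ℝ (Fin n) → (EuclideanSpace ℝ (Fin n)) [⋀^Fin k]→L[ℝ] ℝ)
    {y : EuclideanSpace ℝ (Fin n)} (hy : y ∈ (extChartAt (𝓡 n) c).target) :
    chartRep (localForm c η) c y = η y := by
  ext v
  change η (extChartAt (𝓡 n) c ((extChartAt (𝓡 n) c).symm y))
    (fun i => chartDInv c _ (chartD c y (v i))) = η y v
  rw [(extChartAt (𝓡 n) c).right_inv hy]
  simp only [chartDInv_chartD c hy]

lemma chartRep_apply {k : ℕ} (α : ∀ x : M, Cov n k x) (c : M) (y : EuclideanSpace ℝ (Fin n))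
    (v : Fin k → EuclideanSpace ℝ (Fin n)) :
    chartRep α c y v = α ((extChartAt (𝓡 n) c).symm y) fun i => chartD c y (v i) := rfl

/-- The expressions of a form in two charts are related by the change of charts. -/
lemma chartRep_change {k : ℕ} (α : ∀ x : M, Cov n k x) (c c' : M) {y : EuclideanSpace ℝ (Fin n)}
    (hy : y ∈ (extChartAt (𝓡 n) c').target)
    (hy' : (extChartAt (𝓡 n) c').symm y ∈ (extChartAt (𝓡 n) c).source) :
    chartRep α c' y = (chartRep α c (extChartAt (𝓡 n) c ((extChartAt (𝓡 n) c').symm y))).compContinuousLinearMap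
      (fderiv ℝ (fun z => extChartAt (𝓡 n) c ((extChartAt (𝓡 n) c').symm z)) y) := by
  have hd : fderiv ℝ (fun z => extChartAt (𝓡 n) c ((extChartAt (𝓡 n) c').symm z)) y =
      (chartDInv c ((extChartAt (𝓡 n) c').symm y)).comp (chartD c' y) := by
    rw [← mfderiv_eq_fderiv]
    exact mfderiv_comp y (mdifferentiableAt_chart c hy') (mdifferentiableAt_chart_symm c' hy)
  -- The equality of the two base points is made a hypothesis so that it can be eliminated;
  -- otherwise the tangent spaces have different types.
  have key : ∀ (q p : M), q = p → ∀ (hp : p ∈ (extChartAt (𝓡 n) c).source) (v : Fin k → Tan n p),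
      α q (fun i => ((chartD c (extChartAt (𝓡 n) c p) (chartDInv c p (v i)) : EuclideanSpace ℝ (Fin n)) : Tan n q)) =
      α p v := by
    rintro q p rfl hp v
    congr 1
    funext i
    have h1 := chartD_chartDInv c ((extChartAt (𝓡 n) c).map_source hp)
    rw [(extChartAt (𝓡 n) c).left_inv hp] at h1
    exact h1 (v i)
  ext v
  rw [hd]
  exact (key _ _ ((extChartAt (𝓡 n) c).left_inv hy') hy' fun i => chartD c' y (v i)).symm

lemma contDiffAt_chart_change (c c' : M) {y : EuclideanSpace ℝ (Fin n)}
    (hy : y ∈ (extChartAt (𝓡 n) c').target)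
    (hy' : (extChartAt (𝓡 n) c').symm y ∈ (extChartAt (𝓡 n) c).source) :
    ContDiffAt ℝ ∞ (fun z => extChartAt (𝓡 n) c ((extChartAt (𝓡 n) c').symm z)) y := by
  rw [← contMDiffAt_iff_contDiffAt]
  refine ContMDiffAt.comp y (contMDiffAt_extChartAt' (by rwa [← extChartAt_source (𝓡 n)])) ?_
  exact (contMDiffOn_extChartAt_symm c').contMDiffAt ((isOpen_extChartAt_target c').mem_nhds hy)

/-- A form is smooth if near every point it has a smooth expression in some chart. -/
lemma isSmoothForm_of_local {k : ℕ} {α : ∀ x : M, Cov n k x}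
    (h : ∀ p : M, ∃ c : M, p ∈ (extChartAt (𝓡 n) c).source ∧
      ContDiffAt ℝ ∞ (chartRep α c) (extChartAt (𝓡 n) c p)) : IsSmoothForm α := by
  intro c' y hy
  obtain ⟨c, hc, hs⟩ := h ((extChartAt (𝓡 n) c').symm y)
  refine ContDiffAt.contDiffWithinAt ?_
  have h1 := contDiffAt_chart_change c c' hy hc
  have h2 : ∀ᶠ z in 𝓝 y, z ∈ (extChartAt (𝓡 n) c').target ∧
      (extChartAt (𝓡 n) c').symm z ∈ (extChartAt (𝓡 n) c).source :=
    Filter.Eventually.and ((isOpen_extChartAt_target c').mem_nhds hy)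
      ((continuousAt_extChartAt_symm'' hy).preimage_mem_nhds
      ((isOpen_extChartAt_source c).mem_nhds hc))
  refine ContDiffAt.congr_of_eventuallyEq ?_
    (h2.mono fun z hz => chartRep_change α c c' hz.1 hz.2)
  exact (ContDiffAt.comp y hs h1).cam_comp (h1.fderiv_right (by simp))

lemma IsSmoothForm.contDiffAt {k : ℕ} {α : ∀ x : M, Cov n k x} (h : IsSmoothForm α) (c : M)
    {p : M} (hp : p ∈ (extChartAt (𝓡 n) c).source) :
    ContDiffAt ℝ ∞ (chartRep α c) (extChartAt (𝓡 n) c p) :=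
  (h c).contDiffAt ((isOpen_extChartAt_target c).mem_nhds ((extChartAt (𝓡 n) c).map_source hp))

/-- Cut-off functions. -/
lemma exists_cutoff [T2Space M] (c : M) {U : Set M} (hU : U ∈ 𝓝 c) :
    ∃ χ : C^∞⟮𝓡 n, M; ℝ⟯, (∀ᶠ p in 𝓝 c, χ p = 1) ∧ tsupport χ ⊆ U := by
  obtain ⟨f, -, hf⟩ := (SmoothBumpFunction.nhds_basis_tsupport (I := 𝓡 n) c).mem_iff.1 hU
  exact ⟨⟨f, f.contMDiff⟩, f.eventuallyEq_one, hf⟩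

lemma contDiffAt_comp_chart_symm (c : M) {p : M} (hp : p ∈ (extChartAt (𝓡 n) c).source)
    (χ : C^∞⟮𝓡 n, M; ℝ⟯) :
    ContDiffAt ℝ ∞ (fun y => χ ((extChartAt (𝓡 n) c).symm y)) (extChartAt (𝓡 n) c p) := by
  rw [← contMDiffAt_iff_contDiffAt]
  exact χ.contMDiff.contMDiffAt.comp _ ((contMDiffOn_extChartAt_symm c).contMDiffAt
    ((isOpen_extChartAt_target c).mem_nhds ((extChartAt (𝓡 n) c).map_source hp)))

lemma isSmoothForm_cutoff {k : ℕ} {c : M} {χ : C^∞⟮𝓡 n, M; ℝ⟯}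
    {η : EuclideanSpace ℝ (Fin n) → (EuclideanSpace ℝ (Fin n)) [⋀^Fin k]→L[ℝ] ℝ}
    (h : ∀ p ∈ tsupport χ, p ∈ (extChartAt (𝓡 n) c).source ∧
      ContDiffAt ℝ ∞ η (extChartAt (𝓡 n) c p)) :
    IsSmoothForm fun p => χ p • localForm c η p := by
  refine isSmoothForm_of_local fun p => ?_
  by_cases hp : p ∈ tsupport χ
  · obtain ⟨hc, hη⟩ := h p hp
    refine ⟨c, hc, ?_⟩
    have hy := (extChartAt (𝓡 n) c).map_source hc
    refine ((contDiffAt_comp_chart_symm c hc χ).smul hη).congr_of_eventuallyEq ?_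
    filter_upwards [(isOpen_extChartAt_target c).mem_nhds hy] with z hz
    rw [chartRep_smul]
    simp only [chartRep_localForm c η hz]
    rfl
  · refine ⟨p, mem_extChartAt_source p, ?_⟩
    have h0 : ∀ᶠ q in 𝓝 p, χ q = 0 := notMem_tsupport_iff_eventuallyEq.1 hp
    have h2 : ContinuousAt (extChartAt (𝓡 n) p).symm (extChartAt (𝓡 n) p p) :=
      continuousAt_extChartAt_symm p
    rw [ContinuousAt, extChartAt_to_inv] at h2
    refine (contDiffAt_const (c := 0)).congr_of_eventuallyEq ?_
    filter_upwards [h2.eventually h0] with z hz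
    rw [chartRep_smul]
    simp only [hz, zero_smul]

/-- The trivialization of the tangent bundle at `c` is, on fibres, the derivative of the chart, so
smoothness of a section becomes smoothness of its coordinate expression. -/
lemma contMDiffAt_field_iff (c : M) {p : M} (hp : p ∈ (extChartAt (𝓡 n) c).source)
    (V : ∀ x : M, Tan n x) :
    ContMDiffAt (𝓡 n) (𝓡 n).tangent ∞ (fun x => (⟨x, V x⟩ : TangentBundle (𝓡 n) M)) p ↔
      ContDiffAt ℝ ∞ (chartField c V) (extChartAt (𝓡 n) c p) := by
  have : IsManifold (𝓡 n) 1 M := IsManifold.of_le (n := ∞) (by simp)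
  let e := trivializationAt (EuclideanSpace ℝ (Fin n)) (TangentSpace (𝓡 n) (M := M)) c
  have hs : (extChartAt (𝓡 n) c).source = (chartAt (EuclideanSpace ℝ (Fin n)) c).source :=
    extChartAt_source (𝓡 n) c
  have hpe : p ∈ e.baseSet := by rw [hs] at hp; exact hp
  have h1 := e.contMDiffAt_section_iff (IB := 𝓡 n) (n := ∞) (s := V) hpe
  refine Iff.trans h1 ?_
  let u : M → EuclideanSpace ℝ (Fin n) := fun q => chartDInv c q (V q)
  have h2 : ∀ q ∈ (extChartAt (𝓡 n) c).source, (e ⟨q, V q⟩).2 = u q := by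
    intro q hq
    rw [hs] at hq
    have h3 := DFunLike.congr_fun (TangentBundle.continuousLinearMapAt_trivializationAt
      (I := 𝓡 n) hq) (V q)
    exact (Bundle.Trivialization.continuousLinearMapAt_apply_of_mem (R := ℝ) e hq _).symm.trans h3
  have h4 : (fun q => (e ⟨q, V q⟩).2) =ᶠ[𝓝 p] u := by
    filter_upwards [(isOpen_extChartAt_source (I := 𝓡 n) c).mem_nhds hp] with q hq
    exact h2 q hq
  refine Iff.trans h4.contMDiffAt_iff ?_
  have hy := (extChartAt (𝓡 n) c).map_source hp
  rw [← contMDiffAt_iff_contDiffAt]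
  constructor
  · intro h
    refine ContMDiffAt.comp (g := u) (f := (extChartAt (𝓡 n) c).symm) _ ?_
      ((contMDiffOn_extChartAt_symm c).contMDiffAt ((isOpen_extChartAt_target c).mem_nhds hy))
    rwa [(extChartAt (𝓡 n) c).left_inv hp]
  · intro h
    have h5 : ContMDiffAt (𝓡 n) (𝓡 n) ∞ (extChartAt (𝓡 n) c) p :=
      contMDiffAt_extChartAt' (by rwa [← hs])
    refine (ContMDiffAt.comp (g := chartField c V) (f := extChartAt (𝓡 n) c) p h h5).congr_of_eventuallyEq ?_
    filter_upwards [(isOpen_extChartAt_source (I := 𝓡 n) c).mem_nhds hp] with q hq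
    change u q = u ((extChartAt (𝓡 n) c).symm (extChartAt (𝓡 n) c q))
    rw [(extChartAt (𝓡 n) c).left_inv hq]

lemma chartField_smul (c : M) (f : M → ℝ) (V : ∀ x : M, Tan n x) :
    chartField c (fun p => f p • V p) =
      fun y => f ((extChartAt (𝓡 n) c).symm y) • chartField c V y := by
  funext y
  exact map_smul _ _ _

lemma isSmoothField_cutoff {c : M} {χ : C^∞⟮𝓡 n, M; ℝ⟯}
    {v : EuclideanSpace ℝ (Fin n) → EuclideanSpace ℝ (Fin n)}
    (h : ∀ p ∈ tsupport χ, p ∈ (extChartAt (𝓡 n) c).source ∧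
      ContDiffAt ℝ ∞ v (extChartAt (𝓡 n) c p)) :
    IsSmoothFieldOn (fun p => χ p • localField c v p) Set.univ := by
  rw [IsSmoothFieldOn, contMDiffOn_univ]
  intro p
  by_cases hp : p ∈ tsupport χ
  · obtain ⟨hc, hv⟩ := h p hp
    rw [contMDiffAt_field_iff c hc]
    refine ((contDiffAt_comp_chart_symm c hc χ).smul hv).congr_of_eventuallyEq ?_
    filter_upwards [(isOpen_extChartAt_target c).mem_nhds
      ((extChartAt (𝓡 n) c).map_source hc)] with z hz
    rw [chartField_smul]
    simp only [chartField_localField c v hz]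
    rfl
  · rw [contMDiffAt_field_iff p (mem_extChartAt_source p)]
    have h0 : ∀ᶠ q in 𝓝 p, χ q = 0 := notMem_tsupport_iff_eventuallyEq.1 hp
    have h2 : ContinuousAt (extChartAt (𝓡 n) p).symm (extChartAt (𝓡 n) p p) :=
      continuousAt_extChartAt_symm p
    rw [ContinuousAt, extChartAt_to_inv] at h2
    refine (contDiffAt_const (c := 0)).congr_of_eventuallyEq ?_
    filter_upwards [h2.eventually h0] with z hz
    rw [chartField_smul]
    simp only [hz, zero_smul]

/-- The bracket on a manifold is defined by pulling back along the inverse chart, and near the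
centre these pull-backs are the chart expressions of the fields. -/
lemma mlieBracket_eq_chart (V W : ∀ x : M, Tan n x) (c : M) :
    VectorField.mlieBracket (𝓡 n) V W c = (chartDInv c c).inverse
      (VectorField.lieBracket ℝ (chartField c V) (chartField c W) (extChartAt (𝓡 n) c c)) := by
  have : IsManifold (𝓡 n) 1 M := IsManifold.of_le (n := ∞) (by simp)
  have key : ∀ V : ∀ x : M, Tan n x,
      VectorField.mpullbackWithin (𝓡 n) (𝓡 n) (extChartAt (𝓡 n) c).symm V Set.univ
        =ᶠ[𝓝 (extChartAt (𝓡 n) c c)] chartField c V := by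
    intro V
    filter_upwards [(isOpen_extChartAt_target (I := 𝓡 n) c).mem_nhds
      (mem_extChartAt_target c)] with y hy
    rw [VectorField.mpullbackWithin_apply, mfderivWithin_univ]
    have h1 : (mfderiv (𝓡 n) (𝓡 n) (extChartAt (𝓡 n) c).symm y).inverse =
        chartDInv c ((extChartAt (𝓡 n) c).symm y) := by
      apply ContinuousLinearMap.inverse_eq
      · ext1 v; exact chartD_chartDInv c hy v
      · ext1 v; exact chartDInv_chartD c hy v
    rw [h1]
    rfl
  rw [← VectorField.mlieBracketWithin_univ, VectorField.mlieBracketWithin_apply,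
    ModelWithCorners.range_eq_univ, Set.preimage_univ, Set.univ_inter]
  erw [VectorField.lieBracketWithin_univ]
  have h3 := Filter.EventuallyEq.lieBracket_vectorField_eq (𝕜 := ℝ) (key V) (key W)
  exact congrArg _ h3

end Charts
end FilteredManifold

end

section
open scoped Manifold ContDiff Topology TensorProduct

namespace FilteredManifold

/-! ### Local trivialization of the filtration of the tangent bundle. -/

section Flag
variable {E : Type*} [NormedAddCommGroup E] [NormedSpace ℝ E] [FiniteDimensional ℝ E]

/-- Coordinates with respect to a linearly independent family, extended to the whole space. -/
lemma exists_coordinates {r : ℕ} {X : Fin r → E} (hX : LinearIndependent ℝ X) :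
    ∃ κ : Fin r → E →L[ℝ] ℝ, ∀ v ∈ Submodule.span ℝ (Set.range X), ∑ a, κ a v • X a = v := by
  obtain ⟨l, hl⟩ := (Fintype.linearCombination ℝ X).exists_leftInverse_of_injective
    (LinearMap.ker_eq_bot.2 hX.fintypeLinearCombination_injective)
  refine ⟨fun a => LinearMap.toContinuousLinearMap (LinearMap.proj a ∘ₗ l), fun v hv => ?_⟩
  rw [← Fintype.range_linearCombination] at hv
  obtain ⟨c, rfl⟩ := hv
  have h : l (Fintype.linearCombination ℝ X c) = c := LinearMap.congr_fun hl c
  simp only [LinearMap.coe_toContinuousLinearMap', LinearMap.comp_apply, h, LinearMap.proj_apply]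
  rfl

/-- A smooth family of flags is locally trivial. -/
lemma exists_flag_transport (s : ℕ) (K : ℕ → E → Submodule ℝ E) (y₀ : E) (h0 : K 0 y₀ = ⊥)
    (hs : K s y₀ = ⊤) (hmono : ∀ y i j, i ≤ j → K i y ≤ K j y)
    (hK : ∀ i, ∃ (r : ℕ) (X : Fin r → E → E), ∀ᶠ y in 𝓝 y₀, (∀ a, ContDiffAt ℝ ∞ (X a) y) ∧
      LinearIndependent ℝ (fun a => X a y) ∧
      Submodule.span ℝ (Set.range fun a => X a y) = K i y) :
    ∃ φ : E → E →L[ℝ] E, φ y₀ = ContinuousLinearMap.id ℝ E ∧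
      ∀ᶠ y in 𝓝 y₀, ContDiffAt ℝ ∞ φ y ∧ (φ y).IsInvertible ∧
        ∀ i ≤ s, ∀ v, φ y v ∈ K i y ↔ v ∈ K i y₀ := by
  choose r X hX using hK
  have hX0 := fun i => (hX i).self_of_nhds
  choose κ hκ using fun i => exists_coordinates (hX0 i).2.1
  have hκ' : ∀ i, ∀ v ∈ K i y₀, ∑ a, κ i a v • X i a y₀ = v := fun i v hv =>
    hκ i v (by rw [(hX0 i).2.2]; exact hv)
  -- `ϖ i` takes values in `K i y₀` and is the identity there, so the differences `ϖ (i + 1) - ϖ i`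
  -- cut a vector into layers adapted to the flag at `y₀`.
  let ϖ : ℕ → E →L[ℝ] E := fun i => ∑ a, (κ i a).smulRight (X i a y₀)
  have hϖ : ∀ i v, ϖ i v = ∑ a, κ i a v • X i a y₀ := fun i v => by
    simp [ϖ]
  have hϖ_mem : ∀ i v, ϖ i v ∈ K i y₀ := fun i v => by
    rw [hϖ, ← (hX0 i).2.2]
    exact Submodule.sum_mem _ fun a _ => Submodule.smul_mem _ _
      (Submodule.subset_span ⟨a, rfl⟩)
  -- Each layer is expanded in the frame of `K (i + 1)` at `y₀` and rebuilt with the same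
  -- coefficients from the frame at `y`. On `K i y₀` the layers from `i` onwards vanish, so `φ y`
  -- maps `K i y₀` into `K i y`; at `y₀` the layers telescope to the identity.
  let φ : E → E →L[ℝ] E := fun y => ∑ i ∈ Finset.range s, ∑ a,
    ((κ (i + 1) a).comp (ϖ (i + 1) - ϖ i)).smulRight (X (i + 1) a y)
  have hφ : ∀ y v, φ y v = ∑ i ∈ Finset.range s, ∑ a,
      κ (i + 1) a (ϖ (i + 1) v - ϖ i v) • X (i + 1) a y := fun y v => by
    simp [φ]
  have hφ0 : φ y₀ = ContinuousLinearMap.id ℝ E := by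
    ext v
    rw [hφ]
    have h1 : ∀ i, ∑ a, κ (i + 1) a (ϖ (i + 1) v - ϖ i v) • X (i + 1) a y₀ =
        ϖ (i + 1) v - ϖ i v := fun i =>
      hκ' (i + 1) _ (Submodule.sub_mem _ (hϖ_mem _ _) (hmono _ _ _ (Nat.le_succ i) (hϖ_mem _ _)))
    simp only [h1]
    rw [Finset.sum_range_sub (fun i => ϖ i v), hϖ s, hκ' s v (by rw [hs]; trivial)]
    have h2 : ϖ 0 v = 0 := by have := hϖ_mem 0 v; rwa [h0, Submodule.mem_bot] at this
    rw [h2, sub_zero]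
    rfl
  refine ⟨φ, hφ0, ?_⟩
  have hXall : ∀ᶠ y in 𝓝 y₀, ∀ i ∈ Finset.range (s + 1), (∀ a, ContDiffAt ℝ ∞ (X i a) y) ∧
      LinearIndependent ℝ (fun a => X i a y) ∧
      Submodule.span ℝ (Set.range fun a => X i a y) = K i y :=
    (Filter.eventually_all_finset _).2 fun i _ => hX i
  have hsm : ∀ y, (∀ i ∈ Finset.range (s + 1), (∀ a, ContDiffAt ℝ ∞ (X i a) y) ∧
      LinearIndependent ℝ (fun a => X i a y) ∧
      Submodule.span ℝ (Set.range fun a => X i a y) = K i y) → ContDiffAt ℝ ∞ φ y := by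
    intro y hy
    refine ContDiffAt.sum fun i hi => ContDiffAt.sum fun a _ => ?_
    have h1 := (hy (i + 1) (by simpa using hi)).1 a
    exact (ContinuousLinearMap.smulRightL ℝ E E
      ((κ (i + 1) a).comp (ϖ (i + 1) - ϖ i))).contDiff.contDiffAt.comp y h1
  have hinv : ∀ᶠ y in 𝓝 y₀, (φ y).IsInvertible := by
    have h1 : ContinuousAt φ y₀ := (hsm y₀ hXall.self_of_nhds).continuousAt
    have h2 : {T : E →L[ℝ] E | T.IsInvertible} ∈ 𝓝 (φ y₀) := by
      rw [hφ0]
      exact (ContinuousLinearEquiv.refl ℝ E).nhds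
    exact h1.eventually h2
  filter_upwards [hXall, hinv] with y hy hi
  refine ⟨hsm y hy, hi, fun i his v => ?_⟩
  have hle : (K i y₀).map (φ y).toLinearMap ≤ K i y := by
    rintro _ ⟨u, hu, rfl⟩
    change φ y u ∈ K i y
    rw [hφ]
    refine Submodule.sum_mem _ fun j hj => ?_
    have hj' : j < s := by simpa using hj
    rcases lt_or_ge j i with hji | hji
    · refine Submodule.sum_mem _ fun a _ => Submodule.smul_mem _ _ ?_
      refine hmono y (j + 1) i hji ?_
      rw [← (hy (j + 1) (by simpa using hj')).2.2]
      exact Submodule.subset_span ⟨a, rfl⟩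
    · have h1 : ϖ (j + 1) u = u := by
        rw [hϖ]; exact hκ' _ _ (hmono _ _ _ (by omega) hu)
      have h2 : ϖ j u = u := by
        rw [hϖ]; exact hκ' _ _ (hmono _ _ _ hji hu)
      simp [h1, h2]
  have hinj : Function.Injective (φ y) := by
    obtain ⟨e, he⟩ := hi
    rw [← he]; exact e.injective
  have hdim : ∀ z, (∀ i ∈ Finset.range (s + 1), (∀ a, ContDiffAt ℝ ∞ (X i a) z) ∧
      LinearIndependent ℝ (fun a => X i a z) ∧
      Submodule.span ℝ (Set.range fun a => X i a z) = K i z) →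
      Module.finrank ℝ (K i z) = r i := by
    intro z hz
    have h1 := hz i (by simp; omega)
    rw [← h1.2.2, finrank_span_eq_card h1.2.1, Fintype.card_fin]
  -- The inclusion is an equality by dimension: both spaces have a frame of `r i` vectors and `φ y`
  -- is injective.
  have heq : (K i y₀).map (φ y).toLinearMap = K i y := by
    refine Submodule.eq_of_le_of_finrank_eq hle ?_
    rw [← (Submodule.equivMapOfInjective (φ y).toLinearMap hinj (K i y₀)).finrank_eq,
      hdim y hy, hdim y₀ hXall.self_of_nhds]
  constructor
  · intro h
    rw [← heq] at h
    obtain ⟨u, hu, huv⟩ := h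
    rwa [← hinj huv]
  · intro h
    exact hle ⟨v, h, rfl⟩

end Flag

namespace TangentFiltration
variable {n : ℕ} {M : Type*} [TopologicalSpace M] [ChartedSpace (EuclideanSpace ℝ (Fin n)) M]
  [IsManifold (𝓡 n) ∞ M] (F : TangentFiltration n M)

/-- The expression of `H i` in the chart around `c`. -/
def chartH (c : M) (i : ℕ) (y : EuclideanSpace ℝ (Fin n)) :
    Submodule ℝ (EuclideanSpace ℝ (Fin n)) :=
  (F.H i ((extChartAt (𝓡 n) c).symm y)).comap (chartD c y).toLinearMap

lemma mem_chartH_iff {c p : M} (hp : p ∈ (extChartAt (𝓡 n) c).source) {i : ℕ}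
    {v : EuclideanSpace ℝ (Fin n)} :
    v ∈ F.chartH c i (extChartAt (𝓡 n) c p) ↔ (chartDInv c p).inverse v ∈ F.H i p := by
  have hy := (extChartAt (𝓡 n) c).map_source hp
  have h1 : (chartDInv c ((extChartAt (𝓡 n) c).symm (extChartAt (𝓡 n) c p))).inverse =
      chartD c (extChartAt (𝓡 n) c p) := by
    apply ContinuousLinearMap.inverse_eq
    · ext1 v; exact chartDInv_chartD c hy v
    · ext1 v; exact chartD_chartDInv c hy v
  change chartD c (extChartAt (𝓡 n) c p) v ∈ F.H i _ ↔ _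
  rw [← h1, (extChartAt (𝓡 n) c).left_inv hp]

lemma chartDInv_mem_chartH_iff {c p : M} (hp : p ∈ (extChartAt (𝓡 n) c).source) {i : ℕ}
    {v : Tan n p} : chartDInv c p v ∈ F.chartH c i (extChartAt (𝓡 n) c p) ↔ v ∈ F.H i p := by
  rw [F.mem_chartH_iff hp, inverse_chartDInv c hp]

lemma exists_chart_frame (c : M) (i : ℕ) :
    ∃ (r : ℕ) (X : Fin r → EuclideanSpace ℝ (Fin n) → EuclideanSpace ℝ (Fin n)),
      ∀ᶠ y in 𝓝 (extChartAt (𝓡 n) c c), (∀ a, ContDiffAt ℝ ∞ (X a) y) ∧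
        LinearIndependent ℝ (fun a => X a y) ∧
        Submodule.span ℝ (Set.range fun a => X a y) = F.chartH c i y := by
  obtain ⟨r, X, U, hU, hX, hXU⟩ := F.subbundle i c
  refine ⟨r, fun a => chartField c (X a), ?_⟩
  have hU' : interior U ∈ 𝓝 c := interior_mem_nhds.2 hU
  have h2 : ContinuousAt (extChartAt (𝓡 n) c).symm (extChartAt (𝓡 n) c c) :=
    continuousAt_extChartAt_symm c
  rw [ContinuousAt, extChartAt_to_inv] at h2
  filter_upwards [h2.eventually hU', (isOpen_extChartAt_target (I := 𝓡 n) c).mem_nhds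
      (mem_extChartAt_target c)] with y hyU hy
  have hp := (extChartAt (𝓡 n) c).map_target hy
  have hyy := (extChartAt (𝓡 n) c).right_inv hy
  set p := (extChartAt (𝓡 n) c).symm y with hpdef
  obtain ⟨hli, hsp⟩ := hXU p (interior_subset hyU)
  refine ⟨fun a => ?_, ?_, ?_⟩
  · rw [← hyy, ← contMDiffAt_field_iff c hp]
    exact (hX a).contMDiffAt (mem_interior_iff_mem_nhds.1 hyU)
  · refine hli.map' (chartDInv c p).toLinearMap (LinearMap.ker_eq_bot_of_inverse
      (g := (chartD c y).toLinearMap) ?_)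
    ext1 v
    exact chartD_chartDInv c hy v
  · rw [show (Set.range fun a => chartField c (X a) y) =
      (chartDInv c p).toLinearMap '' (Set.range fun a => X a p) from
        (Set.range_comp (chartDInv c p) (fun a => X a p)), ← Submodule.map_span, hsp]
    ext v
    constructor
    · rintro ⟨u, hu, rfl⟩
      change chartD c y (chartDInv c p u) ∈ F.H i p
      rw [chartD_chartDInv c hy]
      exact hu
    · intro h
      exact ⟨chartD c y v, h, chartDInv_chartD c hy v⟩

/-- A smooth local trivialization, in the chart around `x`, of the filtration of `TM`. -/
def IsTransport (x : M)
    (φ : EuclideanSpace ℝ (Fin n) → EuclideanSpace ℝ (Fin n) →L[ℝ] EuclideanSpace ℝ (Fin n)) :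
    Prop :=
  φ (extChartAt (𝓡 n) x x) = ContinuousLinearMap.id ℝ _ ∧
  ∀ᶠ y in 𝓝 (extChartAt (𝓡 n) x x), ContDiffAt ℝ ∞ φ y ∧ (φ y).IsInvertible ∧
    ∀ i v, φ y v ∈ F.chartH x i y ↔ v ∈ F.chartH x i (extChartAt (𝓡 n) x x)

lemma exists_isTransport (x : M) : ∃ φ, F.IsTransport x φ := by
  have hx := mem_extChartAt_source (I := 𝓡 n) x
  obtain ⟨φ, h0, hφ⟩ := exists_flag_transport F.s (F.chartH x) (extChartAt (𝓡 n) x x)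
    (by
      rw [eq_bot_iff]
      intro v hv
      rw [F.mem_chartH_iff hx, F.zero, Submodule.mem_bot] at hv
      rw [Submodule.mem_bot, ← chartDInv_inverse x hx v, hv, map_zero])
    (by
      rw [eq_top_iff]
      intro v _
      rw [F.mem_chartH_iff hx, F.top _ le_rfl]
      trivial)
    (fun y i j hij v hv => F.H_mono hij _ hv)
    (F.exists_chart_frame x)
  refine ⟨φ, h0, hφ.mono fun y hy => ⟨hy.1, hy.2.1, fun i v => ?_⟩⟩
  rcases le_total i F.s with h | h
  · exact hy.2.2 i h v
  · have h1 : ∀ z, F.chartH x i z = ⊤ := fun z => by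
      rw [chartH, F.top i h, Submodule.comap_top]
    simp [h1]

-- The vector is carried along by `φ` and cut off. The formula near `x` is kept in the conclusion
-- because brackets at `x` are computed from it.
variable {F} in
lemma IsTransport.exists_section [T2Space M] {x : M}
    {φ : EuclideanSpace ℝ (Fin n) → EuclideanSpace ℝ (Fin n) →L[ℝ] EuclideanSpace ℝ (Fin n)}
    (hφ : F.IsTransport x φ) {i : ℕ} {v : Tan n x} (hv : v ∈ F.H i x) :
    ∃ V, IsSmoothSection (F.H i) V ∧ V x = v ∧
      chartField x V =ᶠ[𝓝 (extChartAt (𝓡 n) x x)] fun y => φ y (chartDInv x x v) := by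
  have hx := mem_extChartAt_source (I := 𝓡 n) x
  have hU : ∀ᶠ p in 𝓝 x, p ∈ (extChartAt (𝓡 n) x).source ∧
      (ContDiffAt ℝ ∞ φ (extChartAt (𝓡 n) x p) ∧ (φ (extChartAt (𝓡 n) x p)).IsInvertible ∧
    ∀ i v, φ (extChartAt (𝓡 n) x p) v ∈ F.chartH x i (extChartAt (𝓡 n) x p) ↔
      v ∈ F.chartH x i (extChartAt (𝓡 n) x x)) :=
    Filter.Eventually.and ((isOpen_extChartAt_source x).mem_nhds hx)
      ((continuousAt_extChartAt x).eventually hφ.2)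
  obtain ⟨χ, hχ1, hχ⟩ := exists_cutoff (n := n) x hU
  refine ⟨fun p => χ p • localField x (fun y => φ y (chartDInv x x v)) p, ⟨?_, ?_⟩, ?_, ?_⟩
  · exact isSmoothField_cutoff fun p hp =>
      ⟨(hχ hp).1, (hχ hp).2.1.clm_apply contDiffAt_const⟩
  · intro p
    by_cases hp : p ∈ tsupport χ
    · refine Submodule.smul_mem _ _ ?_
      rw [localField, ← F.mem_chartH_iff (hχ hp).1, (hχ hp).2.2.2, F.chartDInv_mem_chartH_iff hx]
      exact hv
    · dsimp only
      rw [image_eq_zero_of_notMem_tsupport hp, zero_smul]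
      exact Submodule.zero_mem _
  · dsimp only
    rw [hχ1.self_of_nhds, one_smul, localField, hφ.1]
    exact inverse_chartDInv x hx v
  · have h2 : ContinuousAt (extChartAt (𝓡 n) x).symm (extChartAt (𝓡 n) x x) :=
      continuousAt_extChartAt_symm x
    rw [ContinuousAt, extChartAt_to_inv] at h2
    filter_upwards [h2.eventually hχ1, (isOpen_extChartAt_target (I := 𝓡 n) x).mem_nhds
      (mem_extChartAt_target x)] with y h1 hy
    rw [chartField_smul]
    simp only [h1, one_smul]
    exact chartField_localField x _ hy

/-- Elements of weight at least `w` extend to forms of weight at least `w`. -/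
lemma exists_form [T2Space M] {w : ℕ} {x : M} {a : FormFiber n x} (ha : a ∈ F.fiberGE w x) :
    ∃ α ∈ F.formsGE w, α.val x = a := by
  obtain ⟨φ, hφ⟩ := F.exists_isTransport x
  have hx := mem_extChartAt_source (I := 𝓡 n) x
  have hU : ∀ᶠ p in 𝓝 x, p ∈ (extChartAt (𝓡 n) x).source ∧
      (ContDiffAt ℝ ∞ φ (extChartAt (𝓡 n) x p) ∧ (φ (extChartAt (𝓡 n) x p)).IsInvertible ∧
    ∀ i v, φ (extChartAt (𝓡 n) x p) v ∈ F.chartH x i (extChartAt (𝓡 n) x p) ↔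
      v ∈ F.chartH x i (extChartAt (𝓡 n) x x)) :=
    Filter.Eventually.and ((isOpen_extChartAt_source x).mem_nhds hx)
      ((continuousAt_extChartAt x).eventually hφ.2)
  obtain ⟨χ, hχ1, hχ⟩ := exists_cutoff (n := n) x hU
  -- The value at `x` is spread over the chart by pulling back along the inverse of the transport,
  -- which preserves the filtration and hence the weights.
  let η : ∀ k : ℕ, EuclideanSpace ℝ (Fin n) → (EuclideanSpace ℝ (Fin n)) [⋀^Fin k]→L[ℝ] ℝ :=
    fun k y => (a k).compContinuousLinearMap ((chartDInv x x).inverse.comp (φ y).inverse)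
  have hη : ∀ k p, p ∈ tsupport χ → p ∈ (extChartAt (𝓡 n) x).source ∧
      ContDiffAt ℝ ∞ (η k) (extChartAt (𝓡 n) x p) := by
    intro k p hp
    obtain ⟨h1, h2, ⟨e, he⟩, -⟩ := hχ hp
    refine ⟨h1, ?_⟩
    have h3 : ContDiffAt ℝ ∞ (fun y => (φ y).inverse) (extChartAt (𝓡 n) x p) := by
      have h4 := contDiffAt_map_inverse (n := ∞) e
      rw [he] at h4
      exact h4.comp _ h2
    let b : (EuclideanSpace ℝ (Fin n)) [⋀^Fin k]→L[ℝ] ℝ :=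
      (a k).compContinuousLinearMap (chartDInv x x).inverse
    exact (contDiffAt_const (c := b)).cam_comp h3
  refine ⟨⟨fun p k => χ p • localForm x (η k) p, fun k => isSmoothForm_cutoff (hη k)⟩, ?_, ?_⟩
  · intro p k i v hv hw
    change χ p • (a k fun l => (chartDInv x x).inverse ((φ (extChartAt (𝓡 n) x p)).inverse
      (chartDInv x p (v l)))) = 0
    by_cases hp : p ∈ tsupport χ
    · obtain ⟨h1, h2, h3, h4⟩ := hχ hp
      rw [ha k i _ (fun l => ?_) hw, smul_zero]
      rw [← F.mem_chartH_iff hx, ← h4, h3.self_apply_inverse, F.chartDInv_mem_chartH_iff h1]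
      exact hv l
    · rw [image_eq_zero_of_notMem_tsupport hp, zero_smul]
  · funext k
    ext v
    change χ x • (a k fun l => (chartDInv x x).inverse ((φ (extChartAt (𝓡 n) x x)).inverse
      (chartDInv x x (v l)))) = a k v
    rw [hχ1.self_of_nhds, one_smul, hφ.1, ContinuousLinearMap.inverse_id]
    congr 1
    funext l
    exact inverse_chartDInv x hx (v l)

end TangentFiltration

end FilteredManifold

end

/-! ### The Lie bracket of the osculating algebra. -/

section
open scoped Manifold ContDiff Topology TensorProduct

namespace FilteredManifold

section
variable {n : ℕ} {M : Type*} [TopologicalSpace M] [ChartedSpace (EuclideanSpace ℝ (Fin n)) M]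
  [IsManifold (𝓡 n) ∞ M]

lemma chartRep_apply_chart {k : ℕ} (α : ∀ x : M, Cov n k x) {c p : M}
    (hp : p ∈ (extChartAt (𝓡 n) c).source) (v : Fin k → EuclideanSpace ℝ (Fin n)) :
    chartRep α c (extChartAt (𝓡 n) c p) v = α p fun i => (chartDInv c p).inverse (v i) := by
  have hy := (extChartAt (𝓡 n) c).map_source hp
  have h1 : (chartDInv c ((extChartAt (𝓡 n) c).symm (extChartAt (𝓡 n) c p))).inverse =
      chartD c (extChartAt (𝓡 n) c p) := by
    apply ContinuousLinearMap.inverse_eq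
    · ext1 v; exact chartDInv_chartD c hy v
    · ext1 v; exact chartD_chartDInv c hy v
  rw [chartRep_apply, ← h1, (extChartAt (𝓡 n) c).left_inv hp]

end

namespace TangentFiltration
variable {n : ℕ} {M : Type*} [TopologicalSpace M] [ChartedSpace (EuclideanSpace ℝ (Fin n)) M]
  [IsManifold (𝓡 n) ∞ M] (F : TangentFiltration n M)

/-- The value at `x` of the bracket of the vector fields extending two tangent vectors by means
of the trivialization `φ`. -/
def tanBracket (x : M)
    (φ : EuclideanSpace ℝ (Fin n) → EuclideanSpace ℝ (Fin n) →L[ℝ] EuclideanSpace ℝ (Fin n)) :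
    Tan n x →ₗ[ℝ] Tan n x →ₗ[ℝ] Tan n x :=
  LinearMap.mk₂ ℝ (fun v w => (chartDInv x x).inverse
      (fderiv ℝ φ (extChartAt (𝓡 n) x x) (chartDInv x x v) (chartDInv x x w) -
        fderiv ℝ φ (extChartAt (𝓡 n) x x) (chartDInv x x w) (chartDInv x x v)))
    (fun v v' w => by
      rw [← map_add]; congr 1
      simp only [map_add, add_apply]; abel)
    (fun r v w => by
      rw [← map_smul]; congr 1
      simp only [map_smul, smul_apply, smul_sub])
    (fun v w w' => by
      rw [← map_add]; congr 1
      simp only [map_add, add_apply]; abel)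
    (fun r v w => by
      rw [← map_smul]; congr 1
      simp only [map_smul, smul_apply, smul_sub])

lemma tanBracket_swap (x : M)
    (φ : EuclideanSpace ℝ (Fin n) → EuclideanSpace ℝ (Fin n) →L[ℝ] EuclideanSpace ℝ (Fin n))
    (v w : Tan n x) : tanBracket x φ v w = -tanBracket x φ w v := by
  simp only [tanBracket, LinearMap.mk₂_apply]
  rw [← map_neg, neg_sub]

variable {F} {x : M}
  {φ : EuclideanSpace ℝ (Fin n) → EuclideanSpace ℝ (Fin n) →L[ℝ] EuclideanSpace ℝ (Fin n)}

lemma lieBracket_transport {E : Type*} [NormedAddCommGroup E] [NormedSpace ℝ E] {y : E}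
    {φ : E → E →L[ℝ] E} (h0 : φ y = ContinuousLinearMap.id ℝ _) (h1 : DifferentiableAt ℝ φ y)
    (v w : E) : VectorField.lieBracket ℝ (fun y => φ y v) (fun y => φ y w) y =
      fderiv ℝ φ y v w - fderiv ℝ φ y w v := by
  have h2 : ∀ u, φ y u = u := fun u => by rw [h0]; rfl
  rw [VectorField.lieBracket_eq]
  simp only
  rw [fderiv_clm_apply h1 (differentiableAt_const _), fderiv_clm_apply h1 (differentiableAt_const _)]
  simp [h2]

/-- The value is that of the Lie bracket of two genuine sections of `H i` and `H j`, so the bracket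
condition of the filtration applies. -/
lemma IsTransport.tanBracket_mem [T2Space M] (hφ : F.IsTransport x φ) {i j : ℕ} {v w : Tan n x}
    (hv : v ∈ F.H i x) (hw : w ∈ F.H j x) : tanBracket x φ v w ∈ F.H (i + j) x := by
  obtain ⟨V, hV, -, hVv⟩ := hφ.exists_section hv
  obtain ⟨W, hW, -, hWw⟩ := hφ.exists_section hw
  have h := F.bracket i j V W hV hW x
  rw [mlieBracket_eq_chart, Filter.EventuallyEq.lieBracket_vectorField_eq hVv hWw,
    lieBracket_transport hφ.1 (hφ.2.self_of_nhds.1.differentiableAt (by simp))] at h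
  exact h

lemma fderiv_mem_of_eventually_mem {E : Type*} [NormedAddCommGroup E] [NormedSpace ℝ E]
    {E' : Type*} [NormedAddCommGroup E'] [NormedSpace ℝ E'] [FiniteDimensional ℝ E']
    {f : E → E'} {y : E} {K : Submodule ℝ E'} (hf : DifferentiableAt ℝ f y)
    (h : ∀ᶠ z in 𝓝 y, f z ∈ K) (v : E) : fderiv ℝ f y v ∈ K := by
  obtain ⟨q, hq⟩ := K.exists_isCompl
  have hker : ∀ u, q.projection K hq.symm u = 0 ↔ u ∈ K := fun u => by
    rw [← LinearMap.mem_ker, Submodule.ker_projection]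
  let l := LinearMap.toContinuousLinearMap (q.projection K hq.symm)
  have h1 : (fun z => l (f z)) =ᶠ[𝓝 y] fun _ => 0 := h.mono fun z hz => (hker _).2 hz
  have h2 := (l.hasFDerivAt.comp y hf.hasFDerivAt).fderiv
  rw [show ⇑l ∘ f = fun z => l (f z) from rfl, h1.fderiv_eq, fderiv_const_apply] at h2
  exact (hker _).1 (DFunLike.congr_fun h2 v).symm

/-- Writing the sections as `φ u` and `φ w`, the Leibniz rule leaves the error `Dw(u) - Du(w)`. In
the trivialization `u` and `w` take values in a fixed subspace, so their derivatives stay in it.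
Applied one step below the weight of the bracket, this says that its class depends only on the
values at `x`. -/
lemma IsTransport.mlieBracket_sub_mem (hφ : F.IsTransport x φ) {i j m : ℕ}
    {V W : ∀ x : M, Tan n x} (hV : IsSmoothSection (F.H i) V) (hW : IsSmoothSection (F.H j) W)
    (hi : i ≤ m) (hj : j ≤ m) :
    VectorField.mlieBracket (𝓡 n) V W x - tanBracket x φ (V x) (W x) ∈ F.H m x := by
  have hx := mem_extChartAt_source (I := 𝓡 n) x
  set y₀ := extChartAt (𝓡 n) x x with hy₀
  -- the coordinates of a section in the trivialization
  have key : ∀ {i : ℕ} {V : ∀ x : M, Tan n x}, IsSmoothSection (F.H i) V → i ≤ m →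
      ∃ u : EuclideanSpace ℝ (Fin n) → EuclideanSpace ℝ (Fin n), DifferentiableAt ℝ u y₀ ∧
        (chartField x V =ᶠ[𝓝 y₀] fun y => φ y (u y)) ∧ u y₀ = chartDInv x x (V x) ∧
        ∀ h, fderiv ℝ u y₀ h ∈ F.chartH x m y₀ := by
    intro i V hV him
    have hVs : ContDiffAt ℝ ∞ (chartField x V) y₀ := by
      rw [hy₀, ← contMDiffAt_field_iff x hx]
      exact hV.1.contMDiffAt Filter.univ_mem
    obtain ⟨hs, -, -⟩ := hφ.2.self_of_nhds
    have hinv : ContDiffAt ℝ ∞ (fun y => (φ y).inverse) y₀ := by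
      have h4 := contDiffAt_map_inverse (n := ∞)
        (ContinuousLinearEquiv.refl ℝ (EuclideanSpace ℝ (Fin n)))
      rw [show ((ContinuousLinearEquiv.refl ℝ (EuclideanSpace ℝ (Fin n)) :
        EuclideanSpace ℝ (Fin n) →L[ℝ] EuclideanSpace ℝ (Fin n))) = φ y₀ from hφ.1.symm] at h4
      exact h4.comp _ hs
    have hu : ContDiffAt ℝ ∞ (fun y => (φ y).inverse (chartField x V y)) y₀ := hinv.clm_apply hVs
    refine ⟨fun y => (φ y).inverse (chartField x V y), hu.differentiableAt (by simp), ?_, ?_, ?_⟩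
    · filter_upwards [hφ.2] with y hy
      exact (hy.2.1.self_apply_inverse _).symm
    · dsimp only
      rw [show φ y₀ = _ from hφ.1, ContinuousLinearMap.inverse_id]
      change chartField x V y₀ = _
      rw [chartField, hy₀, (extChartAt (𝓡 n) x).left_inv hx]
    · refine fderiv_mem_of_eventually_mem (hu.differentiableAt (by simp)) ?_
      filter_upwards [hφ.2, (isOpen_extChartAt_target (I := 𝓡 n) x).mem_nhds
        (mem_extChartAt_target x)] with y hy hyt
      rw [← hy.2.2, hy.2.1.self_apply_inverse]
      change chartD x y (chartDInv x _ _) ∈ F.H m _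
      rw [chartD_chartDInv x hyt]
      exact F.H_mono him _ (hV.2 _)
  obtain ⟨u, hud, hu, hu0, hum⟩ := key hV hi
  obtain ⟨w, hwd, hw, hw0, hwm⟩ := key hW hj
  have hd : DifferentiableAt ℝ φ y₀ := hφ.2.self_of_nhds.1.differentiableAt (by simp)
  have h1 : VectorField.lieBracket ℝ (chartField x V) (chartField x W) y₀ =
      (fderiv ℝ φ y₀ (u y₀) (w y₀) - fderiv ℝ φ y₀ (w y₀) (u y₀)) +
        (fderiv ℝ w y₀ (u y₀) - fderiv ℝ u y₀ (w y₀)) := by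
    rw [Filter.EventuallyEq.lieBracket_vectorField_eq hu hw, VectorField.lieBracket_eq]
    simp only
    rw [fderiv_clm_apply hd hud, fderiv_clm_apply hd hwd]
    have h2 : ∀ u, φ y₀ u = u := fun u => by rw [hφ.1]; rfl
    simp [h2]
    abel
  have h2 : VectorField.mlieBracket (𝓡 n) V W x - tanBracket x φ (V x) (W x) =
      (chartDInv x x).inverse (fderiv ℝ w y₀ (u y₀) - fderiv ℝ u y₀ (w y₀)) := by
    rw [mlieBracket_eq_chart, h1, map_add, hu0, hw0]
    exact add_sub_cancel_left _ _
  rw [h2, ← F.mem_chartH_iff hx]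
  exact Submodule.sub_mem _ (hwm _) (hum _)

lemma cls_add (j : Fin F.s) (v w : F.H (j + 1) x) :
    F.cls x j (v + w) = F.cls x j v + F.cls x j w := by
  rw [cls, Submodule.Quotient.mk_add, Pi.single_add]; rfl

lemma cls_smul (r : ℝ) (j : Fin F.s) (v : F.H (j + 1) x) :
    F.cls x j (r • v) = r • F.cls x j v := by
  exact map_smul (LinearMap.single ℝ (fun j : Fin F.s =>
    (F.H (j + 1) x) ⧸ (F.H j x).submoduleOf (F.H (j + 1) x)) j ∘ₗ Submodule.mkQ _) r v

lemma cls_eq_of_sub_mem {j : Fin F.s} {v w : F.H (j + 1) x}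
    (h : (v : Tan n x) - w ∈ F.H j x) : F.cls x j v = F.cls x j w := by
  rw [cls, cls]
  congr 1
  exact (Submodule.Quotient.eq _).2 h

lemma osc_hom_ext {W : Type*} [AddCommGroup W] [Module ℝ W] {f f' : F.Osc x →ₗ[ℝ] W}
    (h : ∀ j v, f (F.cls x j v) = f' (F.cls x j v)) : f = f' := by
  refine LinearMap.pi_ext fun j u => ?_
  obtain ⟨v, rfl⟩ := Submodule.Quotient.mk_surjective _ u
  exact h j v

/-- Existence of the Lie bracket of `g_x M`, in terms of a trivialization of the filtration. -/
lemma IsTransport.exists_oscBracket [T2Space M]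
    (g : Bundle.ContMDiffRiemannianMetric (𝓡 n) ∞ (EuclideanSpace ℝ (Fin n))
      (fun x : M => Tan n x)) (hφ : F.IsTransport x φ) :
    ∃ b : F.Osc x →ₗ[ℝ] F.Osc x →ₗ[ℝ] F.Osc x, ∀ (i j : Fin F.s) (v : F.H (i + 1) x)
      (w : F.H (j + 1) x), b (F.cls x i v) (F.cls x j w) =
        if h : (i : ℕ) + j + 1 < F.s then
          F.cls x ⟨i + j + 1, h⟩ ⟨tanBracket x φ v w, by
            have := hφ.tanBracket_mem v.2 w.2
            rwa [show (i : ℕ) + 1 + (j + 1) = i + j + 1 + 1 by ring] at this⟩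
        else 0 := by
  have hmem : ∀ (i j : Fin F.s) (u w : F.Osc x),
      tanBracket x φ (F.orthLift g x i (u i)) (F.orthLift g x j (w j)) ∈
        F.H ((i : ℕ) + j + 1 + 1) x := fun i j u w => by
    have := hφ.tanBracket_mem (F.orthLift_mem g x i (u i)) (F.orthLift_mem g x j (w j))
    rwa [show (i : ℕ) + 1 + (j + 1) = i + j + 1 + 1 by ring] at this
  -- The orthogonal lifts are linear, which makes bilinearity evident. Changing a lift by a
  -- lower-order vector lowers the bracket by one step and does not affect its class.
  let B : F.Osc x → F.Osc x → F.Osc x := fun u w => ∑ i : Fin F.s, ∑ j : Fin F.s,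
    if h : (i : ℕ) + j + 1 < F.s then F.cls x ⟨i + j + 1, h⟩ ⟨_, hmem i j u w⟩ else 0
  let b : F.Osc x →ₗ[ℝ] F.Osc x →ₗ[ℝ] F.Osc x := LinearMap.mk₂ ℝ B
    (fun u u' w => by
      simp only [B, ← Finset.sum_add_distrib]
      refine Finset.sum_congr rfl fun i _ => Finset.sum_congr rfl fun j _ => ?_
      split_ifs with h
      · rw [← cls_add]; congr 1; ext1
        simp
      · rw [add_zero])
    (fun r u w => by
      simp only [B, Finset.smul_sum]
      refine Finset.sum_congr rfl fun i _ => Finset.sum_congr rfl fun j _ => ?_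
      split_ifs with h
      · rw [← cls_smul]; congr 1; ext1
        simp
      · rw [smul_zero])
    (fun u w w' => by
      simp only [B, ← Finset.sum_add_distrib]
      refine Finset.sum_congr rfl fun i _ => Finset.sum_congr rfl fun j _ => ?_
      split_ifs with h
      · rw [← cls_add]; congr 1; ext1
        simp
      · rw [add_zero])
    (fun r u w => by
      simp only [B, Finset.smul_sum]
      refine Finset.sum_congr rfl fun i _ => Finset.sum_congr rfl fun j _ => ?_
      split_ifs with h
      · rw [← cls_smul]; congr 1; ext1
        simp
      · rw [smul_zero])
  refine ⟨b, fun i j v w => ?_⟩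
  change B _ _ = _
  have h0 : ∀ (i : Fin F.s) (v : F.H (i + 1) x) (i' : Fin F.s), i' ≠ i →
      F.orthLift g x i' (F.cls x i v i') = 0 := fun i v i' hi => by
    rw [cls, Pi.single_eq_of_ne hi, map_zero]
  simp only [B]
  rw [Finset.sum_eq_single i, Finset.sum_eq_single j]
  · split_ifs with h
    · apply cls_eq_of_sub_mem
      have e1 : F.orthLift g x i (F.cls x i v i) - v ∈ F.H i x := by
        rw [cls, Pi.single_eq_same]; exact F.orthLift_mk_sub_mem g x i v
      have e2 : F.orthLift g x j (F.cls x j w j) - w ∈ F.H j x := by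
        rw [cls, Pi.single_eq_same]; exact F.orthLift_mk_sub_mem g x j w
      have h1 := hφ.tanBracket_mem e1 (F.orthLift_mem g x j (F.cls x j w j))
      have h2 := hφ.tanBracket_mem v.2 e2
      change tanBracket x φ _ _ - tanBracket x φ v w ∈ F.H ((i : ℕ) + j + 1) x
      rw [show (i : ℕ) + (j + 1) = i + j + 1 by ring] at h1
      rw [show (i : ℕ) + 1 + j = i + j + 1 by ring] at h2
      have h3 := Submodule.add_mem _ h1 h2
      rw [map_sub, map_sub, LinearMap.sub_apply] at h3
      convert h3 using 1
      abel
    · rfl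
  · intro j' _ hj'
    split_ifs with h
    · rw [show F.cls x ⟨i + j' + 1, h⟩ ⟨_, hmem i j' (F.cls x i v) (F.cls x j w)⟩ =
          F.cls x ⟨i + j' + 1, h⟩ 0 by
        congr 1; ext1
        change tanBracket x φ _ _ = 0
        rw [h0 j w j' hj', map_zero]]
      simp [cls]
    · rfl
  · simp
  · intro i' _ hi'
    refine Finset.sum_eq_zero fun j' _ => ?_
    split_ifs with h
    · rw [show F.cls x ⟨i' + j' + 1, h⟩ ⟨_, hmem i' j' (F.cls x i v) (F.cls x j w)⟩ =
          F.cls x ⟨i' + j' + 1, h⟩ 0 by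
        congr 1; ext1
        change tanBracket x φ _ _ = 0
        rw [h0 i v i' hi', map_zero, LinearMap.zero_apply]]
      simp [cls]
    · rfl
  · simp

/-- Exhibiting one bilinear map with the defining property makes the epsilon choice satisfy it.
Every pair of vectors extends to sections, so the property then gives the bracket on all classes;
the metric enters only through the lifts used for existence. -/
lemma IsTransport.oscBracket_cls [T2Space M]
    (g : Bundle.ContMDiffRiemannianMetric (𝓡 n) ∞ (EuclideanSpace ℝ (Fin n))
      (fun x : M => Tan n x)) (hφ : F.IsTransport x φ) (i j : Fin F.s) (v : F.H (i + 1) x)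
      (w : F.H (j + 1) x) : F.oscBracket x (F.cls x i v) (F.cls x j w) =
        if h : (i : ℕ) + j + 1 < F.s then
          F.cls x ⟨i + j + 1, h⟩ ⟨tanBracket x φ v w, by
            have := hφ.tanBracket_mem v.2 w.2
            rwa [show (i : ℕ) + 1 + (j + 1) = i + j + 1 + 1 by ring] at this⟩
        else 0 := by
  have key : ∀ (i j : Fin F.s) (V W : ∀ x : M, Tan n x) (hV : IsSmoothSection (F.H (i + 1)) V)
      (hW : IsSmoothSection (F.H (j + 1)) W) (h : (i : ℕ) + j + 1 < F.s),
      F.cls x ⟨i + j + 1, h⟩ ⟨VectorField.mlieBracket (𝓡 n) V W x, F.bracket_mem hV hW x⟩ =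
      F.cls x ⟨i + j + 1, h⟩ ⟨tanBracket x φ (V x) (W x), by
            have := hφ.tanBracket_mem (hV.2 x) (hW.2 x)
            rwa [show (i : ℕ) + 1 + (j + 1) = i + j + 1 + 1 by ring] at this⟩ := by
    intro i j V W hV hW h
    exact cls_eq_of_sub_mem (hφ.mlieBracket_sub_mem hV hW
      (show (i : ℕ) + 1 ≤ i + j + 1 by omega) (show (j : ℕ) + 1 ≤ i + j + 1 by omega))
  have hex : ∃ b, F.IsOscBracket x b := by
    obtain ⟨b, hb⟩ := hφ.exists_oscBracket g
    refine ⟨b, fun i j V W hV hW => ?_⟩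
    rw [hb]
    split_ifs with h
    · exact (key i j V W hV hW h).symm
    · rfl
  obtain ⟨V, hV, hVv, -⟩ := hφ.exists_section v.2
  obtain ⟨W, hW, hWw, -⟩ := hφ.exists_section w.2
  obtain ⟨v, hv⟩ := v
  obtain ⟨w, hw⟩ := w
  simp only at hVv hWw
  subst hVv hWw
  have h1 := Classical.epsilon_spec hex i j V W hV hW
  refine h1.trans ?_
  split_ifs with h
  · exact key i j V W hV hW h
  · rfl

lemma oscBracket_swap [T2Space M]
    (g : Bundle.ContMDiffRiemannianMetric (𝓡 n) ∞ (EuclideanSpace ℝ (Fin n))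
      (fun x : M => Tan n x)) (u w : F.Osc x) : F.oscBracket x u w = -F.oscBracket x w u := by
  obtain ⟨φ, hφ⟩ := F.exists_isTransport x
  have h : F.oscBracket x = (-1 : ℝ) • (F.oscBracket x).flip := by
    refine osc_hom_ext fun i v => osc_hom_ext fun j w => ?_
    change F.oscBracket x _ _ = (-1 : ℝ) • F.oscBracket x _ _
    rw [hφ.oscBracket_cls g, hφ.oscBracket_cls g]
    by_cases h : (i : ℕ) + j + 1 < F.s
    · have h' : (j : ℕ) + i + 1 < F.s := by omega
      rw [dif_pos h, dif_pos h', ← cls_smul]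
      have hij : (⟨i + j + 1, h⟩ : Fin F.s) = ⟨j + i + 1, h'⟩ := by
        ext; exact congrArg (· + 1) (add_comm _ _)
      -- The indices `i + j + 1` and `j + i + 1` are only propositionally equal, and the type of a
      -- representative depends on them.
      have gen : ∀ (a b : Fin F.s) (hab : a = b) (p q : Tan n x) (hp : p ∈ F.H (a + 1) x)
          (hq : q ∈ F.H (b + 1) x), p = q → F.cls x a ⟨p, hp⟩ = F.cls x b ⟨q, hq⟩ := by
        rintro a _ rfl p _ hp hq rfl; rfl
      refine gen _ _ hij _ _ _ (Submodule.smul_mem _ (-1 : ℝ) (by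
        have := hφ.tanBracket_mem w.2 v.2
        rwa [show (j : ℕ) + 1 + (i + 1) = j + i + 1 + 1 by ring] at this)) ?_
      rw [tanBracket_swap, neg_one_smul]
    · have h' : ¬ (j : ℕ) + i + 1 < F.s := by omega
      rw [dif_neg h, dif_neg h', smul_zero]
  exact (LinearMap.congr_fun₂ h u w).trans
    (neg_one_smul ℝ (F.oscBracket x w u) : (-1 : ℝ) • F.oscBracket x w u = _)

end TangentFiltration
end FilteredManifold

end

/-! ### The associated graded of the de Rham differential. -/

section
open scoped Manifold ContDiff Topology TensorProduct

namespace FilteredManifold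

lemma sum_removeNth {A : Type*} [AddCommMonoid A] {k : ℕ} (i : Fin (k + 1)) (f : Fin (k + 1) → A) :
    ∑ l, f l = f i + ∑ l, i.removeNth f l := Fin.sum_univ_succAbove f i

/-- Bookkeeping for the Chevalley-Eilenberg terms: replacing two arguments by their bracket
conserves the total weight. -/
lemma sum_vecCons_removeNth {A : Type*} [AddCommMonoid A] {k : ℕ} {i j : Fin (k + 1)} (hij : i ≤ j)
    (f : Fin (k + 2) → A) :
    ∑ l, (Matrix.vecCons (f i.castSucc + f j.succ)
      (j.removeNth (i.castSucc.removeNth f)) : Fin (k + 1) → A) l = ∑ l, f l := by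
  rw [sum_removeNth i.castSucc f, sum_removeNth j (i.castSucc.removeNth f), Fin.sum_univ_succ]
  have : i.castSucc.removeNth f j = f j.succ := by
    rw [Fin.removeNth_apply, Fin.succAbove_of_le_castSucc _ _ (by simpa using hij)]
  simp [this, add_assoc]

namespace TangentFiltration
variable {n : ℕ} {M : Type*} [TopologicalSpace M] [ChartedSpace (EuclideanSpace ℝ (Fin n)) M]
  [IsManifold (𝓡 n) ∞ M] {F : TangentFiltration n M} {x : M}
  {φ : EuclideanSpace ℝ (Fin n) → EuclideanSpace ℝ (Fin n) →L[ℝ] EuclideanSpace ℝ (Fin n)}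

/-- Forms of weight at least `w` vanish on vectors of lower weight which are transported by a
trivialization of the filtration. -/
lemma IsTransport.chartRep_apply_eventually_eq_zero (hφ : F.IsTransport x φ) {w : ℕ}
    {α : Forms n M} (hα : α ∈ F.formsGE w) {k : ℕ} {i : Fin k → ℕ} {v : Fin k → Tan n x}
    (hv : ∀ l, v l ∈ F.H (i l) x) (hw : ∑ l, i l < w) :
    ∀ᶠ y in 𝓝 (extChartAt (𝓡 n) x x),
      chartRep (fun p => α.val p k) x y (fun l => φ y (chartDInv x x (v l))) = 0 := by
  have hx := mem_extChartAt_source (I := 𝓡 n) x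
  filter_upwards [hφ.2, (isOpen_extChartAt_target (I := 𝓡 n) x).mem_nhds
    (mem_extChartAt_target x)] with y hy hyt
  have hp := (extChartAt (𝓡 n) x).map_target hyt
  have h1 := chartRep_apply_chart (fun p => α.val p k) hp (fun l => φ y (chartDInv x x (v l)))
  rw [(extChartAt (𝓡 n) x).right_inv hyt] at h1
  rw [h1]
  refine hα _ k i _ (fun l => ?_) hw
  rw [← F.mem_chartH_iff hp, (extChartAt (𝓡 n) x).right_inv hyt, hy.2.2,
    F.chartDInv_mem_chartH_iff hx]
  exact hv l

lemma deRham_apply_eq (α : Forms n M) (x : M) (k : ℕ) (v : Fin (k + 1) → Tan n x) :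
    (deRham α).val x (k + 1) v = extDeriv (chartRep (fun p => α.val p k) x)
      (extChartAt (𝓡 n) x x) (fun l => chartDInv x x (v l)) := rfl

/-- The invariant formula for the exterior derivative is applied to transported fields. In a
derivative term one argument, of weight at least `1`, is omitted, so the remaining total is below
`w` and the differentiated function vanishes near `x`. Only the bracket terms survive. -/
lemma IsTransport.deRham_apply (hφ : F.IsTransport x φ) {w : ℕ} {α : Forms n M}
    (hα : α ∈ F.formsGE w) {k : ℕ} {i : Fin (k + 2) → ℕ} {v : Fin (k + 2) → Tan n x}
    (hi : ∀ l, 1 ≤ i l) (hv : ∀ l, v l ∈ F.H (i l) x) (hw : ∑ l, i l ≤ w) :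
    (deRham α).val x (k + 2) v =
      ∑ i : Fin (k + 1), ∑ j ≥ i, (-1 : ℝ) ^ ((i : ℕ) + (j + 1)) *
        α.val x (k + 1) (Matrix.vecCons (tanBracket x φ (v i.castSucc) (v j.succ))
          (j.removeNth (i.castSucc.removeNth v))) := by
  have hx := mem_extChartAt_source (I := 𝓡 n) x
  have hd : ContDiffAt ℝ ∞ φ (extChartAt (𝓡 n) x x) := hφ.2.self_of_nhds.1
  have hα' : DifferentiableAt ℝ (chartRep (fun p => α.val p (k + 1)) x) (extChartAt (𝓡 n) x x) :=
    (IsSmoothForm.contDiffAt (α.2 (k + 1)) x hx).differentiableAt (by simp)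
  have h := extDeriv_apply_vectorField (V := fun l y => φ y (chartDInv x x (v l))) hα'
    (fun l => (hd.clm_apply contDiffAt_const).differentiableAt (by simp))
  have h1 : ∀ u : EuclideanSpace ℝ (Fin n), φ (extChartAt (𝓡 n) x x) u = u := fun u => by
    rw [hφ.1]; rfl
  rw [deRham_apply_eq]
  simp only [h1] at h
  rw [h]
  have h2 : ∀ l : Fin (k + 2), fderiv ℝ (fun y => chartRep (fun p => α.val p (k + 1)) x y
      (l.removeNth fun l => φ y (chartDInv x x (v l)))) (extChartAt (𝓡 n) x x) = 0 := by
    intro l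
    have hs : ∑ m, i m = i l + ∑ m, l.removeNth i m := Fin.sum_univ_succAbove i l
    have h3 := hφ.chartRep_apply_eventually_eq_zero hα (i := l.removeNth i) (v := l.removeNth v)
      (fun m => hv _) (by have := hi l; omega)
    exact (Filter.EventuallyEq.fderiv_eq h3).trans (fderiv_const_apply 0)
  simp only [h2, zero_apply, smul_zero, Finset.sum_const_zero, zero_sub,
    ← Finset.sum_neg_distrib]
  refine Finset.sum_congr rfl fun i _ => Finset.sum_congr rfl fun j _ => ?_
  rw [lieBracket_transport hφ.1 (hd.differentiableAt (by simp)), chartRep_apply_chart _ hx]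
  have h4 : (fun l => (chartDInv x x).inverse ((Matrix.vecCons
      (fderiv ℝ φ (extChartAt (𝓡 n) x x) (chartDInv x x (v i.castSucc)) (chartDInv x x (v j.succ)) -
        fderiv ℝ φ (extChartAt (𝓡 n) x x) (chartDInv x x (v j.succ)) (chartDInv x x (v i.castSucc)))
      (j.removeNth (i.castSucc.removeNth fun l => chartDInv x x (v l))) :
        Fin (k + 1) → EuclideanSpace ℝ (Fin n)) l)) =
      Matrix.vecCons (tanBracket x φ (v i.castSucc) (v j.succ))
          (j.removeNth (i.castSucc.removeNth v)) := by
    funext l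
    refine Fin.cases rfl (fun l => ?_) l
    exact inverse_chartDInv x hx _
  rw [h4, zsmul_eq_mul]
  push_cast
  ring

lemma IsClass.apply {w k : ℕ} {a : FormFiber n x} {β : F.OscForms x} (h : F.IsClass w x a β)
    (j : Fin k → Fin F.s) (v : Fin k → Tan n x) (hv : ∀ l, v l ∈ F.H (j l + 1) x)
    (u : Fin k → F.Osc x) (hu : ∀ l, u l = F.cls x (j l) ⟨v l, hv l⟩) :
    β k u = if ∑ l, ((j l : ℕ) + 1) = w then a k v else 0 := by
  rw [show u = _ from funext hu]
  exact h k j fun l => ⟨v l, hv l⟩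

lemma sum_bracket_weights {k : ℕ} {i j : Fin (k + 1)} (hij : i ≤ j) (f : Fin (k + 2) → ℕ) :
    f i.castSucc + 1 + (f j.succ + 1) + ∑ l, (j.removeNth (i.castSucc.removeNth f) l + 1) =
      ∑ l, (f l + 1) := by
  rw [← sum_vecCons_removeNth hij fun l => f l + 1, Fin.sum_univ_succ]
  rfl

lemma IsTransport.isClass_deRham [T2Space M]
    (g : Bundle.ContMDiffRiemannianMetric (𝓡 n) ∞ (EuclideanSpace ℝ (Fin n))
      (fun x : M => Tan n x)) (hφ : F.IsTransport x φ) {w : ℕ} {α : Forms n M}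
    (hα : α ∈ F.formsGE w) {β : F.OscForms x} (hβ : F.IsClass w x (α.val x) β) :
    F.IsClass w x ((deRham α).val x) (F.oscD x β) := by
  intro k J v
  match k with
  | 0 => exact (ite_self _).symm
  | 1 =>
    change (0 : ℝ) = _
    split_ifs with h
    -- A nonzero function has weight `0`, whereas here `w` is the weight of one vector and is at
    -- least `1`.
    · have h1 : (fun p => α.val p 0) = fun p => (0 : Cov n 0 p) := by
        funext p
        ext u
        exact hα p 0 (fun l => 0) u (fun l => l.elim0) (by
          rw [← h]; simp)
      have h2 : chartRep (fun p : M => (0 : Cov n 0 p)) x = fun _ => 0 := by ext y v; rfl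
      rw [deRham_apply_eq, h1, h2]
      simp [extDeriv, ContinuousAlternatingMap.alternatizeUncurryFin_apply]
    · rfl
  | k + 2 =>
    change chevalleyEilenberg (F.oscBracket x) k (β (k + 1)) _ = _
    rw [chevalleyEilenberg_apply (F.oscBracket_swap g)]
    have hterm : ∀ i j : Fin (k + 1), i ≤ j → β (k + 1) (Matrix.vecCons
        (F.oscBracket x (F.cls x (J i.castSucc) (v i.castSucc)) (F.cls x (J j.succ) (v j.succ)))
        (j.removeNth (i.castSucc.removeNth fun l => F.cls x (J l) (v l)))) =
        if ∑ l, ((J l : ℕ) + 1) = w then α.val x (k + 1) (Matrix.vecCons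
          (tanBracket x φ (v i.castSucc) (v j.succ))
          (j.removeNth (i.castSucc.removeNth fun l => (v l : Tan n x)))) else 0 := by
      intro i j hij
      have hsum := sum_bracket_weights hij fun l => (J l : ℕ)
      have hT := hφ.tanBracket_mem (v i.castSucc).2 (v j.succ).2
      rw [hφ.oscBracket_cls g]
      split_ifs with h h' h'
      · rw [hβ.apply (Fin.cons ⟨_, h⟩ (j.removeNth (i.castSucc.removeNth J)))
          (Matrix.vecCons (tanBracket x φ (v i.castSucc) (v j.succ))
            (j.removeNth (i.castSucc.removeNth fun l => (v l : Tan n x))))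
          (Fin.cases (by
            rwa [show ((J i.castSucc : ℕ) + 1 + (J j.succ + 1)) =
              J i.castSucc + J j.succ + 1 + 1 by ring] at hT) fun l => (v _).2) _
          (Fin.cases rfl fun l => rfl), if_pos]
        rw [Fin.sum_univ_succ, ← h', ← hsum]
        simp only [Fin.cons_zero, Fin.cons_succ, Fin.removeNth_apply]
        ring
      · rw [hβ.apply (Fin.cons ⟨_, h⟩ (j.removeNth (i.castSucc.removeNth J)))
          (Matrix.vecCons (tanBracket x φ (v i.castSucc) (v j.succ))
            (j.removeNth (i.castSucc.removeNth fun l => (v l : Tan n x))))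
          (Fin.cases (by
            rwa [show ((J i.castSucc : ℕ) + 1 + (J j.succ + 1)) =
              J i.castSucc + J j.succ + 1 + 1 by ring] at hT) fun l => (v _).2) _
          (Fin.cases rfl fun l => rfl), if_neg]
        intro h''
        apply h'
        rw [← h'', ← hsum, Fin.sum_univ_succ]
        simp only [Fin.cons_zero, Fin.cons_succ, Fin.removeNth_apply]
        ring
      -- The osculating bracket vanishes because its weight exceeds `s`. The form vanishes as well:
      -- the bracket vector lies in `H s = TM`, and counting it with weight `s` brings the total
      -- below `w`.
      · rw [(β (k + 1)).map_coord_zero (0 : Fin (k + 1)) rfl]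
        refine (hα x (k + 1) (Matrix.vecCons F.s
          (j.removeNth (i.castSucc.removeNth fun l => (J l : ℕ) + 1))) _
          (Fin.cases (by
            change _ ∈ F.H F.s x
            rw [F.top _ le_rfl]; trivial) fun l => (v _).2) ?_).symm
        rw [Fin.sum_univ_succ, ← h', ← hsum]
        simp only [Matrix.cons_val_zero, Matrix.cons_val_succ, Fin.removeNth_apply]
        omega
      · exact (β (k + 1)).map_coord_zero (0 : Fin (k + 1)) rfl
    split_ifs with h
    · rw [hφ.deRham_apply hα (i := fun l => J l + 1) (v := fun l => (v l : Tan n x))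
        (fun l => by omega) (fun l => (v l).2) h.le]
      refine Finset.sum_congr rfl fun i _ => Finset.sum_congr rfl fun j hj => ?_
      rw [hterm i j (by simpa using hj), if_pos h]
    · refine Finset.sum_eq_zero fun i _ => Finset.sum_eq_zero fun j hj => ?_
      rw [hterm i j (by simpa using hj), if_neg h, mul_zero]

lemma deRham_mem [T2Space M] {w : ℕ} {α : Forms n M} (hα : α ∈ F.formsGE w) :
    deRham α ∈ F.formsGE w := by
  intro x k i v hv hw
  obtain ⟨φ, hφ⟩ := F.exists_isTransport x
  match k with
  | 0 => rfl
  | 1 =>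
    have h1 : (fun p => α.val p 0) = fun p => (0 : Cov n 0 p) := by
      funext p
      ext u
      exact hα p 0 (fun l => 0) u (fun l => l.elim0) (by simp; omega)
    have h2 : chartRep (fun p : M => (0 : Cov n 0 p)) x = fun _ => 0 := by ext y v; rfl
    rw [deRham_apply_eq, h1, h2]
    simp [extDeriv, ContinuousAlternatingMap.alternatizeUncurryFin_apply]
  | k + 2 =>
    by_cases hi : ∀ l, 1 ≤ i l
    · rw [hφ.deRham_apply hα hi hv hw.le]
      refine Finset.sum_eq_zero fun l _ => Finset.sum_eq_zero fun m hm => ?_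
      rw [hα x (k + 1) (Matrix.vecCons (i l.castSucc + i m.succ)
        (m.removeNth (l.castSucc.removeNth i))) _
        (Fin.cases (hφ.tanBracket_mem (hv _) (hv _)) fun l => hv _)
        (by rwa [sum_vecCons_removeNth (by simpa using hm)]), mul_zero]
    · push Not at hi
      obtain ⟨l, hl⟩ := hi
      have h0 := hv l
      rw [show i l = 0 by omega, F.zero, Submodule.mem_bot] at h0
      exact ((deRham α).val x (k + 2)).map_coord_zero l h0

/-- The de Rham differential induces the fibrewise Chevalley-Eilenberg differential. -/
lemma hasGr_deRham [T2Space M]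
    (g : Bundle.ContMDiffRiemannianMetric (𝓡 n) ∞ (EuclideanSpace ℝ (Fin n))
      (fun x : M => Tan n x)) : F.HasGr deRham F.oscD := by
  refine fun w α hα => ⟨deRham_mem hα, fun x => ?_⟩
  obtain ⟨φ, hφ⟩ := F.exists_isTransport x
  exact ⟨_, F.isClass_weightPart_pullOsc g (hα x), hφ.isClass_deRham g hα
    (F.isClass_weightPart_pullOsc g (hα x))⟩

end TangentFiltration
end FilteredManifold

end

section
open scoped Manifold ContDiff Topology TensorProduct

namespace FilteredManifold

/-! ### Smoothness of the coefficients of characteristic polynomials. -/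

section PolynomialFamily
open Polynomial
variable {E : Type*} [NormedAddCommGroup E] [NormedSpace ℝ E] {y : E}

lemma contDiffAt_coeff_prod {ι : Type*} (s : Finset ι) {P : ι → E → ℝ[X]}
    (h : ∀ i ∈ s, ∀ j, ContDiffAt ℝ ∞ (fun z => (P i z).coeff j) y) (j : ℕ) :
    ContDiffAt ℝ ∞ (fun z => (∏ i ∈ s, P i z).coeff j) y := by
  classical
  induction s using Finset.induction_on generalizing j with
  | empty => simpa using contDiffAt_const
  | insert a s ha ih =>
    simp only [Finset.prod_insert ha, coeff_mul]
    refine ContDiffAt.sum fun p _ => ?_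
    exact (h a (by simp) _).mul (ih (fun i hi => h i (by simp [hi])) _)

/-- The coefficients of the characteristic polynomial depend smoothly on the matrix. -/
lemma contDiffAt_coeff_charpoly {ι : Type*} [Fintype ι] [DecidableEq ι] {A : E → Matrix ι ι ℝ}
    (h : ∀ i j, ContDiffAt ℝ ∞ (fun z => A z i j) y) (m : ℕ) :
    ContDiffAt ℝ ∞ (fun z => (A z).charpoly.coeff m) y := by
  simp only [Matrix.charpoly, Matrix.det_apply, finsetSum_coeff, coeff_smul]
  refine ContDiffAt.sum fun σ _ => ContDiffAt.const_smul _ (contDiffAt_coeff_prod _ ?_ m)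
  intro i _ k
  simp only [Matrix.charmatrix_apply, coeff_sub, coeff_C]
  refine contDiffAt_const.sub ?_
  split_ifs
  · exact h _ _
  · exact contDiffAt_const

end PolynomialFamily

variable {n : ℕ} {M : Type*} [TopologicalSpace M] [ChartedSpace (EuclideanSpace ℝ (Fin n)) M]
  [IsManifold (𝓡 n) ∞ M]

variable (n) in
/-- The model of the fibres of the bundle of forms. -/
abbrev ModelFiber : Type := ∀ k : ℕ, (EuclideanSpace ℝ (Fin n)) [⋀^Fin k]→L[ℝ] ℝ

instance finiteDimensional_modelFiber : FiniteDimensional ℝ (ModelFiber n) :=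
  finiteDimensional_formFiber (n := n) (M := EuclideanSpace ℝ (Fin n)) 0

/-- The trivialization of the bundle of forms given by a chart. -/
def fiberChart (c : M) {y : EuclideanSpace ℝ (Fin n)} (hy : y ∈ (extChartAt (𝓡 n) c).target) :
    FormFiber n ((extChartAt (𝓡 n) c).symm y) ≃ₗ[ℝ] ModelFiber n where
  toFun a k := (a k).compContinuousLinearMap (chartD c y)
  invFun a k := (a k).compContinuousLinearMap (chartDInv c _)
  map_add' _ _ := rfl
  map_smul' _ _ := rfl
  left_inv a := by
    funext k
    ext v
    change a k (fun i => chartD c y (chartDInv c _ (v i))) = a k v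
    simp only [chartD_chartDInv c hy]
  right_inv a := by
    funext k
    ext v
    change a k (fun i => chartDInv c _ (chartD c y (v i))) = a k v
    simp only [chartDInv_chartD c hy]

/-- `ModelFiber` is a product over all degrees, used here without a norm, so smoothness is tested
degree by degree; a functional involves only degrees up to `n`, since the others are trivial. -/
lemma contDiffAt_functional (l : ModelFiber n →ₗ[ℝ] ℝ) {E : Type*} [NormedAddCommGroup E]
    [NormedSpace ℝ E] {f : E → ModelFiber n} {y : E}
    (h : ∀ k, ContDiffAt ℝ ∞ (fun z => f z k) y) : ContDiffAt ℝ ∞ (fun z => l (f z)) y := by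
  have h1 : ∀ a : ModelFiber n, l a =
      ∑ k ∈ Finset.range (n + 1), (l ∘ₗ LinearMap.single ℝ _ k) (a k) := by
    intro a
    have h2 : a = ∑ k ∈ Finset.range (n + 1), Pi.single k (a k) := by
      funext k
      rw [Finset.sum_apply]
      by_cases hk : k < n + 1
      · rw [Finset.sum_eq_single k, Pi.single_eq_same]
        · intro j _ hj
          exact Pi.single_eq_of_ne hj.symm _
        · simp [hk]
      · have h0 : a k = 0 :=
          cov_eq_zero (M := EuclideanSpace ℝ (Fin n)) (x := 0) (by omega) (a k)
        rw [h0, Finset.sum_eq_zero]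
        intro j hj
        refine Pi.single_eq_of_ne ?_ _
        rintro rfl
        simp at hj; omega
    conv_lhs => rw [h2, map_sum]
    rfl
  simp only [h1]
  refine ContDiffAt.sum fun k _ => ?_
  have : FiniteDimensional ℝ ((EuclideanSpace ℝ (Fin n)) [⋀^Fin k]→L[ℝ] ℝ) :=
    finiteDimensional_cov (n := n) (M := EuclideanSpace ℝ (Fin n)) k 0
  exact (LinearMap.toContinuousLinearMap (l ∘ₗ LinearMap.single ℝ
    (fun k : ℕ => (EuclideanSpace ℝ (Fin n)) [⋀^Fin k]→L[ℝ] ℝ) k)).contDiff.contDiffAt.comp y (h k)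

/-- The coefficients of the characteristic polynomials of an algebraic map are smooth. -/
lemma AlgebraicMap.contMDiff_charpoly_coeff [T2Space M] (A : AlgebraicMap n M) (m : ℕ) :
    ContMDiff (𝓡 n) 𝓘(ℝ, ℝ) ∞ fun x => (A.fib x).charpoly.coeff m := by
  intro c
  have hc := mem_extChartAt_source (I := 𝓡 n) c
  let b := Module.finBasis ℝ (ModelFiber n)
  obtain ⟨χ, hχ1, hχ⟩ := exists_cutoff (n := n) c ((isOpen_extChartAt_source (I := 𝓡 n) c).mem_nhds hc)
  -- Constant forms in the chart, cut off, are global smooth forms that make up a frame near `c`.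
  -- Smoothness of their images under `A` yields smooth matrix entries.
  let σ : Fin (Module.finrank ℝ (ModelFiber n)) → Forms n M := fun j =>
    ⟨fun p k => χ p • localForm c (fun _ => b j k) p, fun k =>
      isSmoothForm_cutoff fun p hp => ⟨hχ hp, contDiffAt_const⟩⟩
  let Mat : EuclideanSpace ℝ (Fin n) → Matrix (Fin (Module.finrank ℝ (ModelFiber n)))
      (Fin (Module.finrank ℝ (ModelFiber n))) ℝ := fun y i j =>
    b.coord i (fun k => chartRep (fun p => (A.op (σ j)).val p k) c y)
  have hMat : ContDiffAt ℝ ∞ (fun y => (Mat y).charpoly.coeff m) (extChartAt (𝓡 n) c c) :=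
    contDiffAt_coeff_charpoly (fun i j => contDiffAt_functional (b.coord i) fun k =>
      IsSmoothForm.contDiffAt ((A.op (σ j)).2 k) c hc) m
  have h2 : ContinuousAt (extChartAt (𝓡 n) c).symm (extChartAt (𝓡 n) c c) :=
    continuousAt_extChartAt_symm c
  rw [ContinuousAt, extChartAt_to_inv] at h2
  have heq : ∀ᶠ y in 𝓝 (extChartAt (𝓡 n) c c),
      (A.fib ((extChartAt (𝓡 n) c).symm y)).charpoly.coeff m = (Mat y).charpoly.coeff m := by
    filter_upwards [h2.eventually hχ1, (isOpen_extChartAt_target (I := 𝓡 n) c).mem_nhds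
      (mem_extChartAt_target c)] with y h1 hy
    rw [← LinearEquiv.charpoly_conj (fiberChart c hy), ← LinearMap.charpoly_toMatrix _ b]
    congr 2
    ext i j
    rw [LinearMap.toMatrix_apply]
    change b.coord i _ = b.coord i _
    congr 1
    have h3 : (σ j).val ((extChartAt (𝓡 n) c).symm y) = (fiberChart c hy).symm (b j) := by
      funext k
      change χ _ • localForm c (fun _ => b j k) _ = _
      rw [h1, one_smul]
      rfl
    rw [LinearEquiv.conj_apply_apply, ← h3]
    rfl
  have h5 : ContMDiffAt (𝓡 n) (𝓡 n) ∞ (extChartAt (𝓡 n) c) c := contMDiffAt_extChartAt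
  refine (ContMDiffAt.comp c (hMat.contMDiffAt) h5).congr_of_eventuallyEq ?_
  filter_upwards [(isOpen_extChartAt_source (I := 𝓡 n) c).mem_nhds hc,
    (continuousAt_extChartAt (I := 𝓡 n) c).eventually heq] with p hp h
  rw [(extChartAt (𝓡 n) c).left_inv hp] at h
  exact h

end FilteredManifold

end

section
open scoped Manifold ContDiff Topology TensorProduct

namespace FilteredManifold
open Polynomial

variable {n : ℕ} {M : Type*} [TopologicalSpace M] [ChartedSpace (EuclideanSpace ℝ (Fin n)) M]
  [IsManifold (𝓡 n) ∞ M]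

/-! ### Algebraic maps and the de Rham differential as operators on forms. -/

section Operators

@[simp] lemma mulFun_val (f : C^∞⟮𝓡 n, M; ℝ⟯) (α : Forms n M) (x : M) :
    (mulFun f α).val x = f x • α.val x := rfl

@[simp] lemma Forms.add_val (α β : Forms n M) (x : M) : (α + β).val x = α.val x + β.val x := rfl

@[simp] lemma Forms.smul_val (r : ℝ) (α : Forms n M) (x : M) : (r • α).val x = r • α.val x := rfl

@[simp] lemma Forms.sub_val (α β : Forms n M) (x : M) : (α - β).val x = α.val x - β.val x := rfl

@[simp] lemma AlgebraicMap.op_val (A : AlgebraicMap n M) (α : Forms n M) (x : M) :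
    (A.op α).val x = A.fib x (α.val x) := rfl

@[simp] lemma Forms.sum_val {ι : Type*} (s : Finset ι) (α : ι → Forms n M) (x : M) :
    (∑ i ∈ s, α i).val x = ∑ i ∈ s, (α i).val x := map_sum (evalAt n x) α s

lemma AlgebraicMap.op_mul_mulFun (A : AlgebraicMap n M) (f : C^∞⟮𝓡 n, M; ℝ⟯) :
    A.op * mulFun f = mulFun f * A.op := by
  ext α x : 2
  exact map_smul (A.fib x) (f x) (α.val x)

lemma AlgebraicMap.aeval_op_val (A : AlgebraicMap n M) (p : ℝ[X]) (α : Forms n M) (x : M) :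
    (aeval A.op p α).val x = aeval (A.fib x) p (α.val x) := by
  have hpow : ∀ j, ((A.op ^ j) α).val x = (A.fib x ^ j) (α.val x) := by
    intro j
    induction j with
    | zero => rfl
    | succ j ih => rw [pow_succ', pow_succ', Module.End.mul_apply, op_val, ih]; rfl
  rw [aeval_eq_sum_range, aeval_eq_sum_range, LinearMap.sum_apply, LinearMap.sum_apply,
    Forms.sum_val]
  refine Finset.sum_congr rfl fun j _ => ?_
  rw [LinearMap.smul_apply, LinearMap.smul_apply, Forms.smul_val, hpow]

lemma deRham_mul_deRham : (deRham : Module.End ℝ (Forms n M)) * deRham = 0 := by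
  ext α x k : 3
  match k with
  | 0 => rfl
  | 1 =>
    change extDer (fun y => (0 : Cov n 0 y)) x = 0
    have := extDer_smul (n := n) (M := M) (k := 0) (0 : ℝ) (fun y => (0 : Cov n 0 y))
    simp only [zero_smul] at this
    exact congrFun this x
  | k + 2 =>
    change extDer (extDer fun y => α.val y k) x = 0
    have hs : IsSmoothForm fun y => α.val y k := α.2 k
    have hx := (isOpen_extChartAt_target (I := 𝓡 n) x).mem_nhds (mem_extChartAt_target x)
    have h1 : chartRep (extDer fun y => α.val y k) x =ᶠ[𝓝 (extChartAt (𝓡 n) x x)]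
        extDeriv (chartRep (fun y => α.val y k) x) := by
      filter_upwards [hx] with y hy using chartRep_extDer hs x hy
    rw [FilteredManifold.extDer, h1.extDeriv_eq,
      extDeriv_extDeriv_apply ((hs x).contDiffAt hx)
        (by simpa using! (WithTop.coe_le_coe.2 (le_top : (2 : ℕ∞) ≤ ⊤)))]
    rfl

end Operators

/-! ### Orders of differential operators. -/

section Order

lemma HasOrderLE.add {r : ℕ} {D D' : Module.End ℝ (Forms n M)} (h : HasOrderLE r D)
    (h' : HasOrderLE r D') : HasOrderLE r (D + D') := by
  induction r generalizing D D' with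
  | zero => intro f; rw [add_mul, mul_add, h f, h' f]
  | succ r ih =>
    intro f
    have := ih (h f) (h' f)
    rwa [show D * mulFun f - mulFun f * D + (D' * mulFun f - mulFun f * D') =
      (D + D') * mulFun f - mulFun f * (D + D') by noncomm_ring] at this

lemma HasOrderLE.smul {r : ℕ} {D : Module.End ℝ (Forms n M)} (h : HasOrderLE r D) (c : ℝ) :
    HasOrderLE r (c • D) := by
  induction r generalizing D with
  | zero => intro f; rw [smul_mul_assoc, mul_smul_comm, h f]
  | succ r ih =>
    intro f
    have := ih (h f)
    rwa [smul_sub, ← smul_mul_assoc, ← mul_smul_comm] at this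

lemma HasOrderLE.zero (r : ℕ) : HasOrderLE r (0 : Module.End ℝ (Forms n M)) := by
  induction r with
  | zero => intro f; rw [zero_mul, mul_zero]
  | succ r ih => intro f; rw [zero_mul, mul_zero, sub_zero]; exact ih

lemma HasOrderLE.succ {r : ℕ} {D : Module.End ℝ (Forms n M)} (h : HasOrderLE r D) :
    HasOrderLE (r + 1) D := by
  induction r generalizing D with
  | zero => intro f; rw [h f, sub_self]; exact HasOrderLE.zero 0
  | succ r ih => intro f; exact ih (h f)

lemma HasOrderLE.mono {r s : ℕ} (hrs : r ≤ s) {D : Module.End ℝ (Forms n M)}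
    (h : HasOrderLE r D) : HasOrderLE s D := by
  induction hrs with
  | refl => exact h
  | step _ ih => exact ih.succ

lemma HasOrderLE.one : HasOrderLE 0 (1 : Module.End ℝ (Forms n M)) := fun f => by
  rw [one_mul, mul_one]

/-- Commutation with a function is a derivation of the algebra of operators; induction is on the
total order. -/
lemma HasOrderLE.mul {r s : ℕ} {D D' : Module.End ℝ (Forms n M)} (h : HasOrderLE r D)
    (h' : HasOrderLE s D') : HasOrderLE (r + s) (D * D') := by
  induction hm : r + s generalizing r s D D' with
  | zero =>
    obtain ⟨rfl, rfl⟩ : r = 0 ∧ s = 0 := by omega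
    intro f
    rw [mul_assoc, h' f, ← mul_assoc, h f, mul_assoc]
  | succ m ih =>
    intro f
    have e : D * D' * mulFun f - mulFun f * (D * D') =
        D * (D' * mulFun f - mulFun f * D') + (D * mulFun f - mulFun f * D) * D' := by
      noncomm_ring
    rw [e]
    refine HasOrderLE.add ?_ ?_
    · cases s with
      | zero => rw [h' f, sub_self, mul_zero]; exact HasOrderLE.zero _
      | succ s => exact ih h (h' f) (by omega)
    · cases r with
      | zero => rw [h f, sub_self, zero_mul]; exact HasOrderLE.zero _
      | succ r => exact ih (h f) h' (by omega)

lemma HasOrderLE.pow {D : Module.End ℝ (Forms n M)} (h : HasOrderLE 1 D) (j : ℕ) :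
    HasOrderLE j (D ^ j) := by
  induction j with
  | zero => exact HasOrderLE.one
  | succ j ih => rw [pow_succ]; exact ih.mul h

lemma HasOrderLE.sum {ι : Type*} {s : Finset ι} {r : ℕ} {D : ι → Module.End ℝ (Forms n M)}
    (h : ∀ i ∈ s, HasOrderLE r (D i)) : HasOrderLE r (∑ i ∈ s, D i) := by
  classical
  induction s using Finset.induction_on with
  | empty => exact HasOrderLE.zero r
  | insert a s ha ih =>
    rw [Finset.sum_insert ha]
    exact (h a (by simp)).add (ih fun i hi => h i (by simp [hi]))

lemma HasOrderLE.aeval {D : Module.End ℝ (Forms n M)} (h : HasOrderLE 1 D) {p : ℝ[X]} {r : ℕ}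
    (hp : p.natDegree ≤ r) : HasOrderLE r (aeval D p) := by
  rw [aeval_eq_sum_range]
  exact HasOrderLE.sum fun j hj => ((h.pow j).smul _).mono
    ((Nat.lt_succ_iff.1 (Finset.mem_range.1 hj)).trans hp)

/-- The value at `x` of a commutator with a function involves `D` only through values at `x`, so the
comparison operator may vary with `x` without any regularity. This is what allows `P` to be compared
with a different polynomial in `□` at each point. -/
lemma HasOrderLE.of_pointwise {r : ℕ} {D : Module.End ℝ (Forms n M)}
    (h : ∀ x, ∃ D', HasOrderLE r D' ∧ ∀ α, (D α).val x = (D' α).val x) : HasOrderLE r D := by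
  induction r generalizing D with
  | zero =>
    intro f
    ext α x : 2
    obtain ⟨D', hD', hx⟩ := h x
    change (D (mulFun f α)).val x = f x • (D α).val x
    rw [hx, hx]
    exact congrArg (fun β => Forms.val β x) (LinearMap.congr_fun (hD' f) α)
  | succ r ih =>
    intro f
    refine ih fun x => ?_
    obtain ⟨D', hD', hx⟩ := h x
    refine ⟨_, hD' f, fun α => ?_⟩
    change (D (mulFun f α)).val x - f x • (D α).val x =
      (D' (mulFun f α)).val x - f x • (D' α).val x
    rw [hx, hx]

lemma AlgebraicMap.hasOrderLE (A : AlgebraicMap n M) : HasOrderLE 0 A.op := A.op_mul_mulFun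

lemma extDer_smul_fun {k : ℕ} {α : ∀ x : M, Cov n k x} (hα : IsSmoothForm α)
    (f : C^∞⟮𝓡 n, M; ℝ⟯) (x : M) :
    extDeriv (chartRep (fun p => f p • α p) x) (extChartAt (𝓡 n) x x) =
      f x • extDeriv (chartRep α x) (extChartAt (𝓡 n) x x) +
      ContinuousAlternatingMap.alternatizeUncurryFin
        ((fderiv ℝ (fun y => f ((extChartAt (𝓡 n) x).symm y)) (extChartAt (𝓡 n) x x)).smulRight
          (chartRep α x (extChartAt (𝓡 n) x x))) := by
  have hx := mem_extChartAt_source (I := 𝓡 n) x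
  have h1 := (contDiffAt_comp_chart_symm x hx f).differentiableAt (by simp)
  have h2 := (hα.contDiffAt x hx).differentiableAt (by simp)
  rw [chartRep_smul, extDeriv, fderiv_fun_smul h1 h2, extDeriv, (extChartAt (𝓡 n) x).left_inv hx]
  exact (ContinuousAlternatingMap.alternatizeUncurryFinCLM ℝ _ ℝ).map_add _ _ |>.trans
    (congrArg (· + _) ((ContinuousAlternatingMap.alternatizeUncurryFinCLM ℝ _ ℝ).map_smul _ _))

/-- By the product rule the commutator with `f` is exterior multiplication by `df`, which is
algebraic. -/
lemma hasOrderLE_deRham : HasOrderLE 1 (deRham : Module.End ℝ (Forms n M)) := by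
  intro f h
  ext α x k : 3
  match k with
  | 0 =>
    change (0 : Cov n 0 x) - f x • (0 : Cov n 0 x) = h x • ((0 : Cov n 0 x) - f x • (0 : Cov n 0 x))
    simp
  | k + 1 =>
    have hs : IsSmoothForm fun y => α.val y k := α.2 k
    have hsh : IsSmoothForm fun y => h y • α.val y k := (mulFun h α).2 k
    change extDer (fun p => f p • h p • α.val p k) x - f x • extDer (fun p => h p • α.val p k) x =
      h x • (extDer (fun p => f p • α.val p k) x - f x • extDer (fun p => α.val p k) x)
    have e1 : ∀ p, f p • h p • α.val p k = h p • f p • α.val p k := fun p => smul_comm _ _ _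
    have hx := mem_extChartAt_source (I := 𝓡 n) x
    have h3 : chartRep (fun p => h p • α.val p k) x (extChartAt (𝓡 n) x x) =
        h x • chartRep (fun p => α.val p k) x (extChartAt (𝓡 n) x x) := by
      rw [chartRep_smul]
      simp only [(extChartAt (𝓡 n) x).left_inv hx]
    simp only [FilteredManifold.extDer]
    rw [extDer_smul_fun hsh f, extDer_smul_fun hs f, h3]
    have h4 : ∀ (l : EuclideanSpace ℝ (Fin n) →L[ℝ] ℝ)
        (a : EuclideanSpace ℝ (Fin n) [⋀^Fin k]→L[ℝ] ℝ) (c : ℝ),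
        ContinuousAlternatingMap.alternatizeUncurryFin (l.smulRight (c • a)) =
          c • ContinuousAlternatingMap.alternatizeUncurryFin (l.smulRight a) := by
      intro l a c
      have : l.smulRight (c • a) = c • l.smulRight a := by
        ext; simp [mul_left_comm]
      rw [this]
      exact (ContinuousAlternatingMap.alternatizeUncurryFinCLM ℝ _ ℝ).map_smul _ _
    rw [h4]
    have h5 : ∀ (a₁ a₂ b : EuclideanSpace ℝ (Fin n) [⋀^Fin (k + 1)]→L[ℝ] ℝ) (r t : ℝ)
        (T : Tan n x →L[ℝ] EuclideanSpace ℝ (Fin n)),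
        (r • a₁ + t • b).compContinuousLinearMap T - r • a₁.compContinuousLinearMap T =
          t • ((r • a₂ + b).compContinuousLinearMap T - r • a₂.compContinuousLinearMap T) := by
      intro a₁ a₂ b r t T
      ext v
      change (r * a₁ (fun i => T (v i)) + t * b fun i => T (v i)) - r * a₁ (fun i => T (v i)) =
        t * ((r * a₂ (fun i => T (v i)) + b fun i => T (v i)) - r * a₂ fun i => T (v i))
      ring
    exact h5 _ _ _ _ _ _

lemma hasOrderLE_box (δ : AlgebraicMap n M) : HasOrderLE 1 (box δ) :=
  (hasOrderLE_deRham.mul δ.hasOrderLE).add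
    ((δ.hasOrderLE.mul hasOrderLE_deRham).mono (by simp))

end Order

end FilteredManifold

end

/-! ### Calculus of associated gradeds; stabilization of kernels and images. -/

section
open scoped Manifold ContDiff Topology TensorProduct

namespace FilteredManifold
open Polynomial

variable {n : ℕ} {M : Type*} [TopologicalSpace M] [ChartedSpace (EuclideanSpace ℝ (Fin n)) M]
  [IsManifold (𝓡 n) ∞ M]

namespace TangentFiltration
variable {F : TangentFiltration n M} {D D' : Module.End ℝ (Forms n M)}
  {T T' : ∀ x : M, Module.End ℝ (F.OscForms x)}

lemma formsGE_anti {w w' : ℕ} (h : w ≤ w') : F.formsGE w' ≤ F.formsGE w :=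
  fun _ hα x => F.fiberGE_anti h x (hα x)

lemma mem_formsGE_zero (α : Forms n M) : α ∈ F.formsGE 0 := fun x => by
  rw [F.fiberGE_zero]; trivial

lemma eq_zero_of_mem_formsGE {w : ℕ} (hw : n * F.s + 1 ≤ w) {α : Forms n M}
    (hα : α ∈ F.formsGE w) : α = 0 := by
  ext1 x
  have := F.fiberGE_anti hw x (hα x)
  rwa [F.fiberGE_top, Submodule.mem_bot] at this

lemma mulFun_mem (f : C^∞⟮𝓡 n, M; ℝ⟯) {w : ℕ} {α : Forms n M} (hα : α ∈ F.formsGE w) :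
    mulFun f α ∈ F.formsGE w := fun x => Submodule.smul_mem _ _ (hα x)

lemma HasGr.mem (h : F.HasGr D T) {w : ℕ} {α : Forms n M} (hα : α ∈ F.formsGE w) :
    D α ∈ F.formsGE w := (h w α hα).1

lemma HasGr.isClass (h : F.HasGr D T) {w : ℕ} {α : Forms n M} (hα : α ∈ F.formsGE w) {x : M}
    {β : F.OscForms x} (hβ : F.IsClass w x (α.val x) β) :
    F.IsClass w x ((D α).val x) (T x β) := by
  obtain ⟨β', h1, h2⟩ := (h w α hα).2 x
  rwa [hβ.unique h1]

lemma mem_formsGE_succ {w : ℕ} {α : Forms n M} (hα : α ∈ F.formsGE w)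
    (h : ∀ x, F.IsClass w x (α.val x) 0) : α ∈ F.formsGE (w + 1) :=
  fun x => F.mem_fiberGE_succ (hα x) (h x)

lemma HasGr.congr (h : F.HasGr D T) (hT : ∀ x, T x = T' x) : F.HasGr D T' := by
  rwa [show T' = T from funext fun x => (hT x).symm]

lemma HasGr.mul (h : F.HasGr D T) (h' : F.HasGr D' T') :
    F.HasGr (D * D') fun x => T x * T' x := by
  refine fun w α hα => ⟨h.mem (h'.mem hα), fun x => ?_⟩
  obtain ⟨β, h1, h2⟩ := (h' w α hα).2 x
  exact ⟨β, h1, h.isClass (h'.mem hα) h2⟩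

lemma HasGr.add (h : F.HasGr D T) (h' : F.HasGr D' T') :
    F.HasGr (D + D') fun x => T x + T' x := by
  refine fun w α hα => ⟨Submodule.add_mem _ (h.mem hα) (h'.mem hα), fun x => ?_⟩
  obtain ⟨β, h1, h2⟩ := (h w α hα).2 x
  exact ⟨β, h1, h2.add (h'.isClass hα h1)⟩

lemma HasGr.smul (h : F.HasGr D T) (r : ℝ) : F.HasGr (r • D) fun x => r • T x := by
  refine fun w α hα => ⟨Submodule.smul_mem _ _ (h.mem hα), fun x => ?_⟩
  obtain ⟨β, h1, h2⟩ := (h w α hα).2 x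
  exact ⟨β, h1, h2.smul r⟩

lemma IsClass.sub {w : ℕ} {x : M} {a b : FormFiber n x} {β : F.OscForms x}
    (h : F.IsClass w x a β) (h' : F.IsClass w x b β) : F.IsClass w x (a - b) 0 := by
  intro k j v
  have h1 := h k j v
  have h2 := h' k j v
  change (0 : ℝ) = if _ then a k _ - b k _ else 0
  split_ifs at h1 h2 ⊢ with hw
  · rw [← h1, ← h2, sub_self]
  · rfl

/-- The difference of two operators with the same associated graded increases the weights of
forms. -/
lemma HasGr.sub_raises (h : F.HasGr D T) (h' : F.HasGr D' T) {w : ℕ} {α : Forms n M}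
    (hα : α ∈ F.formsGE w) : (D - D') α ∈ F.formsGE (w + 1) := by
  refine mem_formsGE_succ (Submodule.sub_mem _ (h.mem hα) (h'.mem hα)) fun x => ?_
  obtain ⟨β, h1, h2⟩ := (h w α hα).2 x
  exact h2.sub (h'.isClass hα h1)

lemma pow_mem_of_raises (h : ∀ w, ∀ α ∈ F.formsGE w, D α ∈ F.formsGE (w + 1)) {w : ℕ}
    {α : Forms n M} (hα : α ∈ F.formsGE w) (j : ℕ) : (D ^ j) α ∈ F.formsGE (w + j) := by
  induction j with
  | zero => exact hα
  | succ j ih => rw [pow_succ']; exact h _ _ ih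

lemma pow_eq_zero_of_raises (h : ∀ w, ∀ α ∈ F.formsGE w, D α ∈ F.formsGE (w + 1)) {j : ℕ}
    (hj : n * F.s + 1 ≤ j) : D ^ j = 0 := by
  ext1 α
  exact eq_zero_of_mem_formsGE (by omega) (pow_mem_of_raises h (mem_formsGE_zero α) j)

lemma isNilpotencyBound : F.IsNilpotencyBound (n * F.s + 1) :=
  fun _ h => pow_eq_zero_of_raises h le_rfl

section Metric
variable (g : Bundle.ContMDiffRiemannianMetric (𝓡 n) ∞ (EuclideanSpace ℝ (Fin n))
  (fun x : M => Tan n x))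
include g

lemma exists_isClass {w : ℕ} {x : M} {a : FormFiber n x} (ha : a ∈ F.fiberGE w x) :
    ∃ β, F.IsClass w x a β := ⟨_, F.isClass_weightPart_pullOsc g ha⟩

lemma hasGr_one : F.HasGr (1 : Module.End ℝ (Forms n M)) fun _ => 1 := fun _ _ hα =>
  ⟨hα, fun x => by
    obtain ⟨β, hβ⟩ := exists_isClass g (hα x)
    exact ⟨β, hβ, hβ⟩⟩

lemma hasGr_mulFun (f : C^∞⟮𝓡 n, M; ℝ⟯) : F.HasGr (mulFun f) fun x => f x • 1 := fun _ _ hα =>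
  ⟨mulFun_mem f hα, fun x => by
    obtain ⟨β, hβ⟩ := exists_isClass g (hα x)
    exact ⟨β, hβ, hβ.smul (f x)⟩⟩

lemma hasGr_zero : F.HasGr (0 : Module.End ℝ (Forms n M)) fun _ => 0 := fun w _ hα =>
  ⟨Submodule.zero_mem _, fun x => by
    obtain ⟨β, hβ⟩ := exists_isClass g (hα x)
    exact ⟨β, hβ, F.isClass_zero_of_mem (Submodule.zero_mem _)⟩⟩

lemma HasGr.pow (h : F.HasGr D T) (j : ℕ) : F.HasGr (D ^ j) fun x => T x ^ j := by
  induction j with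
  | zero => exact hasGr_one g
  | succ j ih => exact (ih.mul h).congr fun x => (pow_succ (T x) j).symm

lemma hasGr_sum {ι : Type*} (s : Finset ι) {D : ι → Module.End ℝ (Forms n M)}
    {T : ι → ∀ x : M, Module.End ℝ (F.OscForms x)} (h : ∀ i ∈ s, F.HasGr (D i) (T i)) :
    F.HasGr (∑ i ∈ s, D i) fun x => ∑ i ∈ s, T i x := by
  classical
  induction s using Finset.induction_on with
  | empty => exact hasGr_zero g
  | insert a s ha ih =>
    rw [Finset.sum_insert ha]
    exact ((h a (by simp)).add (ih fun i hi => h i (by simp [hi]))).congr fun x =>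
      (Finset.sum_insert (f := fun i => T i x) ha).symm

lemma HasGr.aeval (h : F.HasGr D T) (p : ℝ[X]) :
    F.HasGr (aeval D p) fun x => aeval (T x) p := by
  rw [aeval_eq_sum_range]
  exact (hasGr_sum g _ fun j _ => (h.pow g j).smul (p.coeff j)).congr fun x =>
    (aeval_eq_sum_range (T x)).symm

omit g in
lemma HasGr.isFiberGr [T2Space M] {A : AlgebraicMap n M} (h : F.HasGr A.op T) (x : M) :
    F.IsFiberGr (A.fib x) (T x) := by
  intro w a ha
  obtain ⟨α, hα, rfl⟩ := F.exists_form ha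
  exact ⟨h.mem hα x, fun β hβ => h.isClass hα hβ⟩

lemma HasGr.charpoly_eq [T2Space M] {A : AlgebraicMap n M} (h : F.HasGr A.op T) (x : M) :
    (A.fib x).charpoly = (T x).charpoly := (h.isFiberGr x).charpoly_eq g

/-- If `T` and `τ` commute and `T ^ d = T ^ (d + 1) τ`, where `T` and `τ` are the associated graded
of `D` and `t`, then the kernels and the ranges of the powers of `D` stabilize. -/
lemma HasGr.stabilize {t : Module.End ℝ (Forms n M)} {τ : ∀ x : M, Module.End ℝ (F.OscForms x)}
    (h : F.HasGr D T) (ht : F.HasGr t τ) {d : ℕ} (hTτ : ∀ x, Commute (T x) (τ x))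
    (hd : ∀ x, T x ^ d = T x ^ (d + 1) * τ x) {a : ℕ} (ha : d * (n * F.s + 1) ≤ a) :
    (∀ (b : ℕ) (v : Forms n M), (D ^ b) v = 0 → (D ^ a) v = 0) ∧
    ∀ (b : ℕ) (v : Forms n M), ∃ u, (D ^ a) v = (D ^ b) u := by
  have hd' : ∀ (b : ℕ) x, T x ^ d = T x ^ (d + b) * τ x ^ b := by
    intro b x
    induction b with
    | zero => simp
    | succ b ih =>
      rw [pow_succ' (τ x), ← add_assoc, pow_succ' (T x), mul_assoc, ← mul_assoc (T x ^ (d + b)),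
        ((hTτ x).pow_left (d + b)).eq, mul_assoc (τ x), ← ih, ((hTτ x).symm.pow_right d).eq,
        ← mul_assoc, ← pow_succ', ← hd]
  constructor
  · intro b v hv
    -- `D ^ d` and `t ^ b D ^ (d + b)` have the same associated graded, and the second kills the
    -- vectors killed by `D ^ b`. So on such vectors each application of `D ^ d` gains one weight.
    have key : ∀ w, (D ^ (d * w)) v ∈ F.formsGE w := by
      intro w
      induction w with
      | zero => exact mem_formsGE_zero _
      | succ w ih =>
        have h1 : F.HasGr (t ^ b * D ^ (d + b)) fun x => T x ^ d :=
          ((ht.pow g b).mul (h.pow g (d + b))).congr fun x => by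
            rw [((hTτ x).symm.pow_pow b (d + b)).eq, ← hd' b]
        have h2 := (h.pow g d).sub_raises h1 ih
        have h3 : (D ^ (d + b)) ((D ^ (d * w)) v) = 0 := by
          rw [← Module.End.mul_apply, ← pow_add, show d + b + d * w = d + d * w + b by ring,
            pow_add, Module.End.mul_apply, hv, map_zero]
        rw [LinearMap.sub_apply, Module.End.mul_apply, h3, map_zero, sub_zero,
          ← Module.End.mul_apply, ← pow_add] at h2
        rwa [show d * (w + 1) = d + d * w by ring]
    have h4 := eq_zero_of_mem_formsGE le_rfl (key (n * F.s + 1))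
    obtain ⟨c, rfl⟩ := Nat.exists_eq_add_of_le ha
    rw [add_comm, pow_add, Module.End.mul_apply, h4, map_zero]
  · intro b
    -- Downward in the weight: `D ^ d v` is `D ^ (d + b) (t ^ b v)` plus a form of larger weight, to
    -- which the induction hypothesis applies.
    have key : ∀ j w, n * F.s + 1 ≤ w + j → ∀ v ∈ F.formsGE w, ∃ u, (D ^ (d * j)) v = (D ^ b) u := by
      intro j
      induction j with
      | zero =>
        intro w hw v hv
        exact ⟨0, by rw [eq_zero_of_mem_formsGE (by omega) hv]; simp⟩
      | succ j ih =>
        intro w hw v hv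
        have h1 : F.HasGr (D ^ (d + b) * t ^ b) fun x => T x ^ d :=
          ((h.pow g (d + b)).mul (ht.pow g b)).congr fun x => (hd' b x).symm
        have h2 := (h.pow g d).sub_raises h1 hv
        obtain ⟨u, hu⟩ := ih (w + 1) (by omega) _ h2
        refine ⟨u + (D ^ (d * j + d)) ((t ^ b) v), ?_⟩
        rw [map_add, ← hu, ← Module.End.mul_apply, ← Module.End.mul_apply, ← Module.End.mul_apply,
          ← LinearMap.add_apply]
        congr 1
        rw [mul_sub, ← pow_add, ← mul_assoc, ← pow_add, ← pow_add,
          show d * (j + 1) = d * j + d by ring, show b + (d * j + d) = d * j + (d + b) by ring,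
          sub_add_cancel]
    intro v
    obtain ⟨u, hu⟩ := key (n * F.s + 1) 0 (by omega) v (mem_formsGE_zero v)
    obtain ⟨c, rfl⟩ := Nat.exists_eq_add_of_le ha
    refine ⟨(D ^ c) u, ?_⟩
    rw [add_comm, pow_add, Module.End.mul_apply, hu, ← Module.End.mul_apply, ← Module.End.mul_apply,
      ← pow_add, ← pow_add, add_comm]

end Metric

end TangentFiltration
end FilteredManifold

end

/-! ### Spectral polynomials, and annihilation at a point. -/

section
open scoped Manifold ContDiff Topology TensorProduct

namespace FilteredManifold
open Polynomial

section Polynomials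

/-- For a polynomial `p`, the power `X ^ d` is a multiple of `X ^ (d + 1)` modulo `p`, if `0` is a
root of multiplicity at most `d`. -/
lemma dvd_X_pow_sub {p : ℝ[X]} (hp : p ≠ 0) {d : ℕ} (hd : p.natDegree ≤ d) :
    p ∣ X ^ d - X ^ (d + 1) * ∑ j ∈ Finset.range d,
      C (-(p.coeff (p.natTrailingDegree + 1 + j) / p.coeff p.natTrailingDegree)) * X ^ j := by
  set m := p.natTrailingDegree with hm
  have hm0 : p.coeff m ≠ 0 := mt Polynomial.trailingCoeff_eq_zero.1 hp
  have hmd : m ≤ d := (natTrailingDegree_le_natDegree p).trans hd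
  -- Normalizing the lowest nonzero coefficient to `1` and shifting it to degree `d`, the remaining
  -- terms of `p` are multiples of `X ^ (d + 1)`. The range `d` catches all of them because `p` has
  -- degree at most `d`.
  have key : X ^ d - X ^ (d + 1) * ∑ j ∈ Finset.range d,
      C (-(p.coeff (m + 1 + j) / p.coeff m)) * X ^ j = p * (C (p.coeff m)⁻¹ * X ^ (d - m)) := by
    ext i
    rw [coeff_sub, coeff_X_pow, ← mul_assoc, coeff_mul_X_pow', coeff_X_pow_mul', coeff_mul_C]
    simp only [finsetSum_coeff, coeff_C_mul, coeff_X_pow, mul_ite, mul_one, mul_zero,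
      Finset.sum_ite_eq, Finset.mem_range]
    rcases lt_trichotomy i d with h | rfl | h
    · rw [if_neg h.ne, if_neg (by omega)]
      split_ifs with h1
      · rw [coeff_eq_zero_of_lt_natTrailingDegree (by omega)]; simp
      · simp
    · rw [if_pos rfl, if_neg (by omega), if_pos (by omega), show i - (i - m) = m by omega,
        mul_inv_cancel₀ hm0]
      simp
    · rw [if_neg h.ne', if_pos (show d + 1 ≤ i by omega), if_pos (show d - m ≤ i by omega)]
      split_ifs with h1
      · rw [show m + 1 + (i - (d + 1)) = i - (d - m) by omega]
        field_simp
        ring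
      · rw [coeff_eq_zero_of_natDegree_lt (show p.natDegree < i - (d - m) by omega)]; simp
  rw [key]
  exact dvd_mul_right _ _

/-- Chinese remainders for the coprime `X ^ a` and `ρ`. The reduction modulo their product serves
only to bound the degree, which must be uniform in the point for `P` to have finite order. -/
lemma exists_projection_polynomial {ρ : ℝ[X]} (hρ : ρ.eval 0 ≠ 0) (a : ℕ) :
    ∃ π : ℝ[X], π.natDegree ≤ a + ρ.natDegree ∧ X ^ a ∣ π - 1 ∧ ρ ∣ π := by
  have hcop : IsCoprime (X ^ a : ℝ[X]) ρ := by
    refine IsCoprime.pow_left ((irreducible_X).coprime_iff_not_dvd.2 ?_)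
    rwa [X_dvd_iff, coeff_zero_eq_eval_zero]
  obtain ⟨u, v, huv⟩ := hcop
  have h0 : X ^ a * ρ ≠ 0 := mul_ne_zero (pow_ne_zero _ X_ne_zero) (by rintro rfl; simp at hρ)
  refine ⟨(v * ρ) % (X ^ a * ρ), ?_, ?_, ?_⟩
  · refine (natDegree_le_natDegree (degree_mod_lt _ h0).le).trans ?_
    exact natDegree_mul_le.trans (by simp)
  · have h1 : (v * ρ) % (X ^ a * ρ) - 1 = X ^ a * (-u - ρ * ((v * ρ) / (X ^ a * ρ))) := by
      rw [EuclideanDomain.mod_eq_sub_mul_div]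
      linear_combination huv
    rw [h1]
    exact dvd_mul_right _ _
  · rw [EuclideanDomain.mod_eq_sub_mul_div]
    exact dvd_sub (dvd_mul_left _ _) (Dvd.intro (X ^ a * ((v * ρ) / (X ^ a * ρ))) (by ring))

/-- The nonzero part of a split characteristic polynomial. -/
lemma exists_nonzero_part {V : Type*} [AddCommGroup V] [Module ℝ V] [FiniteDimensional ℝ V]
    {T : Module.End ℝ V} (hT : T.charpoly.Splits) :
    ∃ q : ℝ[X], q.natDegree ≤ T.charpoly.natDegree ∧
      T.charpoly ∣ X ^ T.charpoly.natDegree * q ∧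
      ∀ z : ℂ, aeval z q = 0 → ∃ μ : ℝ, z = μ ∧ μ ≠ 0 ∧ Module.End.HasEigenvalue T μ := by
  have hp : T.charpoly ≠ 0 := T.charpoly_monic.ne_zero
  obtain ⟨q, hq, hq0⟩ := exists_eq_pow_rootMultiplicity_mul_and_not_dvd T.charpoly hp 0
  rw [C_0, sub_zero] at hq hq0
  have hqd : q ∣ T.charpoly := Dvd.intro_left _ hq.symm
  refine ⟨q, natDegree_le_of_dvd hqd hp, ?_, fun z hz => ?_⟩
  · conv_lhs => rw [hq]
    exact mul_dvd_mul (pow_dvd_pow _ (by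
      rw [← count_roots]
      exact (Multiset.count_le_card _ _).trans (card_roots' _))) dvd_rfl
  · have hqs : q.Splits := hT.of_dvd hp hqd
    have hq' : q ≠ 0 := by rintro rfl; simp at hq0
    rw [hqs.eq_prod_roots] at hz
    simp only [map_mul, aeval_C, map_multiset_prod, Multiset.map_map, Function.comp_def,
      map_sub, aeval_X, mul_eq_zero, Multiset.prod_eq_zero_iff, Multiset.mem_map] at hz
    rcases hz with hz | ⟨μ, hμ, hz⟩
    · simp [hq'] at hz
    · refine ⟨μ, sub_eq_zero.1 hz, ?_, ?_⟩
      · rintro rfl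
        exact hq0 (by rw [X_dvd_iff, coeff_zero_eq_eval_zero]; exact (mem_roots hq').1 hμ)
      · rw [Module.End.hasEigenvalue_iff_isRoot_charpoly]
        exact ((mem_roots hq').1 hμ).dvd hqd

end Polynomials

variable {n : ℕ} {M : Type*} [TopologicalSpace M] [ChartedSpace (EuclideanSpace ℝ (Fin n)) M]
  [IsManifold (𝓡 n) ∞ M]

namespace TangentFiltration
variable (F : TangentFiltration n M)

/-- The filtration of the space of forms by the order of vanishing at `x` together with twice the
weight. -/
def vanishing (x : M) : ℕ → Submodule ℝ (Forms n M)
  | 0 => ⊤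
  -- `(h + 2) / 2` is `(h + 1) / 2` rounded up. Weight counts twice so that a weight-raising
  -- commutator gains two levels: one makes up for the function that was pulled out, and one is a
  -- net gain.
  | h + 1 => Submodule.span ℝ {β | ∃ (f : C^∞⟮𝓡 n, M; ℝ⟯) (α : Forms n M), f x = 0 ∧
      α ∈ vanishing x h ∧ β = mulFun f α} ⊔ F.formsGE ((h + 2) / 2)

variable {F} {x : M}

lemma formsGE_le_vanishing {h w : ℕ} (hw : h ≤ 2 * w) : F.formsGE w ≤ F.vanishing x h := by
  cases h with
  | zero => exact le_top
  | succ h => exact (formsGE_anti (by omega)).trans le_sup_right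

lemma mulFun_mem_vanishing {h : ℕ} {f : C^∞⟮𝓡 n, M; ℝ⟯} (hf : f x = 0) {α : Forms n M}
    (hα : α ∈ F.vanishing x h) : mulFun f α ∈ F.vanishing x (h + 1) :=
  Submodule.mem_sup_left (Submodule.subset_span ⟨f, α, hf, hα, rfl⟩)

/-- An induction principle for `vanishing`. -/
lemma vanishing_induction {W : Type*} [AddCommGroup W] [Module ℝ W] (L : Forms n M →ₗ[ℝ] W)
    (K : ℕ → Submodule ℝ W)
    (h1 : ∀ h w, h ≤ 2 * w → ∀ α ∈ F.formsGE w, L α ∈ K h)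
    (h2 : ∀ h (f : C^∞⟮𝓡 n, M; ℝ⟯), f x = 0 → ∀ α ∈ F.vanishing x h, L α ∈ K h →
      L (mulFun f α) ∈ K (h + 1))
    (h : ℕ) : ∀ α ∈ F.vanishing x h, L α ∈ K h := by
  induction h with
  | zero => exact fun α _ => h1 0 0 le_rfl α (mem_formsGE_zero α)
  | succ h ih =>
    suffices F.vanishing x (h + 1) ≤ (K (h + 1)).comap L from this
    refine sup_le (Submodule.span_le.2 ?_) fun α hα => h1 _ _ (by omega) α hα
    rintro _ ⟨f, α, hf, hα, rfl⟩
    exact h2 h f hf α hα (ih α hα)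

lemma vanishing_succ_le (h : ℕ) : F.vanishing x (h + 1) ≤ F.vanishing x h := by
  induction h with
  | zero => exact le_top
  | succ h ih =>
    refine sup_le (Submodule.span_le.2 ?_) (formsGE_le_vanishing (by omega))
    rintro _ ⟨f, α, hf, hα, rfl⟩
    exact mulFun_mem_vanishing hf (ih hα)

lemma val_eq_zero_of_mem_vanishing {h : ℕ} (hh : 2 * (n * F.s) + 1 ≤ h) {α : Forms n M}
    (hα : α ∈ F.vanishing x h) : α.val x = 0 := by
  obtain ⟨h, rfl⟩ : ∃ h', h = h' + 1 := ⟨h - 1, by omega⟩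
  suffices F.vanishing x (h + 1) ≤ LinearMap.ker (evalAt n x) from this hα
  refine sup_le (Submodule.span_le.2 ?_) fun α hα => ?_
  · rintro _ ⟨f, α, hf, -, rfl⟩
    change f x • α.val x = 0
    rw [hf, zero_smul]
  · rw [eq_zero_of_mem_formsGE (by omega) hα]
    exact Submodule.zero_mem _

/-- Algebraic operators which increase weights act on `vanishing`. -/
lemma mem_vanishing_of_raises {C : Module.End ℝ (Forms n M)} (h0 : HasOrderLE 0 C)
    (hC : ∀ w, ∀ α ∈ F.formsGE w, C α ∈ F.formsGE (w + 1)) (h : ℕ) :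
    ∀ α ∈ F.vanishing x h, C α ∈ F.vanishing x (h + 2) := by
  refine vanishing_induction C (fun h => F.vanishing x (h + 2))
    (fun h w hw α hα => formsGE_le_vanishing (by omega) (hC w α hα)) (fun h f hf α hα ih => ?_) h
  have := LinearMap.congr_fun (h0 f) α
  rw [Module.End.mul_apply, Module.End.mul_apply] at this
  rw [this]
  exact mulFun_mem_vanishing hf ih

section Metric
variable (g : Bundle.ContMDiffRiemannianMetric (𝓡 n) ∞ (EuclideanSpace ℝ (Fin n))
  (fun x : M => Tan n x)) {D : Module.End ℝ (Forms n M)} {T : ∀ x : M, Module.End ℝ (F.OscForms x)}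
include g

/-- A function acts on the graded fibre at `x` as the scalar `f x`, which commutes with `T x`. -/
lemma HasGr.commutator_raises (hD : F.HasGr D T) (f : C^∞⟮𝓡 n, M; ℝ⟯) {w : ℕ} {α : Forms n M}
    (hα : α ∈ F.formsGE w) : (D * mulFun f - mulFun f * D) α ∈ F.formsGE (w + 1) := by
  have h1 := hD.mul (hasGr_mulFun g f)
  have h2 : F.HasGr (mulFun f * D) fun x => T x * (f x • 1) :=
    ((hasGr_mulFun g f).mul hD).congr fun x => by
      ext1 β
      exact (map_smul (T x) (f x) β).symm
  exact h1.sub_raises h2 hα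

lemma HasGr.commutator_mem_vanishing (hD : F.HasGr D T) (hord : HasOrderLE 1 D)
    (f : C^∞⟮𝓡 n, M; ℝ⟯) (h : ℕ) : ∀ α ∈ F.vanishing x h,
      (D * mulFun f - mulFun f * D) α ∈ F.vanishing x (h + 2) :=
  mem_vanishing_of_raises (hord f) (fun _ _ hα => hD.commutator_raises g f hα) h

lemma HasGr.mem_vanishing (hD : F.HasGr D T) (hord : HasOrderLE 1 D) (h : ℕ) :
    ∀ α ∈ F.vanishing x h, D α ∈ F.vanishing x h := by
  refine vanishing_induction D (F.vanishing x)
    (fun h w hw α hα => formsGE_le_vanishing hw (hD.mem hα)) (fun h f hf α hα ih => ?_) h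
  have h1 := hD.commutator_mem_vanishing g hord f h α hα
  have h2 : D (mulFun f α) = (D * mulFun f - mulFun f * D) α + mulFun f (D α) := by
    simp [Module.End.mul_apply]
  rw [h2]
  exact Submodule.add_mem _ (vanishing_succ_le _ h1) (mulFun_mem_vanishing hf ih)

lemma HasGr.pow_mem_vanishing (hD : F.HasGr D T) (hord : HasOrderLE 1 D) (j : ℕ) {h : ℕ}
    {α : Forms n M} (hα : α ∈ F.vanishing x h) : (D ^ j) α ∈ F.vanishing x h := by
  induction j with
  | zero => exact hα
  | succ j ih => rw [pow_succ']; exact hD.mem_vanishing g hord h _ ih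

lemma HasGr.aeval_commutator_mem_vanishing (hD : F.HasGr D T) (hord : HasOrderLE 1 D)
    (f : C^∞⟮𝓡 n, M; ℝ⟯) (p : ℝ[X]) (h : ℕ) {α : Forms n M} (hα : α ∈ F.vanishing x h) :
    (Polynomial.aeval D p * mulFun f - mulFun f * Polynomial.aeval D p) α ∈ F.vanishing x (h + 2) := by
  have hpow : ∀ j, (D ^ j * mulFun f - mulFun f * D ^ j) α ∈ F.vanishing x (h + 2) := by
    intro j
    induction j with
    | zero => simp
    | succ j ih =>
      have e : D ^ (j + 1) * mulFun f - mulFun f * D ^ (j + 1) =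
          D * (D ^ j * mulFun f - mulFun f * D ^ j) +
            (D * mulFun f - mulFun f * D) * D ^ j := by
        rw [pow_succ']; noncomm_ring
      rw [e]
      exact Submodule.add_mem _ (hD.mem_vanishing g hord _ _ ih)
        (hD.commutator_mem_vanishing g hord f h _ (hD.pow_mem_vanishing g hord j hα))
  have e : (Polynomial.aeval D p * mulFun f - mulFun f * Polynomial.aeval D p) α =
      ∑ j ∈ Finset.range (p.natDegree + 1), p.coeff j • (D ^ j * mulFun f - mulFun f * D ^ j) α := by
    rw [aeval_eq_sum_range]
    simp [LinearMap.sum_apply, Module.End.mul_apply, smul_sub]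
  rw [e]
  exact Submodule.sum_mem _ fun j _ => Submodule.smul_mem _ _ (hpow j)

/-- If a family of polynomials with smooth coefficients annihilates the associated graded of `D`,
then a power of its member at `x`, evaluated at `D`, vanishes at `x`. -/
lemma HasGr.val_aeval_pow_eq_zero (hD : F.HasGr D T) (hord : HasOrderLE 1 D) {p : M → ℝ[X]} {d : ℕ}
    (hd : ∀ y, (p y).natDegree ≤ d) (c : ℕ → C^∞⟮𝓡 n, M; ℝ⟯) (hc : ∀ j y, c j y = (p y).coeff j)
    (hp : ∀ y, Polynomial.aeval (T y) (p y) = 0) (x : M) (α : Forms n M) :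
    (Polynomial.aeval D (p x ^ (2 * (n * F.s) + 1)) α).val x = 0 := by
  -- The polynomial frozen at `x` is compared with the varying one: the operator with coefficients
  -- `c j` has associated graded zero, hence raises weights, and the correction has coefficients
  -- that vanish at `x`. Both gain at least one level.
  let c' : ℕ → C^∞⟮𝓡 n, M; ℝ⟯ := fun j =>
    ⟨fun y => c j x - c j y, contMDiff_const.sub (c j).contMDiff⟩
  have hgr : F.HasGr (∑ j ∈ Finset.range (d + 1), mulFun (c j) * D ^ j) fun _ => 0 := by
    refine (hasGr_sum g _ fun j _ => (hasGr_mulFun g (c j)).mul (hD.pow g j)).congr fun y => ?_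
    rw [← hp y, aeval_eq_sum_range' (Nat.lt_succ_of_le (hd y))]
    refine Finset.sum_congr rfl fun j _ => ?_
    rw [hc, smul_mul_assoc, one_mul]
  have hstep : ∀ h, ∀ α ∈ F.vanishing x h,
      Polynomial.aeval D (p x) α ∈ F.vanishing x (h + 1) := by
    refine vanishing_induction (Polynomial.aeval D (p x)) (fun h => F.vanishing x (h + 1)) ?_ ?_
    · intro h w hw α hα
      have e : Polynomial.aeval D (p x) α =
          (∑ j ∈ Finset.range (d + 1), mulFun (c j) * D ^ j - 0) α +
            ∑ j ∈ Finset.range (d + 1), mulFun (c' j) ((D ^ j) α) := by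
        rw [aeval_eq_sum_range' (Nat.lt_succ_of_le (hd x)), sub_zero, LinearMap.sum_apply,
          LinearMap.sum_apply, ← Finset.sum_add_distrib]
        refine Finset.sum_congr rfl fun j _ => ?_
        ext1 y
        simp only [LinearMap.smul_apply, Forms.smul_val, Module.End.mul_apply, Forms.add_val,
          mulFun_val, ← hc]
        rw [← add_smul]
        congr 1
        exact (add_sub_cancel _ _).symm
      rw [e]
      refine Submodule.add_mem _ (formsGE_le_vanishing (by omega)
        (hgr.sub_raises (hasGr_zero g) hα)) (Submodule.sum_mem _ fun j _ => ?_)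
      exact mulFun_mem_vanishing (sub_self _)
        (formsGE_le_vanishing hw ((hD.pow g j).mem hα))
    -- Here `mulFun f α` is at level `h + 1`, so level `h + 2` has to be reached; the commutator
    -- with `f` gains exactly that.
    · intro h f hf α hα ih
      have e : Polynomial.aeval D (p x) (mulFun f α) =
          (Polynomial.aeval D (p x) * mulFun f - mulFun f * Polynomial.aeval D (p x)) α +
            mulFun f (Polynomial.aeval D (p x) α) := by
        simp [Module.End.mul_apply]
      rw [e]
      exact Submodule.add_mem _ (hD.aeval_commutator_mem_vanishing g hord f _ _ hα)
        (mulFun_mem_vanishing hf ih)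
  have hpow : ∀ j, Polynomial.aeval D (p x ^ j) α ∈ F.vanishing x j := by
    intro j
    induction j with
    | zero => exact Submodule.mem_top
    | succ j ih =>
      rw [pow_succ', map_mul, Module.End.mul_apply]
      exact hstep j _ ih
  exact val_eq_zero_of_mem_vanishing le_rfl (hpow _)

end Metric

end TangentFiltration
end FilteredManifold

end

/-! ### Fitting projections on forms, and their local expression by polynomials. -/

section
open scoped Manifold ContDiff Topology TensorProduct

namespace FilteredManifold
open Polynomial

section
variable {V : Type*} [AddCommGroup V] [Module ℝ V] [FiniteDimensional ℝ V] (T : Module.End ℝ V)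

omit [FiniteDimensional ℝ V] in
lemma commute_aeval (p : ℝ[X]) : Commute T (aeval T p) := by
  have h := Commute.map (show Commute (X : ℝ[X]) p from Commute.all _ _) (aeval T)
  rwa [aeval_X] at h

omit [FiniteDimensional ℝ V] in
lemma aeval_sum_C_mul_X_pow (s : Finset ℕ) (f : ℕ → ℝ) :
    aeval T (∑ j ∈ s, C (f j) * X ^ j) = ∑ j ∈ s, (f j • 1) * T ^ j := by
  simp [Algebra.smul_def]

lemma pow_eq_pow_succ_mul_aeval {d : ℕ} (hd : T.charpoly.natDegree ≤ d) :
    T ^ d = T ^ (d + 1) * aeval T (∑ j ∈ Finset.range d,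
      C (-(T.charpoly.coeff (T.charpoly.natTrailingDegree + 1 + j) /
        T.charpoly.coeff T.charpoly.natTrailingDegree)) * X ^ j) := by
  obtain ⟨r, hr⟩ := dvd_X_pow_sub T.charpoly_monic.ne_zero hd
  have h3 := congrArg (aeval T) hr
  rw [map_mul, LinearMap.aeval_self_charpoly, zero_mul, map_sub, map_mul, map_pow, aeval_X,
    map_pow, aeval_X] at h3
  exact sub_eq_zero.1 h3

lemma aeval_X_mul_apply_eq_zero {a k : ℕ} {ρ : ℝ[X]}
    (hT : LinearMap.ker (T ^ a) = LinearMap.ker T) (h : T.charpoly ^ (k + 1) ∣ X ^ a * ρ) (v : V) :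
    aeval T (X ^ 1 * ρ) v = 0 := by
  have h1 : aeval T (X ^ a * ρ) = 0 := by
    obtain ⟨r, hr⟩ := h
    rw [hr, map_mul, map_pow, LinearMap.aeval_self_charpoly, zero_pow (by omega), zero_mul]
  have h2 : aeval T ρ v ∈ LinearMap.ker (T ^ a) := by
    have := LinearMap.congr_fun h1 v
    rwa [map_mul, map_pow, aeval_X, Module.End.mul_apply] at this
  rw [hT] at h2
  rw [pow_one, map_mul, aeval_X, Module.End.mul_apply]
  exact h2

end

variable {n : ℕ} {M : Type*} [TopologicalSpace M] [ChartedSpace (EuclideanSpace ℝ (Fin n)) M]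
  [IsManifold (𝓡 n) ∞ M]

lemma AlgebraicMap.natDegree_charpoly (A : AlgebraicMap n M) (x : M) :
    (A.fib x).charpoly.natDegree = Module.finrank ℝ (ModelFiber n) :=
  LinearMap.charpoly_natDegree _

/-- The coefficients of the fibrewise characteristic polynomials of an algebraic map. -/
def AlgebraicMap.charCoeff [T2Space M] (A : AlgebraicMap n M) (j : ℕ) : C^∞⟮𝓡 n, M; ℝ⟯ :=
  ⟨fun x => (A.fib x).charpoly.coeff j, A.contMDiff_charpoly_coeff j⟩

namespace TangentFiltration
variable {F : TangentFiltration n M}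

variable (F) in
/-- An exponent at which the kernels and the images of the powers of the box stabilize. -/
def exponent : ℕ := Module.finrank ℝ (ModelFiber n) * (2 * (n * F.s) + 1) + 1

variable {g : Bundle.ContMDiffRiemannianMetric (𝓡 n) ∞ (EuclideanSpace ℝ (Fin n))
  (fun x : M => Tan n x)} {D P : Module.End ℝ (Forms n M)}

variable (F g) in
/-- For every `x`, a polynomial `ρ x` whose roots are nonzero eigenvalues of the osculating box,
and a polynomial `π x` which is `1` modulo a power of `X` and divisible by `ρ x`. -/
structure IsSpectralPair (ρ π : M → ℝ[X]) : Prop where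
  natDegree_le : ∃ r, ∀ x, (π x).natDegree ≤ r
  dvd_sub_one : ∀ x, X ^ F.exponent ∣ π x - 1
  dvd : ∀ x, ρ x ∣ π x
  hasEigenvalue : ∀ x (z : ℂ), aeval z (ρ x) = 0 →
    ∃ μ : ℝ, z = μ ∧ μ ≠ 0 ∧ Module.End.HasEigenvalue (F.oscBox g x) μ
  charpoly_pow_dvd : ∀ x,
    (F.oscBox g x).charpoly ^ (2 * (n * F.s) + 1) ∣ X ^ F.exponent * ρ x

variable [T2Space M]

lemma natDegree_charpoly_oscBox {A : AlgebraicMap n M} (hA : F.HasGr A.op (F.oscBox g)) (x : M) :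
    (F.oscBox g x).charpoly.natDegree = Module.finrank ℝ (ModelFiber n) := by
  rw [← hA.charpoly_eq g, A.natDegree_charpoly]

/-- `ρ x` is a power of the part of the characteristic polynomial with nonzero roots. The power is
the number of levels after which a form must vanish at `x`. -/
lemma exists_isSpectralPair {A : AlgebraicMap n M} (hA : F.HasGr A.op (F.oscBox g)) :
    ∃ ρ π, IsSpectralPair F g ρ π := by
  choose q hqd hq hqe using fun x => exists_nonzero_part (F.splits_charpoly_oscBox g x)
  set K := 2 * (n * F.s) + 1
  have h0 : ∀ x, (q x ^ K).eval 0 ≠ 0 := by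
    intro x h
    rw [eval_pow] at h
    obtain ⟨μ, h1, h2, -⟩ := hqe x 0 (by
      rw [← coeff_zero_eq_aeval_zero', coeff_zero_eq_eval_zero, pow_eq_zero_iff (by omega)|>.1 h,
        map_zero])
    exact h2 (by exact_mod_cast h1.symm)
  choose π hπd hπ1 hπ using fun x => exists_projection_polynomial (h0 x) F.exponent
  refine ⟨fun x => q x ^ K, π, ⟨F.exponent + K * Module.finrank ℝ (ModelFiber n), fun x => ?_⟩,
    hπ1, hπ, fun x z hz => hqe x z ?_, fun x => ?_⟩
  · refine (hπd x).trans (Nat.add_le_add_left (natDegree_pow_le.trans ?_) _)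
    exact Nat.mul_le_mul_left _ ((hqd x).trans (natDegree_charpoly_oscBox hA x).le)
  · rw [map_pow] at hz
    exact pow_eq_zero_iff (by omega) |>.1 hz
  · refine (pow_dvd_pow_of_dvd (hq x) K).trans ?_
    rw [mul_pow, ← pow_mul, natDegree_charpoly_oscBox hA]
    exact mul_dvd_mul (pow_dvd_pow _ (Nat.le_succ _)) dvd_rfl

/-- An operator whose associated graded is the osculating box admits a Fitting projection. -/
lemma exists_isFittingProjection {A : AlgebraicMap n M} (hA : F.HasGr A.op (F.oscBox g))
    (hrank : IsLocallyConstant fun x : M => Module.finrank ℝ (LinearMap.ker (F.oscBox g x)))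
    (hD : F.HasGr D (F.oscBox g)) :
    (∃ P, IsFittingProjection D P F.exponent) ∧
    (∀ (b : ℕ) (v : Forms n M), (D ^ b) v = 0 → (D ^ F.exponent) v = 0) ∧
    ∀ (b : ℕ) (v : Forms n M), ∃ u, (D ^ F.exponent) v = (D ^ b) u := by
  set d := Module.finrank ℝ (ModelFiber n)
  let m : M → ℕ := fun x => (F.oscBox g x).charpoly.natTrailingDegree
  have hm : ∀ x, ∀ᶠ y in 𝓝 x, m y = m x := by
    intro x
    filter_upwards [(IsLocallyConstant.iff_eventually_eq _).1 hrank x] with y hy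
    simp only [m, natTrailingDegree_charpoly_oscBox]
    exact hy
  have hp : ∀ x, (F.oscBox g x).charpoly ≠ 0 := fun x => (LinearMap.charpoly_monic _).ne_zero
  have hc : ∀ x j, A.charCoeff j x = (F.oscBox g x).charpoly.coeff j := fun x j => by
    rw [← hA.charpoly_eq g]; rfl
  -- The index `m x` of the lowest nonzero coefficient is locally constant; this is where the
  -- constant dimension of the kernel is needed. The quotients are therefore smooth.
  let τ : ℕ → M → ℝ := fun j x => -(A.charCoeff (m x + 1 + j) x / A.charCoeff (m x) x)
  have hτ : ∀ j, ContMDiff (𝓡 n) 𝓘(ℝ, ℝ) ∞ (τ j) := by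
    intro j x
    have h1 : ContMDiffAt (𝓡 n) 𝓘(ℝ, ℝ) ∞
        (fun y => -(A.charCoeff (m x + 1 + j) y / A.charCoeff (m x) y)) x := by
      refine ContMDiffAt.neg (ContMDiffAt.div₀ (A.charCoeff _).contMDiff.contMDiffAt
        (A.charCoeff _).contMDiff.contMDiffAt ?_)
      rw [hc]
      exact mt Polynomial.trailingCoeff_eq_zero.1 (hp x)
    refine h1.congr_of_eventuallyEq ?_
    filter_upwards [hm x] with y hy
    simp only [τ, hy]
  let t : Module.End ℝ (Forms n M) := ∑ j ∈ Finset.range d, mulFun ⟨τ j, hτ j⟩ * D ^ j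
  let σ : M → ℝ[X] := fun x => ∑ j ∈ Finset.range d, C (τ j x) * X ^ j
  have ht : F.HasGr t fun x => aeval (F.oscBox g x) (σ x) := by
    refine (hasGr_sum g _ fun j _ => (hasGr_mulFun g ⟨τ j, hτ j⟩).mul (hD.pow g j)).congr
      fun x => ?_
    exact (aeval_sum_C_mul_X_pow _ _ _).symm
  have hσ : ∀ x, F.oscBox g x ^ d = F.oscBox g x ^ (d + 1) * aeval (F.oscBox g x) (σ x) := by
    intro x
    have h4 : σ x = ∑ j ∈ Finset.range d,
      C (-((F.oscBox g x).charpoly.coeff ((F.oscBox g x).charpoly.natTrailingDegree + 1 + j) /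
        (F.oscBox g x).charpoly.coeff (F.oscBox g x).charpoly.natTrailingDegree)) * X ^ j :=
      Finset.sum_congr rfl fun j _ => by simp only [τ, hc]; rfl
    rw [h4]
    exact pow_eq_pow_succ_mul_aeval _ (natDegree_charpoly_oscBox hA x).le
  obtain ⟨h1, h2⟩ := hD.stabilize g (a := F.exponent) ht (fun x => commute_aeval _ _) hσ
    ((Nat.mul_le_mul_left d (by omega)).trans (Nat.le_succ _))
  exact ⟨FilteredManifold.exists_isFittingProjection (h1 _) (h2 _), h1, h2⟩

namespace IsSpectralPair
variable {ρ π : M → ℝ[X]} (hs : IsSpectralPair F g ρ π)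
include hs

-- `oscProj x` is the Fitting projection of `oscBox x` with exponent `1`. Since the powers of a
-- symmetric operator have the same kernel, the annihilating polynomial `X ^ a ρ` can be replaced by
-- `X ρ`.
omit [T2Space M] in
lemma aeval_oscBox_eq (x : M) : aeval (F.oscBox g x) (π x) = F.oscProj g x := by
  ext1 β
  refine ((F.isFittingProjection_oscProj g x).eq_aeval (T := LinearMap.id) (ρ := ρ x)
    (aeval_X_mul_apply_eq_zero _ ?_ (hs.charpoly_pow_dvd x))
    ((pow_dvd_pow X (Nat.le_add_left 1 _)).trans (hs.dvd_sub_one x)) (hs.dvd x) β).symm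
  exact ker_pow_eq_of_symmetric (F.oscFormForm_symm g x) (F.oscFormForm_pos g x)
    (F.oscBox_symmetric g x) _

lemma val_aeval_eq_zero {A : AlgebraicMap n M} (hA : F.HasGr A.op (F.oscBox g))
    (hD : F.HasGr D (F.oscBox g)) (hord : HasOrderLE 1 D) (x : M) (α : Forms n M) :
    (aeval D (X ^ F.exponent * ρ x) α).val x = 0 := by
  obtain ⟨r, hr⟩ := hs.charpoly_pow_dvd x
  rw [hr, map_mul, Module.End.mul_apply]
  exact hD.val_aeval_pow_eq_zero g hord (p := fun y => (F.oscBox g y).charpoly)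
    (fun y => (natDegree_charpoly_oscBox hA y).le) A.charCoeff
    (fun j y => by rw [← hA.charpoly_eq g]; rfl)
    (fun y => LinearMap.aeval_self_charpoly _) x _

variable {A : AlgebraicMap n M} (hA : F.HasGr A.op (F.oscBox g)) (hD : F.HasGr D (F.oscBox g))
  (hord : HasOrderLE 1 D) (hP : IsFittingProjection D P F.exponent)
include hA hD hord hP

/-- Seen through evaluation at `x`, the polynomial `X ^ a ρ` annihilates `D`, so the abstract
projection becomes a polynomial in `D`. Locality, order, degree and associated graded of `P` are all
read off from this. -/
lemma val_apply (α : Forms n M) (x : M) : (P α).val x = (aeval D (π x) α).val x :=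
  hP.eq_aeval (T := evalAt n x) (hs.val_aeval_eq_zero hA hD hord x) (hs.dvd_sub_one x) (hs.dvd x) α

lemma isDifferentialOperator : IsDifferentialOperator P := by
  obtain ⟨r, hr⟩ := hs.natDegree_le
  exact ⟨r, HasOrderLE.of_pointwise fun x =>
    ⟨_, hord.aeval (hr x), fun α => hs.val_apply hA hD hord hP α x⟩⟩

lemma hasGr : F.HasGr P (F.oscProj g) := by
  refine fun w α hα => ⟨fun x => ?_, fun x => ?_⟩
  · rw [hs.val_apply hA hD hord hP]
    exact (hD.aeval g (π x)).mem hα x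
  · obtain ⟨β, hβ⟩ := exists_isClass g (hα x)
    refine ⟨β, hβ, ?_⟩
    rw [hs.val_apply hA hD hord hP, ← hs.aeval_oscBox_eq x]
    exact (hD.aeval g (π x)).isClass hα hβ

lemma respects (hdeg : F.RespectsDegreeAndFiltration D) : F.RespectsDegreeAndFiltration P := by
  intro k w α hα
  have h1 : ∀ p : ℝ[X], aeval D p α ∈ F.degFormsGE k w := by
    intro p
    rw [aeval_eq_sum_range, LinearMap.sum_apply]
    refine Submodule.sum_mem _ fun j _ => Submodule.smul_mem _ _ ?_
    clear * - hα hdeg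
    induction j with
    | zero => exact hα
    | succ j ih => rw [pow_succ']; exact hdeg k w _ ih
  refine ⟨fun x => ?_, fun x l hl => ?_⟩
  · rw [hs.val_apply hA hD hord hP]
    exact (h1 _).1 x
  · rw [hs.val_apply hA hD hord hP]
    exact (h1 _).2 x l hl

end IsSpectralPair
end TangentFiltration

namespace BasePair
variable {F : TangentFiltration n M}
  {g : Bundle.ContMDiffRiemannianMetric (𝓡 n) ∞ (EuclideanSpace ℝ (Fin n)) (fun x : M => Tan n x)}
  (B : BasePair F g)

/-- The base box as an algebraic map. -/
def box₀Map : AlgebraicMap n M where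
  fib := B.box₀
  smooth α hα := Submodule.add_mem _ (B.d₀.smooth _ (B.δ₀.smooth α hα))
    (B.δ₀.smooth _ (B.d₀.smooth α hα))

lemma box₀Map_op : B.box₀Map.op = B.d₀.op * B.δ₀.op + B.δ₀.op * B.d₀.op := rfl

lemma hasGr_box₀Map : F.HasGr B.box₀Map.op (F.oscBox g) := by
  rw [box₀Map_op]
  exact (B.gr_d₀.mul B.gr_δ₀).add (B.gr_δ₀.mul B.gr_d₀)

variable [T2Space M]

lemma hasGr_box : F.HasGr B.box (F.oscBox g) :=
  ((TangentFiltration.hasGr_deRham g).mul B.gr_δ₀).add (B.gr_δ₀.mul (TangentFiltration.hasGr_deRham g))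

/-- The fibrewise Fitting projection of the base box is smooth. -/
lemma exists_baseProjection {ρ π : M → ℝ[X]} (hs : TangentFiltration.IsSpectralPair F g ρ π)
    (hrank : IsLocallyConstant fun x : M => Module.finrank ℝ (LinearMap.ker (F.oscBox g x))) :
    ∃ Q₀ : AlgebraicMap n M, IsFittingProjection B.box₀Map.op Q₀.op F.exponent ∧
      ∀ x, Q₀.fib x = aeval (B.box₀ x) (π x) := by
  obtain ⟨⟨Q, hQ⟩, -⟩ := TangentFiltration.exists_isFittingProjection B.hasGr_box₀Map hrank
    B.hasGr_box₀Map
  have hv := hs.val_apply B.hasGr_box₀Map B.hasGr_box₀Map B.box₀Map.hasOrderLE.succ hQ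
  have hv' : ∀ (α : Forms n M) x, aeval (B.box₀ x) (π x) (α.val x) = (Q α).val x := fun α x => by
    rw [hv, B.box₀Map.aeval_op_val]; rfl
  -- The polynomials `π x` are chosen point by point, without regularity in `x`. Smoothness is
  -- inherited from `Q`, which acts on smooth forms and agrees with this fibrewise expression.
  refine ⟨⟨fun x => aeval (B.box₀ x) (π x), fun α hα => ?_⟩, ?_, fun x => rfl⟩
  · have : (fun x => aeval (B.box₀ x) (π x) (α x)) = (Q ⟨α, hα⟩).1 :=
      funext fun x => hv' ⟨α, hα⟩ x
    rw [this]
    exact (Q ⟨α, hα⟩).2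
  · convert hQ
    ext α x : 2
    exact hv' α x

end BasePair
end FilteredManifold

end

/-! ### Invertibility of polynomials in the box, globally and on germs. -/

section
open scoped Manifold ContDiff Topology TensorProduct

namespace FilteredManifold
open Polynomial

section LinearAlgebra

/-- The real polynomial `|X - z| ^ 2`. -/
def normPoly (z : ℂ) : ℝ[X] := X ^ 2 - C (2 * z.re) * X + C (Complex.normSq z)

lemma aeval_normPoly_ofReal {z : ℂ} {μ : ℝ} (h : (μ : ℂ) ≠ z) : aeval (μ : ℂ) (normPoly z) ≠ 0 := by
  have h1 : aeval (μ : ℂ) (normPoly z) = ((Complex.normSq ((μ : ℂ) - z) : ℝ) : ℂ) := by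
    simp only [normPoly, map_add, map_sub, map_pow, map_mul, aeval_X, aeval_C,
      Complex.coe_algebraMap, Complex.normSq_apply, Complex.sub_re, Complex.sub_im,
      Complex.ofReal_re, Complex.ofReal_im]
    push_cast
    ring
  rw [h1, Complex.ofReal_ne_zero]
  exact (Complex.normSq_pos.2 (sub_ne_zero.2 h)).ne'

variable {V : Type*} [AddCommGroup V] [Module ℝ V] [FiniteDimensional ℝ V] {T : Module.End ℝ V}

lemma hasEigenvalue_of_aeval_charpoly_eq_zero (hT : T.charpoly.Splits) {z : ℂ}
    (hz : aeval z T.charpoly = 0) : ∃ μ : ℝ, z = μ ∧ Module.End.HasEigenvalue T μ := by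
  have hp : T.charpoly ≠ 0 := T.charpoly_monic.ne_zero
  rw [hT.eq_prod_roots] at hz
  simp only [map_mul, aeval_C, map_multiset_prod, Multiset.map_map, Function.comp_def,
    map_sub, aeval_X, mul_eq_zero, Multiset.prod_eq_zero_iff, Multiset.mem_map] at hz
  rcases hz with hz | ⟨μ, hμ, hz⟩
  · simp [hp] at hz
  · exact ⟨μ, sub_eq_zero.1 hz, (Module.End.hasEigenvalue_iff_isRoot_charpoly _ _).2
      ((mem_roots hp).1 hμ)⟩

lemma isCoprime_normPoly_charpoly (hT : T.charpoly.Splits) {z : ℂ}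
    (hz : ∀ μ : ℝ, Module.End.HasEigenvalue T μ → (μ : ℂ) ≠ z) :
    IsCoprime (normPoly z) T.charpoly := by
  refine (isCoprime_iff_aeval_ne_zero_of_isAlgClosed ℝ ℂ _ _).2 fun w => ?_
  by_contra! h
  obtain ⟨μ, rfl, hμ⟩ := hasEigenvalue_of_aeval_charpoly_eq_zero hT h.2
  exact aeval_normPoly_ofReal (hz μ hμ) h.1

lemma isUnit_aeval_of_isCoprime {c : ℝ[X]} (h : IsCoprime c T.charpoly) : IsUnit (aeval T c) := by
  obtain ⟨u, v, huv⟩ := h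
  have h1 := congrArg (aeval T) huv
  rw [map_add, map_mul, map_mul, LinearMap.aeval_self_charpoly, mul_zero, add_zero, map_one] at h1
  refine isUnit_iff_exists_and_exists.2 ⟨⟨aeval T u, ?_⟩, ⟨aeval T u, h1⟩⟩
  rw [← map_mul, mul_comm, map_mul, h1]

lemma coeff_zero_charpoly_ne_zero (h : IsUnit T) : T.charpoly.coeff 0 ≠ 0 := by
  intro h0
  have h1 : T.charpoly.IsRoot 0 := by rw [IsRoot, ← coeff_zero_eq_eval_zero, h0]
  obtain ⟨v, hv⟩ := ((Module.End.hasEigenvalue_iff_isRoot_charpoly _ _).2 h1).exists_hasEigenvector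
  have h2 := hv.apply_eq_smul
  rw [zero_smul] at h2
  exact hv.2 (((Module.End.isUnit_iff _).1 h).1 (h2.trans (map_zero T).symm))

/-- Cayley-Hamilton with the constant term moved to the other side: an inverse up to a scalar,
polynomial in `T`, whose coefficients remain smooth where `T` degenerates. -/
lemma mul_sum_coeff_charpoly {d : ℕ} (hd : T.charpoly.natDegree ≤ d) {a : ℕ → ℝ} {r : ℝ}
    (hr : r = T.charpoly.coeff 0) (ha : ∀ j, a j = -T.charpoly.coeff (j + 1)) :
    T * ∑ j ∈ Finset.range d, (a j • 1) * T ^ j = r • 1 := by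
  have h := LinearMap.aeval_self_charpoly T
  rw [aeval_eq_sum_range' (Nat.lt_succ_of_le hd), Finset.sum_range_succ', pow_zero] at h
  rw [hr, eq_neg_of_add_eq_zero_right h, Finset.mul_sum, ← Finset.sum_neg_distrib]
  refine Finset.sum_congr rfl fun j _ => ?_
  rw [ha, smul_mul_assoc, one_mul, mul_smul_comm, ← pow_succ', neg_smul]

lemma sum_coeff_charpoly_mul {d : ℕ} (hd : T.charpoly.natDegree ≤ d) {a : ℕ → ℝ} {r : ℝ}
    (hr : r = T.charpoly.coeff 0) (ha : ∀ j, a j = -T.charpoly.coeff (j + 1)) :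
    (∑ j ∈ Finset.range d, (a j • 1) * T ^ j) * T = r • 1 := by
  rw [← mul_sum_coeff_charpoly hd hr ha]
  simp [Finset.mul_sum, Finset.sum_mul, ← pow_succ, ← pow_succ']

omit [FiniteDimensional ℝ V] in
lemma smul_one_mul_smul_one {a b c : ℝ} (h : a * b = c) :
    (a • 1 : Module.End ℝ V) * (b • 1) = c • 1 := by
  rw [smul_mul_smul_comm, h, one_mul]

omit [FiniteDimensional ℝ V] in
lemma smul_one_mul_smul_one_eq_one {a b : ℝ} (h : a * b = 1) :
    (a • 1 : Module.End ℝ V) * (b • 1) = 1 := by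
  rw [smul_one_mul_smul_one h, one_smul]

omit [FiniteDimensional ℝ V] in
lemma smul_one_add_smul_one {a b : ℝ} (h : a + b = 1) :
    (a • 1 : Module.End ℝ V) + b • 1 = 1 := by
  rw [← add_smul, h, one_smul]

lemma finite_hasEigenvalue : {μ : ℝ | Module.End.HasEigenvalue T μ}.Finite := by
  refine (T.charpoly.roots.toFinset.finite_toSet).subset fun μ hμ => ?_
  rw [Finset.mem_coe, Multiset.mem_toFinset, mem_roots T.charpoly_monic.ne_zero]
  exact (Module.End.hasEigenvalue_iff_isRoot_charpoly _ _).1 hμ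

variable (T) in
lemma eventually_lt_abs_eigenvalue : ∀ᶠ ε in 𝓝[>] (0 : ℝ), 0 < ε ∧
    ∀ μ : ℝ, Module.End.HasEigenvalue T μ → μ ≠ 0 → ε < |μ| := by
  refine eventually_nhdsWithin_of_forall (fun ε hε => hε) |>.and ?_
  have h := (Set.Finite.eventually_all (l := 𝓝[>] (0 : ℝ)) (finite_hasEigenvalue (T := T))
    (p := fun μ ε => μ ≠ 0 → ε < |μ|)).2 fun μ _ => ?_
  · exact h
  · by_cases h0 : μ = 0
    · simp [h0]
    · filter_upwards [nhdsWithin_le_nhds (Iio_mem_nhds (abs_pos.2 h0))] with ε hε _ using hε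

end LinearAlgebra

variable {n : ℕ} {M : Type*} [TopologicalSpace M] [ChartedSpace (EuclideanSpace ℝ (Fin n)) M]
  [IsManifold (𝓡 n) ∞ M]

/-- The operators which act on germs at `x`. -/
def germEnd (x : M) : Subalgebra ℝ (Module.End ℝ (Forms n M)) where
  carrier := {D | vanishingNear n x ≤ (vanishingNear n x).comap D}
  mul_mem' h h' _ hα := h (h' hα)
  add_mem' h h' _ hα := (vanishingNear n x).add_mem (h hα) (h' hα)
  algebraMap_mem' r _ hα := (vanishingNear n x).smul_mem r hα

lemma mem_germEnd {x : M} {D : Module.End ℝ (Forms n M)} :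
    D ∈ germEnd x ↔ vanishingNear n x ≤ (vanishingNear n x).comap D := Iff.rfl

/-- The action on germs at `x`. -/
def germAction (x : M) : germEnd (n := n) x →ₐ[ℝ] Module.End ℝ (FormGerm n x) where
  toFun D := (vanishingNear n x).mapQ (vanishingNear n x) D (mem_germEnd.1 D.2)
  map_one' := by ext; rfl
  map_mul' _ _ := by ext; rfl
  map_zero' := by ext; rfl
  map_add' _ _ := by ext; rfl
  commutes' _ := by ext; rfl

lemma mulFun_mem_germEnd (x : M) (f : C^∞⟮𝓡 n, M; ℝ⟯) : mulFun f ∈ germEnd (n := n) x :=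
  mem_germEnd.2 fun α hα => by
    have hα : ∀ᶠ y in 𝓝 x, α.val y = 0 := hα
    change ∀ᶠ y in 𝓝 x, f y • α.val y = 0
    filter_upwards [hα] with y hy
    rw [hy, smul_zero]

lemma germAction_mulFun {x : M} {f : C^∞⟮𝓡 n, M; ℝ⟯} (hf : ∀ᶠ y in 𝓝 x, f y = 0) :
    germAction x ⟨mulFun f, mulFun_mem_germEnd x f⟩ = 0 := by
  ext α
  refine (Submodule.Quotient.mk_eq_zero _).2 ?_
  change ∀ᶠ y in 𝓝 x, f y • α.val y = 0
  filter_upwards [hf] with y hy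
  rw [hy, zero_smul]

lemma boxGerm_eq (δ : AlgebraicMap n M) (x : M) :
    boxGerm δ x = germAction x ⟨box δ, mem_germEnd.2 (box_vanishingNear δ x)⟩ := rfl

lemma aeval_boxGerm_mk (δ : AlgebraicMap n M) (x : M) (p : ℝ[X]) (α : Forms n M) :
    aeval (boxGerm δ x) p (Submodule.Quotient.mk α) =
      Submodule.Quotient.mk (aeval (box δ) p α) := by
  rw [boxGerm_eq, aeval_algHom_apply]
  have : ((aeval (⟨box δ, mem_germEnd.2 (box_vanishingNear δ x)⟩ : germEnd (n := n) x) p : germEnd (n := n) x) :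
      Module.End ℝ (Forms n M)) = aeval (box δ) p :=
    (aeval_algHom_apply (germEnd (n := n) x).val _ p).symm
  rw [← this]
  rfl

namespace TangentFiltration
variable {F : TangentFiltration n M}
  {g : Bundle.ContMDiffRiemannianMetric (𝓡 n) ∞ (EuclideanSpace ℝ (Fin n))
    (fun x : M => Tan n x)} {D : Module.End ℝ (Forms n M)}

include g in
lemma HasGr.pow_one_sub_eq_zero (h : F.HasGr D fun _ => 1) : (1 - D) ^ (n * F.s + 1) = 0 :=
  pow_eq_zero_of_raises (fun _ _ hα => (hasGr_one g).sub_raises h hα) le_rfl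

include g in
lemma HasGr.isUnit (h : F.HasGr D fun _ => 1) : IsUnit D := by
  have h1 : IsNilpotent (1 - D) := ⟨_, h.pow_one_sub_eq_zero (g := g)⟩
  have := h1.isUnit_one_sub
  rwa [sub_sub_cancel] at this

include g in
lemma HasGr.isUnit_germAction {x : M} (h : F.HasGr D fun _ => 1) (hD : D ∈ germEnd x) :
    IsUnit (germAction x ⟨D, hD⟩) := by
  have h1 : IsNilpotent (1 - (⟨D, hD⟩ : germEnd (n := n) x)) :=
    ⟨n * F.s + 1, Subtype.ext (h.pow_one_sub_eq_zero (g := g))⟩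
  have := h1.isUnit_one_sub.map (germAction x)
  rwa [sub_sub_cancel] at this

variable [T2Space M] {A : AlgebraicMap n M} (hA : F.HasGr A.op (F.oscBox g))
  (hD : F.HasGr D (F.oscBox g))
include hA hD

/-- An inverse up to a function and up to operators which increase weights. -/
lemma exists_quasi_inverse (c : ℝ[X]) : ∃ (r : C^∞⟮𝓡 n, M; ℝ⟯) (f : ℕ → C^∞⟮𝓡 n, M; ℝ⟯) (d : ℕ),
    (∀ y, IsUnit (aeval (F.oscBox g y) c) → r y ≠ 0) ∧
    F.HasGr (aeval D c * ∑ j ∈ Finset.range d, mulFun (f j) * aeval D c ^ j) (fun y => r y • 1) ∧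
    F.HasGr ((∑ j ∈ Finset.range d, mulFun (f j) * aeval D c ^ j) * aeval D c)
      (fun y => r y • 1) := by
  -- The coefficients sought are those of the characteristic polynomial of `c(oscBox)`. They are
  -- smooth because `c` of the algebraic map `A` has that associated graded.
  let S : AlgebraicMap n M := ⟨fun x => aeval (A.fib x) c, fun α hα => by
    have : (fun x => aeval (A.fib x) c (α x)) = (aeval A.op c ⟨α, hα⟩ : Forms n M).1 :=
      funext fun x => (A.aeval_op_val c ⟨α, hα⟩ x).symm
    rw [this]
    exact (aeval A.op c ⟨α, hα⟩ : Forms n M).2⟩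
  have hSop : S.op = aeval A.op c := by
    ext α x : 2
    exact (A.aeval_op_val c α x).symm
  have hS : F.HasGr S.op fun x => aeval (F.oscBox g x) c := hSop ▸ hA.aeval g c
  have hc : ∀ x j, S.charCoeff j x = (aeval (F.oscBox g x) c).charpoly.coeff j := fun x j => by
    rw [← hS.charpoly_eq g]; rfl
  have hd : ∀ x, (aeval (F.oscBox g x) c).charpoly.natDegree ≤ Module.finrank ℝ (ModelFiber n) :=
    fun x => by rw [← hS.charpoly_eq g, S.natDegree_charpoly]
  let f : ℕ → C^∞⟮𝓡 n, M; ℝ⟯ := fun j => -S.charCoeff (j + 1)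
  have hG : F.HasGr (∑ j ∈ Finset.range (Module.finrank ℝ (ModelFiber n)),
      mulFun (f j) * aeval D c ^ j) fun x => ∑ j ∈ Finset.range (Module.finrank ℝ (ModelFiber n)),
        (f j x • 1) * (aeval (F.oscBox g x) c) ^ j :=
    hasGr_sum g _ fun j _ => (hasGr_mulFun g (f j)).mul ((hD.aeval g c).pow g j)
  have hf : ∀ x j, f j x = -(aeval (F.oscBox g x) c).charpoly.coeff (j + 1) := fun x j =>
    congrArg Neg.neg (hc x (j + 1))
  refine ⟨S.charCoeff 0, f, Module.finrank ℝ (ModelFiber n), fun y hy => ?_, ?_, ?_⟩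
  · rw [hc]
    exact coeff_zero_charpoly_ne_zero hy
  · exact ((hD.aeval g c).mul hG).congr fun x => mul_sum_coeff_charpoly (hd x) (hc x 0) (hf x)
  · exact (hG.mul (hD.aeval g c)).congr fun x => sum_coeff_charpoly_mul (hd x) (hc x 0) (hf x)

/-- Dividing by the nowhere vanishing function `r` makes both products of `aeval D c` with its
quasi-inverse unipotent; this gives a left and a right inverse. -/
lemma isUnit_aeval {c : ℝ[X]} (hc : ∀ y, IsUnit (aeval (F.oscBox g y) c)) : IsUnit (aeval D c) := by
  obtain ⟨r, f, d, hr, h1, h2⟩ := exists_quasi_inverse hA hD c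
  set G := ∑ j ∈ Finset.range d, mulFun (f j) * aeval D c ^ j
  let θ : C^∞⟮𝓡 n, M; ℝ⟯ := ⟨fun y => (r y)⁻¹, r.contMDiff.inv₀ fun y => hr y (hc y)⟩
  have hθ : ∀ y, θ y * r y = 1 := fun y => inv_mul_cancel₀ (hr y (hc y))
  have u1 : IsUnit (aeval D c * G * mulFun θ) := HasGr.isUnit (F := F) (g := g) <|
    (h1.mul (hasGr_mulFun g θ)).congr fun y =>
      smul_one_mul_smul_one_eq_one ((mul_comm _ _).trans (hθ y))
  have u2 : IsUnit (mulFun θ * (G * aeval D c)) := HasGr.isUnit (F := F) (g := g) <|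
    ((hasGr_mulFun g θ).mul h2).congr fun y =>
      smul_one_mul_smul_one_eq_one (hθ y)
  obtain ⟨v1, hv1, -⟩ := isUnit_iff_exists.1 u1
  obtain ⟨v2, -, hv2⟩ := isUnit_iff_exists.1 u2
  exact isUnit_iff_exists_and_exists.2 ⟨⟨G * mulFun θ * v1, by rw [← hv1]; simp only [mul_assoc]⟩,
    ⟨v2 * (mulFun θ * G), by rw [← hv2]; simp only [mul_assoc]⟩⟩

/-- Invertibility at `x` gives `r ≠ 0` near `x` only, so `1 / r` is cut off by `χ` and the
associated graded of the products becomes `χ` instead of `1`. -/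
lemma isUnit_germAction_aeval {x : M} {c : ℝ[X]} (hc : IsUnit (aeval (F.oscBox g x) c))
    (hDx : D ∈ germEnd x) : IsUnit (aeval (germAction x ⟨D, hDx⟩) c) := by
  obtain ⟨r, f, d, hr, h1, h2⟩ := exists_quasi_inverse hA hD c
  obtain ⟨χ, hχ, hχ'⟩ := exists_cutoff (n := n) x (U := {y | r y ≠ 0})
    ((isOpen_ne_fun r.contMDiff.continuous continuous_const).mem_nhds (hr x hc))
  let θ : C^∞⟮𝓡 n, M; ℝ⟯ := ⟨fun y => χ y * (r y)⁻¹, fun y => by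
    by_cases hy : y ∈ tsupport χ
    · exact χ.contMDiff.contMDiffAt.mul (r.contMDiff.contMDiffAt.inv₀ (hχ' hy))
    · have : (fun y => χ y * (r y)⁻¹) =ᶠ[𝓝 y] fun _ => 0 := by
        filter_upwards [(isClosed_tsupport χ).isOpen_compl.mem_nhds hy] with z hz
        rw [image_eq_zero_of_notMem_tsupport hz, zero_mul]
      exact contMDiffAt_const.congr_of_eventuallyEq this⟩
  have hθ : ∀ y, θ y * r y = χ y := fun y => by
    by_cases hy : r y = 0
    · rw [hy, mul_zero, image_eq_zero_of_notMem_tsupport fun h => hχ' h hy]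
    · exact inv_mul_cancel_right₀ hy _
  -- Multiplication by `1 - χ` is zero on germs at `x`. Adding it restores the associated graded `1`
  -- without changing the action on germs.
  let η : C^∞⟮𝓡 n, M; ℝ⟯ := ⟨fun y => 1 - χ y, contMDiff_const.sub χ.contMDiff⟩
  have hη : germAction x ⟨mulFun η, mulFun_mem_germEnd x η⟩ = 0 := germAction_mulFun (by
    filter_upwards [hχ] with y hy
    change 1 - χ y = 0
    rw [hy, sub_self])
  let E : germEnd (n := n) x := aeval ⟨D, hDx⟩ c
  have hE : (E : Module.End ℝ (Forms n M)) = aeval D c :=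
    (aeval_algHom_apply (germEnd (n := n) x).val _ c).symm
  let μ : C^∞⟮𝓡 n, M; ℝ⟯ → germEnd (n := n) x := fun f => ⟨mulFun f, mulFun_mem_germEnd x f⟩
  let G : germEnd (n := n) x := ∑ j ∈ Finset.range d, μ (f j) * E ^ j
  have hG : (G : Module.End ℝ (Forms n M)) =
      ∑ j ∈ Finset.range d, mulFun (f j) * aeval D c ^ j := by
    rw [← hE]
    simp [G, μ]
  have key : ∀ S : germEnd (n := n) x, F.HasGr (S : Module.End ℝ (Forms n M)) (fun y => χ y • 1) →
      IsUnit (germAction x S) := by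
    intro S hS
    have h3 := HasGr.isUnit_germAction (F := F) (g := g) (D := (S + μ η : germEnd (n := n) x))
      ((hS.add (hasGr_mulFun g η)).congr fun y =>
        smul_one_add_smul_one (add_sub_cancel (χ y) 1)) (S + μ η).2
    change IsUnit (germAction x (S + μ η)) at h3
    rwa [map_add, hη, add_zero] at h3
  have u1 := key (E * G * μ θ) (by
    change F.HasGr ((E : Module.End ℝ (Forms n M)) * G * mulFun θ) _
    rw [hE, hG]
    exact (h1.mul (hasGr_mulFun g θ)).congr fun y =>
      smul_one_mul_smul_one ((mul_comm _ _).trans (hθ y)))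
  have u2 := key (μ θ * (G * E)) (by
    change F.HasGr (mulFun θ * ((G : Module.End ℝ (Forms n M)) * E)) _
    rw [hE, hG]
    exact ((hasGr_mulFun g θ).mul h2).congr fun y =>
      smul_one_mul_smul_one (hθ y))
  rw [map_mul, map_mul, mul_assoc] at u1
  rw [map_mul, map_mul, ← mul_assoc] at u2
  rw [aeval_algHom_apply]
  obtain ⟨v1, hv1, -⟩ := isUnit_iff_exists.1 u1
  obtain ⟨v2, -, hv2⟩ := isUnit_iff_exists.1 u2
  exact isUnit_iff_exists_and_exists.2 ⟨⟨_, (mul_assoc _ _ _).symm.trans hv1⟩,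
    ⟨_, (mul_assoc _ _ _).trans hv2⟩⟩

end TangentFiltration
end FilteredManifold

end

/-! ### The projections as contour integrals. -/

section
open scoped Manifold ContDiff Topology TensorProduct

namespace FilteredManifold
open Polynomial

variable {n : ℕ} {M : Type*} [TopologicalSpace M] [ChartedSpace (EuclideanSpace ℝ (Fin n)) M]
  [IsManifold (𝓡 n) ∞ M]

lemma ofReal_ne_of_lt_abs {V : Type*} [AddCommGroup V] [Module ℝ V] {T : Module.End ℝ V} {ε : ℝ}
    (hε : 0 < ε) (h : ∀ μ : ℝ, Module.End.HasEigenvalue T μ → μ ≠ 0 → ε < |μ|) {z : ℂ}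
    (hz : ‖z‖ = ε) (μ : ℝ) (hμ : Module.End.HasEigenvalue T μ) : (μ : ℂ) ≠ z := by
  rintro rfl
  rw [Complex.norm_real, Real.norm_eq_abs] at hz
  by_cases h0 : μ = 0
  · rw [h0, abs_zero] at hz
    exact hε.ne hz
  · exact (h μ hμ h0).ne' hz

namespace TangentFiltration
variable {F : TangentFiltration n M} {g : Bundle.ContMDiffRiemannianMetric (𝓡 n) ∞
    (EuclideanSpace ℝ (Fin n)) (fun x : M => Tan n x)} {ρ π : M → ℝ[X]}

lemma IsSpectralPair.aeval_ne_zero (hs : IsSpectralPair F g ρ π) {x : M} {ε : ℝ}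
    (h : ∀ μ : ℝ, Module.End.HasEigenvalue (F.oscBox g x) μ → μ ≠ 0 → ε < |μ|) (z : ℂ)
    (hz : ‖z‖ ≤ ε) : aeval z (ρ x) ≠ 0 := by
  intro h0
  obtain ⟨μ, rfl, hμ0, hμ⟩ := hs.hasEigenvalue x z h0
  rw [Complex.norm_real, Real.norm_eq_abs] at hz
  exact absurd (h μ hμ hμ0) hz.not_gt

lemma isUnit_aeval_normPoly_oscBox {x : M} {z : ℂ}
    (hz : ∀ μ : ℝ, Module.End.HasEigenvalue (F.oscBox g x) μ → (μ : ℂ) ≠ z) :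
    IsUnit (aeval (F.oscBox g x) (normPoly z)) :=
  isUnit_aeval_of_isCoprime (isCoprime_normPoly_charpoly (F.splits_charpoly_oscBox g x) hz)

end TangentFiltration

namespace BasePair
variable {F : TangentFiltration n M}
  {g : Bundle.ContMDiffRiemannianMetric (𝓡 n) ∞ (EuclideanSpace ℝ (Fin n)) (fun x : M => Tan n x)}
  (B : BasePair F g) [T2Space M] {ρ π : M → ℝ[X]} (hs : TangentFiltration.IsSpectralPair F g ρ π)
  {ε : ℝ} (hε : 0 < ε)

lemma charpoly_box₀ (x : M) : (B.box₀ x).charpoly = (F.oscBox g x).charpoly :=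
  B.hasGr_box₀Map.charpoly_eq g x

section Pointwise
variable {x : M} (h : ∀ μ : ℝ, Module.End.HasEigenvalue (F.oscBox g x) μ → μ ≠ 0 → ε < |μ|)
include hε h

lemma circleInResolventSet_box₀ : CircleInResolventSet (B.box₀ x) ε := fun z hz => by
  refine isUnit_sub_baseChange (isUnit_aeval_of_isCoprime (c := normPoly z) ?_)
  rw [charpoly_box₀]
  exact isCoprime_normPoly_charpoly (F.splits_charpoly_oscBox g x) (ofReal_ne_of_lt_abs hε h hz)

include hs in
lemma isContourValue_box₀ (v : FormFiber n x) :
    IsContourValue (B.box₀ x) ε LinearMap.id v (aeval (B.box₀ x) (π x) v) := by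
  have h0 : aeval (B.box₀ x) (X ^ F.exponent * ρ x) = 0 := by
    obtain ⟨r, hr⟩ := hs.charpoly_pow_dvd x
    rw [hr, map_mul, map_pow, ← charpoly_box₀, LinearMap.aeval_self_charpoly,
      zero_pow (by omega), zero_mul]
  obtain ⟨q, hq⟩ := hs.dvd_sub_one x
  obtain ⟨r, hr⟩ := hs.dvd x
  refine isContourValue_of_annihilating (T := LinearMap.id) (u := -aeval (B.box₀ x) q v) hε
    (B.circleInResolventSet_box₀ hε h) (hs.aeval_ne_zero h) (a := F.exponent)
    (fun v => by rw [h0]; rfl) ?_ ?_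
  · have h1 : aeval (B.box₀ x) (X ^ F.exponent * π x) = 0 := by
      rw [hr, ← mul_assoc, map_mul, h0, zero_mul]
    have := LinearMap.congr_fun h1 v
    rwa [map_mul, map_pow, aeval_X] at this
  · have h1 := LinearMap.congr_fun (congrArg (aeval (B.box₀ x)) hq) v
    rw [map_sub, map_mul, map_pow, aeval_X, map_one] at h1
    rw [map_neg]
    exact (neg_sub _ _).symm.trans (congrArg Neg.neg h1)

lemma circleInResolventSet_boxGerm : CircleInResolventSet (boxGerm B.δ₀ x) ε := fun _ hz =>
  isUnit_sub_baseChange (TangentFiltration.isUnit_germAction_aeval B.hasGr_box₀Map B.hasGr_box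
    (TangentFiltration.isUnit_aeval_normPoly_oscBox (ofReal_ne_of_lt_abs hε h hz))
    (mem_germEnd.2 (box_vanishingNear B.δ₀ x)))

-- Neither the box nor its action on germs is claimed to be annihilated by a polynomial;
-- annihilation after evaluation at `x` is all that the residue computation requires.
include hs in
lemma isContourValue_boxGerm {P : Module.End ℝ (Forms n M)}
    (hP : IsFittingProjection B.box P F.exponent) (α : Forms n M) :
    IsContourValue (boxGerm B.δ₀ x) ε (germValue n x) (Submodule.Quotient.mk α)
      ((P α).val x) := by
  obtain ⟨u, hu⟩ := hP.exists_pow_eq_sub α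
  have hpow : ∀ (k : ℕ) β, (boxGerm B.δ₀ x ^ k) (Submodule.Quotient.mk β) =
      Submodule.Quotient.mk ((B.box ^ k) β) := fun k β => by
    have := aeval_boxGerm_mk B.δ₀ x (X ^ k) β
    rwa [map_pow, aeval_X, map_pow, aeval_X] at this
  refine isContourValue_of_annihilating (T := germValue n x) (a := F.exponent)
    (v₀ := Submodule.Quotient.mk (P α)) (u := Submodule.Quotient.mk u) hε
    (B.circleInResolventSet_boxGerm hε h) (hs.aeval_ne_zero h) (fun v => ?_) ?_ ?_
  · obtain ⟨β, rfl⟩ := Submodule.Quotient.mk_surjective _ v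
    rw [aeval_boxGerm_mk]
    exact hs.val_aeval_eq_zero B.hasGr_box₀Map B.hasGr_box (hasOrderLE_box B.δ₀) x β
  · rw [hpow, hP.mem_ker_pow]
    rfl
  · rw [hpow, ← hu]
    rfl

end Pointwise

section Global
variable (h : ∀ (x : M) (μ : ℝ), Module.End.HasEigenvalue (F.oscBox g x) μ → μ ≠ 0 → ε < |μ|)
include hε h

lemma circleInResolventSet_box : CircleInResolventSet B.box ε := fun _ hz =>
  isUnit_sub_baseChange (TangentFiltration.isUnit_aeval B.hasGr_box₀Map B.hasGr_box fun x =>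
    TangentFiltration.isUnit_aeval_normPoly_oscBox (ofReal_ne_of_lt_abs hε (h x) hz))

include hs in
lemma isContourValue_box {P : Module.End ℝ (Forms n M)}
    (hP : IsFittingProjection B.box P F.exponent) (α : Forms n M) (x : M) :
    IsContourValue B.box ε (evalAt n x) α ((P α).val x) := by
  obtain ⟨u, hu⟩ := hP.exists_pow_eq_sub α
  exact isContourValue_of_annihilating (T := evalAt n x) hε
    (B.circleInResolventSet_box hε h) (hs.aeval_ne_zero (h x))
    (hs.val_aeval_eq_zero B.hasGr_box₀Map B.hasGr_box (hasOrderLE_box B.δ₀) x)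
    (hP.mem_ker_pow α) hu

end Global

-- Two conditions valid for all small radii share a radius, and there the integral determines the
-- value.
omit [T2Space M] in
lemma isBaseKernelProjection_unique {Q Q' : AlgebraicMap n M} (h : B.IsBaseKernelProjection Q)
    (h' : B.IsBaseKernelProjection Q') : Q = Q' := by
  have : Q.fib = Q'.fib := by
    funext x
    obtain ⟨ε, h1, h2⟩ := ((h x).and (h' x)).exists
    ext1 v
    exact (h1.2 v).unique (h2.2 v)
  cases Q
  cases Q'
  congr

omit [T2Space M] in
lemma isContourProjection_unique {P P' : Module.End ℝ (Forms n M)} (h : B.IsContourProjection P)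
    (h' : B.IsContourProjection P') : P = P' := by
  ext α x : 2
  obtain ⟨ε, h1, h2⟩ := ((h x).and (h' x)).exists
  exact (h1.2 α).unique (h2.2 α)

include hs

lemma isBaseKernelProjection_of_fib {Q : AlgebraicMap n M}
    (hQ : ∀ x, Q.fib x = aeval (B.box₀ x) (π x)) : B.IsBaseKernelProjection Q := fun x => by
  filter_upwards [eventually_lt_abs_eigenvalue (F.oscBox g x)] with ε hε
  refine ⟨B.circleInResolventSet_box₀ hε.1 hε.2, fun v => ?_⟩
  rw [hQ]
  exact B.isContourValue_box₀ hs hε.1 hε.2 v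

lemma isContourProjection_of_fitting {P : Module.End ℝ (Forms n M)}
    (hP : IsFittingProjection B.box P F.exponent) : B.IsContourProjection P := fun x => by
  filter_upwards [eventually_lt_abs_eigenvalue (F.oscBox g x)] with ε hε
  exact ⟨B.circleInResolventSet_boxGerm hε.1 hε.2, B.isContourValue_boxGerm hs hε.1 hε.2 hP⟩

end BasePair
end FilteredManifold

end

/-! ### Consequences for `P`, `L` and the subspaces. -/

section
open scoped Manifold ContDiff Topology TensorProduct

namespace FilteredManifold

section Ring
variable {R : Type*} [Ring R] {p q l l' b : R}

lemma idem_mul_intertwiner (hp : p * p = p) :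
    p * (p * q + (1 - p) * (1 - q)) = p * q := by
  have h : p * (1 - p) = 0 := by rw [mul_sub, mul_one, hp, sub_self]
  rw [mul_add, ← mul_assoc, ← mul_assoc, hp, h, zero_mul, add_zero]

lemma intertwiner_mul_idem (hq : q * q = q) :
    (p * q + (1 - p) * (1 - q)) * q = p * q := by
  have h : (1 - q) * q = 0 := by rw [sub_mul, one_mul, hq, sub_self]
  rw [add_mul, mul_assoc, mul_assoc, hq, h, mul_zero, add_zero]

lemma eq_conj_of_intertwining (h : p * l = l * q) (h1 : l * l' = 1) : p = l * q * l' := by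
  rw [← h, mul_assoc, h1, mul_one]

lemma inv_mul_eq_of_intertwining (h : p * l = l * q) (h1 : l * l' = 1) (h2 : l' * l = 1) :
    l' * p = q * l' := by
  rw [eq_conj_of_intertwining h h1, mul_assoc, ← mul_assoc, h2, one_mul]

lemma conj_commutes_of_intertwining (h : p * l = l * q) (h1 : l * l' = 1) (h2 : l' * l = 1)
    (hb : p * b = b * p) : (l' * b * l) * q = q * (l' * b * l) := by
  rw [mul_assoc, ← h, ← mul_assoc, mul_assoc l', ← hb, ← mul_assoc,
    inv_mul_eq_of_intertwining h h1 h2]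
  simp only [mul_assoc]

end Ring

section Module
variable {V : Type*} [AddCommGroup V] [Module ℝ V] {p q l l' : Module.End ℝ V}

lemma map_ker_of_intertwining (h : p * l = l * q) (h1 : l * l' = 1) (h2 : l' * l = 1) :
    Submodule.map l (LinearMap.ker q) = LinearMap.ker p := by
  apply le_antisymm
  · rintro _ ⟨v, hv, rfl⟩
    have := LinearMap.congr_fun h v
    rw [Module.End.mul_apply, Module.End.mul_apply, hv, map_zero] at this
    exact this
  · intro v hv
    refine ⟨l' v, ?_, LinearMap.congr_fun h1 v⟩
    have := LinearMap.congr_fun (inv_mul_eq_of_intertwining h h1 h2) v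
    rw [Module.End.mul_apply, Module.End.mul_apply, hv, map_zero] at this
    exact this.symm

lemma map_range_of_intertwining (h : p * l = l * q) (h1 : l * l' = 1) :
    Submodule.map l (LinearMap.range q) = LinearMap.range p := by
  apply le_antisymm
  · rintro _ ⟨_, ⟨v, rfl⟩, rfl⟩
    exact ⟨l v, LinearMap.congr_fun h v⟩
  · rintro _ ⟨v, rfl⟩
    exact ⟨q (l' v), ⟨_, rfl⟩, (LinearMap.congr_fun (eq_conj_of_intertwining h h1) v).symm⟩

lemma idem_intertwiner (hp : p * p = p) :
    p * p + (1 + (-1 : ℝ) • p) * (1 + (-1 : ℝ) • p) = 1 := by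
  rw [neg_one_smul, ← sub_eq_add_neg, mul_sub, sub_mul, mul_one, sub_mul, hp]
  simp

lemma one_add_neg_smul_apply_eq_iff (v : V) : (1 + (-1 : ℝ) • p) v = v ↔ p v = 0 := by
  rw [neg_one_smul, LinearMap.add_apply, Module.End.one_apply, add_eq_left, LinearMap.neg_apply,
    neg_eq_zero]

lemma range_one_sub (hp : p * p = p) : LinearMap.range (1 - p) = LinearMap.ker p := by
  ext v
  constructor
  · rintro ⟨u, rfl⟩
    have := LinearMap.congr_fun hp u
    rw [Module.End.mul_apply] at this
    simp [this]
  · intro hv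
    exact ⟨v, by simpa using hv⟩

end Module

namespace IsFittingProjection
variable {V : Type*} [AddCommGroup V] [Module ℝ V] {A P : Module.End ℝ V} {a : ℕ}
  (h : IsFittingProjection A P a)
include h

lemma commute_self : Commute P A := h.commute (Commute.refl A)

lemma apply_eq_iff (v : V) : P v = v ↔ (A ^ a) v = 0 :=
  ⟨fun hv => hv ▸ h.mem_ker_pow v, h.apply_of_pow_eq_zero⟩

/-- This replaces the exponent of the construction by any power that kills `P`, whether larger or
smaller. -/
lemma range_eq_ker_pow {b : ℕ} (hk : ∀ v, (A ^ b) v = 0 → (A ^ a) v = 0) (hb : A ^ b * P = 0) :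
    LinearMap.range P = LinearMap.ker (A ^ b) := by
  apply le_antisymm
  · rintro _ ⟨v, rfl⟩
    exact LinearMap.congr_fun hb v
  · rw [h.range_eq]
    exact hk

lemma ker_eq_range_pow {b : ℕ} (hr : ∀ v, ∃ u, (A ^ a) v = (A ^ b) u) (hb : A ^ b * P = 0) :
    LinearMap.ker P = LinearMap.range (A ^ b) := by
  apply le_antisymm
  · rw [h.ker_eq]
    rintro _ ⟨v, rfl⟩
    obtain ⟨u, hu⟩ := hr v
    exact ⟨u, hu.symm⟩
  · rintro _ ⟨v, rfl⟩
    have := LinearMap.congr_fun ((h.commute_self.pow_right b).eq.trans hb) v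
    exact this

lemma bijOn (ha : a ≠ 0) (hr : ∀ v, ∃ u, (A ^ a) v = (A ^ (a + 1)) u) :
    Set.BijOn A (LinearMap.ker P : Set V) (LinearMap.ker P : Set V) := by
  refine ⟨fun v hv => ?_, fun u hu v hv huv => ?_, fun v hv => ?_⟩
  · have := LinearMap.congr_fun h.commute_self.eq v
    rw [Module.End.mul_apply, Module.End.mul_apply, LinearMap.mem_ker.1 hv, map_zero] at this
    exact this
  · rw [← sub_eq_zero]
    have h1 : (A ^ a) (u - v) = 0 := by
      obtain ⟨a, rfl⟩ := Nat.exists_eq_succ_of_ne_zero ha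
      rw [pow_succ, Module.End.mul_apply, map_sub A, huv, sub_self, map_zero]
    rw [← h.apply_of_pow_eq_zero h1, map_sub, LinearMap.mem_ker.1 hu, LinearMap.mem_ker.1 hv,
      sub_zero]
  · rw [h.ker_eq] at hv ⊢
    obtain ⟨u, rfl⟩ := hv
    obtain ⟨u', hu'⟩ := hr u
    exact ⟨_, ⟨u', rfl⟩, by rw [hu', pow_succ']; rfl⟩

lemma pow_mul_eq_zero {N : ℕ} (hN : (A * P) ^ N = 0) : A ^ N * P = 0 := by
  have h1 : P ^ N * P = P := by
    induction N with
    | zero => rw [pow_zero, one_mul]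
    | succ N _ => rw [← pow_succ, IsIdempotentElem.pow_succ_eq _ h.idem]
  rw [h.commute_self.symm.mul_pow] at hN
  rw [← h1, ← mul_assoc, hN, zero_mul]

end IsFittingProjection

variable {n : ℕ} {M : Type*} [TopologicalSpace M] [ChartedSpace (EuclideanSpace ℝ (Fin n)) M]
  [IsManifold (𝓡 n) ∞ M] {D D' : Module.End ℝ (Forms n M)}

lemma IsDifferentialOperator.one : IsDifferentialOperator (1 : Module.End ℝ (Forms n M)) :=
  ⟨0, HasOrderLE.one⟩

lemma IsDifferentialOperator.add (h : IsDifferentialOperator D) (h' : IsDifferentialOperator D') :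
    IsDifferentialOperator (D + D') := by
  obtain ⟨r, h⟩ := h
  obtain ⟨r', h'⟩ := h'
  exact ⟨max r r', (h.mono (le_max_left _ _)).add (h'.mono (le_max_right _ _))⟩

lemma IsDifferentialOperator.mul (h : IsDifferentialOperator D) (h' : IsDifferentialOperator D') :
    IsDifferentialOperator (D * D') := by
  obtain ⟨r, h⟩ := h
  obtain ⟨r', h'⟩ := h'
  exact ⟨r + r', h.mul h'⟩

lemma IsDifferentialOperator.one_sub (h : IsDifferentialOperator D) :
    IsDifferentialOperator (1 - D) := by
  obtain ⟨r, h⟩ := h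
  rw [sub_eq_add_neg, ← neg_one_smul ℝ D]
  exact IsDifferentialOperator.one.add ⟨r, h.smul _⟩

lemma IsDifferentialOperator.geom_sum (h : IsDifferentialOperator D) (N : ℕ) :
    IsDifferentialOperator (∑ j ∈ Finset.range N, D ^ j) := by
  have hpow : ∀ j, IsDifferentialOperator (D ^ j) := fun j => by
    induction j with
    | zero => exact IsDifferentialOperator.one
    | succ j ih => rw [pow_succ]; exact ih.mul h
  induction N with
  | zero => exact ⟨0, HasOrderLE.zero 0⟩
  | succ N ih => rw [Finset.sum_range_succ]; exact ih.add (hpow N)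

lemma deRham_val_eq_zero {α : Forms n M} {k : ℕ} (hα : ∀ x l, l ≠ k → α.val x l = 0) (x : M)
    {l : ℕ} (hl : l ≠ k + 1) : (deRham α).val x l = 0 := by
  match l with
  | 0 => rfl
  | l + 1 =>
    change extDer (fun y => α.val y l) x = 0
    have h1 : (fun y : M => α.val y l) = fun y => (0 : ℝ) • α.val y l := by
      funext y
      rw [hα y l (by omega), smul_zero]
    rw [h1, extDer_smul]
    exact zero_smul ℝ _

namespace TangentFiltration
variable {F : TangentFiltration n M}

lemma degFormsGE_anti {k w w' : ℕ} (hw : w ≤ w') : F.degFormsGE k w' ≤ F.degFormsGE k w :=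
  fun _ hα => ⟨formsGE_anti hw hα.1, hα.2⟩

lemma RespectsDegreeAndFiltration.add (h : F.RespectsDegreeAndFiltration D)
    (h' : F.RespectsDegreeAndFiltration D') : F.RespectsDegreeAndFiltration (D + D') :=
  fun k w α hα => Submodule.add_mem _ (h k w α hα) (h' k w α hα)

lemma RespectsDegreeAndFiltration.one_sub (h : F.RespectsDegreeAndFiltration D) :
    F.RespectsDegreeAndFiltration (1 - D) :=
  fun k w α hα => Submodule.sub_mem _ hα (h k w α hα)

lemma RespectsDegreeAndFiltration.mul (h : F.RespectsDegreeAndFiltration D)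
    (h' : F.RespectsDegreeAndFiltration D') : F.RespectsDegreeAndFiltration (D * D') :=
  fun k w α hα => h k w _ (h' k w α hα)

variable {g : Bundle.ContMDiffRiemannianMetric (𝓡 n) ∞ (EuclideanSpace ℝ (Fin n))
  (fun x : M => Tan n x)}

lemma oscBox_mul_oscProj (x : M) : F.oscBox g x * F.oscProj g x = 0 := by
  ext1 β
  have := (F.isFittingProjection_oscProj g x).mem_ker_pow β
  rwa [pow_one] at this

lemma oscProj_apply_eq_iff (x : M) (β : F.OscForms x) :
    F.oscProj g x β = β ↔ β ∈ LinearMap.ker (F.oscBox g x) := by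
  rw [(F.isFittingProjection_oscProj g x).apply_eq_iff, pow_one, LinearMap.mem_ker]

lemma oscProj_apply_eq_zero_iff (x : M) (β : F.OscForms x) :
    F.oscProj g x β = 0 ↔ β ∈ LinearMap.range (F.oscBox g x) := by
  rw [← LinearMap.mem_ker, (F.isFittingProjection_oscProj g x).ker_eq, pow_one]

include g in
/-- The associated graded of the image of an idempotent. -/
lemma HasGr.hasGrSubspace {T : ∀ x : M, Module.End ℝ (F.OscForms x)} (h : F.HasGr D T)
    (hD : D * D = D) {S : ∀ x : M, Submodule ℝ (F.OscForms x)}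
    (hS : ∀ x β, T x β = β ↔ β ∈ S x) : F.HasGrSubspace (LinearMap.range D) S := by
  refine fun w α hα => ⟨?_, fun h1 => ⟨D α, ⟨α, rfl⟩, h.mem hα, ?_⟩⟩
  · rintro ⟨_, ⟨α', rfl⟩, h1, h2⟩ x
    obtain ⟨β, hβ⟩ := exists_isClass g (h1 x)
    have h3 := h.isClass h1 hβ
    rw [← Module.End.mul_apply, hD] at h3
    refine ⟨β, (hS x β).1 (h3.unique hβ), ?_⟩
    have h4 := hβ.add (F.isClass_zero_of_mem (h2 x))
    rw [Forms.sub_val, add_sub_cancel, add_zero] at h4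
    exact h4
  · refine mem_formsGE_succ (Submodule.sub_mem _ hα (h.mem hα)) fun x => ?_
    obtain ⟨β, hβ, h2⟩ := h1 x
    have h3 := h.isClass hα h2
    rw [(hS x β).2 hβ] at h3
    exact h2.sub h3

lemma HasGr.one_sub {T : ∀ x : M, Module.End ℝ (F.OscForms x)} (h : F.HasGr D T)
    (g : Bundle.ContMDiffRiemannianMetric (𝓡 n) ∞ (EuclideanSpace ℝ (Fin n))
      (fun x : M => Tan n x)) : F.HasGr (1 - D) fun x => 1 + (-1 : ℝ) • T x := by
  rw [sub_eq_add_neg, ← neg_one_smul ℝ D]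
  exact (hasGr_one g).add (h.smul _)

lemma HasGr.hasGrSubspace_range (h : F.HasGr D (F.oscProj g)) (hD : D * D = D) :
    F.HasGrSubspace (LinearMap.range D) fun x => LinearMap.ker (F.oscBox g x) :=
  HasGr.hasGrSubspace (g := g) h hD oscProj_apply_eq_iff

lemma HasGr.hasGrSubspace_ker (h : F.HasGr D (F.oscProj g)) (hD : D * D = D) :
    F.HasGrSubspace (LinearMap.ker D) fun x => LinearMap.range (F.oscBox g x) := by
  rw [← range_one_sub hD]
  exact HasGr.hasGrSubspace (g := g) (h.one_sub g) (IsIdempotentElem.one_sub hD) fun x β =>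
    (one_add_neg_smul_apply_eq_iff β).trans (oscProj_apply_eq_zero_iff x β)

/-- Both factors induce the same idempotent `p`, and `p p + (1 - p) (1 - p) = 1`; hence `L` is
unipotent. -/
lemma hasGr_opL {Q : AlgebraicMap n M} (hD : F.HasGr D (F.oscProj g))
    (hQ : F.HasGr Q.op (F.oscProj g)) : F.HasGr (opL Q D) fun _ => 1 :=
  ((hD.mul hQ).add ((hD.one_sub g).mul (hQ.one_sub g))).congr fun x =>
    idem_intertwiner (F.isFittingProjection_oscProj g x).idem

end TangentFiltration

namespace BasePair
variable {F : TangentFiltration n M}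
  {g : Bundle.ContMDiffRiemannianMetric (𝓡 n) ∞ (EuclideanSpace ℝ (Fin n)) (fun x : M => Tan n x)}
  (B : BasePair F g)

lemma δ₀_eq_zero_of_degree_zero {w : ℕ} {α : Forms n M} (hα : α ∈ F.degFormsGE 0 w) :
    B.δ₀.op α = 0 := B.δ₀_zero α (TangentFiltration.degFormsGE_anti (Nat.zero_le w) hα)

lemma respects_anticommutator {d : Module.End ℝ (Forms n M)}
    (hd : ∀ k w, ∀ α ∈ F.degFormsGE k w, d α ∈ F.degFormsGE (k + 1) w) :
    F.RespectsDegreeAndFiltration (d * B.δ₀.op + B.δ₀.op * d) := by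
  refine fun k w α hα => Submodule.add_mem _ ?_ (B.δ₀_mem k w _ (hd k w α hα))
  -- In degree zero the codifferential has no target degree, and its vanishing on functions is used
  -- instead.
  cases k with
  | zero =>
    rw [Module.End.mul_apply, B.δ₀_eq_zero_of_degree_zero hα, map_zero]
    exact Submodule.zero_mem _
  | succ k => exact hd k w _ (B.δ₀_mem k w α hα)

lemma respects_box₀Map : F.RespectsDegreeAndFiltration B.box₀Map.op := by
  rw [box₀Map_op]
  exact B.respects_anticommutator B.d₀_mem

lemma respects_box [T2Space M] : F.RespectsDegreeAndFiltration B.box :=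
  B.respects_anticommutator fun _ _ _ hα => ⟨TangentFiltration.deRham_mem hα.1, fun x _ hl =>
    deRham_val_eq_zero hα.2 x hl⟩

lemma commute_deRham_box : Commute deRham B.box := by
  change deRham * (deRham * B.δ₀.op + B.δ₀.op * deRham) =
    (deRham * B.δ₀.op + B.δ₀.op * deRham) * deRham
  rw [mul_add, add_mul, ← mul_assoc, deRham_mul_deRham, mul_assoc B.δ₀.op, deRham_mul_deRham,
    zero_mul, mul_zero, zero_add, add_zero, mul_assoc]

lemma commute_δ₀_box : Commute B.δ₀.op B.box := by
  change B.δ₀.op * (deRham * B.δ₀.op + B.δ₀.op * deRham) =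
    (deRham * B.δ₀.op + B.δ₀.op * deRham) * B.δ₀.op
  rw [mul_add, add_mul, ← mul_assoc B.δ₀.op B.δ₀.op, B.δ₀_sq, mul_assoc deRham, B.δ₀_sq,
    zero_mul, mul_zero, zero_add, add_zero, mul_assoc]

lemma commute_d₀_box₀ : Commute B.d₀.op B.box₀Map.op := by
  change B.d₀.op * (B.d₀.op * B.δ₀.op + B.δ₀.op * B.d₀.op) =
    (B.d₀.op * B.δ₀.op + B.δ₀.op * B.d₀.op) * B.d₀.op
  rw [mul_add, add_mul, ← mul_assoc B.d₀.op B.d₀.op, B.d₀_sq, mul_assoc B.δ₀.op, B.d₀_sq,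
    zero_mul, mul_zero, zero_add, add_zero, mul_assoc]

lemma commute_δ₀_box₀ : Commute B.δ₀.op B.box₀Map.op := by
  change B.δ₀.op * (B.d₀.op * B.δ₀.op + B.δ₀.op * B.d₀.op) =
    (B.d₀.op * B.δ₀.op + B.δ₀.op * B.d₀.op) * B.δ₀.op
  rw [mul_add, add_mul, ← mul_assoc B.δ₀.op B.δ₀.op, B.δ₀_sq, mul_assoc B.d₀.op, B.δ₀_sq,
    zero_mul, mul_zero, zero_add, add_zero, mul_assoc]

/-- Applying `d₀` to `d₀ δ₀ α + δ₀ d₀ α = 0` leaves `d₀ δ₀ d₀ α = 0`. The two disjointness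
conditions then give successively `δ₀ d₀ α = 0`, `d₀ α = 0` and `δ₀ α = 0`. -/
lemma mem_E₀_iff (α : Forms n M) : α ∈ B.E₀ ↔ B.box₀Map.op α = 0 := by
  have hd : ∀ β, B.d₀.op (B.d₀.op β) = 0 := LinearMap.congr_fun B.d₀_sq
  constructor
  · rintro ⟨h1, h2⟩
    change B.d₀.op (B.δ₀.op α) + B.δ₀.op (B.d₀.op α) = 0
    rw [LinearMap.mem_ker.1 h1, LinearMap.mem_ker.1 h2, map_zero, map_zero, add_zero]
  · intro h
    have h0 : B.d₀.op (B.δ₀.op α) + B.δ₀.op (B.d₀.op α) = 0 := h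
    have h1 : B.d₀.op (B.δ₀.op (B.d₀.op α)) = 0 := by
      have := congrArg B.d₀.op h0
      rwa [map_add, hd, zero_add, map_zero] at this
    have h2 := B.disjoint_δ₀ _ h1
    rw [h2, add_zero] at h0
    exact ⟨B.disjoint_d₀ α h2, B.disjoint_δ₀ α h0⟩

/-- The base box of `α` lies in `E₀`. Since the base box commutes with `d₀` and `δ₀`, it kills `d₀
α` and `δ₀ α`, so these lie in `E₀` too and both terms of the base box of `α` vanish. No metric is
involved, although the base box need not be symmetric. -/
lemma box₀Map_apply_eq_zero_of_sq {α : Forms n M} (h : B.box₀Map.op (B.box₀Map.op α) = 0) :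
    B.box₀Map.op α = 0 := by
  obtain ⟨h1, h2⟩ := (B.mem_E₀_iff _).2 h
  have h3 : B.box₀Map.op (B.d₀.op α) = 0 :=
    (LinearMap.congr_fun B.commute_d₀_box₀.eq α).symm.trans h1
  have h4 : B.box₀Map.op (B.δ₀.op α) = 0 :=
    (LinearMap.congr_fun B.commute_δ₀_box₀.eq α).symm.trans h2
  change B.d₀.op (B.δ₀.op α) + B.δ₀.op (B.d₀.op α) = 0
  rw [LinearMap.mem_ker.1 ((B.mem_E₀_iff _).2 h3).2, LinearMap.mem_ker.1 ((B.mem_E₀_iff _).2 h4).1,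
    add_zero]

lemma box₀Map_apply_eq_zero_of_pow {a : ℕ} {α : Forms n M} (h : (B.box₀Map.op ^ (a + 1)) α = 0) :
    B.box₀Map.op α = 0 := by
  induction a with
  | zero => simpa using h
  | succ a ih =>
    refine ih ?_
    rw [pow_succ', pow_succ', Module.End.mul_apply, Module.End.mul_apply] at h
    rw [pow_succ', Module.End.mul_apply]
    exact B.box₀Map_apply_eq_zero_of_sq h

section Projections
variable {Q₀ : AlgebraicMap n M} {P L' : Module.End ℝ (Forms n M)} {a : ℕ}
  (hQ : IsFittingProjection B.box₀Map.op Q₀.op (a + 1))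
  (hP : IsFittingProjection B.box P (a + 1))

section
include hQ

lemma apply_mem_E₀ (α : Forms n M) : Q₀.op α ∈ B.E₀ :=
  (B.mem_E₀_iff _).2 (B.box₀Map_apply_eq_zero_of_pow (hQ.mem_ker_pow α))

lemma range_eq_E₀ : LinearMap.range Q₀.op = B.E₀ := by
  apply le_antisymm
  · rintro _ ⟨α, rfl⟩
    exact B.apply_mem_E₀ hQ α
  · intro α hα
    refine ⟨α, hQ.apply_of_pow_eq_zero ?_⟩
    rw [pow_succ, Module.End.mul_apply, (B.mem_E₀_iff α).1 hα, map_zero]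

lemma δ₀_baseProjection (α : Forms n M) : Q₀.op (B.δ₀.op α) = 0 :=
  (LinearMap.congr_fun (hQ.commute B.commute_δ₀_box₀).eq α).trans (B.apply_mem_E₀ hQ α).2

lemma d₀_baseProjection (α : Forms n M) : Q₀.op (B.d₀.op α) = 0 :=
  (LinearMap.congr_fun (hQ.commute B.commute_d₀_box₀).eq α).trans (B.apply_mem_E₀ hQ α).1

lemma ker_eq_F₀ : LinearMap.ker Q₀.op = B.F₀ := by
  apply le_antisymm
  · rw [hQ.ker_eq]
    rintro _ ⟨α, rfl⟩
    rw [pow_succ']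
    exact Submodule.add_mem_sup
      (LinearMap.mem_range_self B.d₀.op (B.δ₀.op ((B.box₀Map.op ^ a) α)))
      (LinearMap.mem_range_self B.δ₀.op (B.d₀.op ((B.box₀Map.op ^ a) α)))
  · refine sup_le ?_ ?_
    · rintro _ ⟨α, rfl⟩
      exact B.d₀_baseProjection hQ α
    · rintro _ ⟨α, rfl⟩
      exact B.δ₀_baseProjection hQ α

end

include hP

/-- `P` fixes `δ₀ P α` because it commutes with `δ₀`, while `Π₀` kills it because `Π₀ δ₀ = 0`. Hence
both terms of `L` vanish on it, and `L` is injective. This carries the algebraic identity for `Π₀`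
over to `P`. -/
lemma δ₀_projection (hQ : IsFittingProjection B.box₀Map.op Q₀.op (a + 1))
    (hL : L' * opL Q₀ P = 1) (α : Forms n M) : B.δ₀.op (P α) = 0 := by
  have h1 : P (B.δ₀.op (P α)) = B.δ₀.op (P α) := by
    have := LinearMap.congr_fun (hP.commute B.commute_δ₀_box).eq (P α)
    rw [Module.End.mul_apply, Module.End.mul_apply, hP.apply_idem] at this
    exact this
  have h2 : opL Q₀ P (B.δ₀.op (P α)) = 0 := by
    simp only [opL, LinearMap.add_apply, Module.End.mul_apply, LinearMap.sub_apply,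
      Module.End.one_apply, B.δ₀_baseProjection hQ, h1, map_zero, sub_zero, sub_self, add_zero]
  have h3 := LinearMap.congr_fun hL (B.δ₀.op (P α))
  rw [Module.End.mul_apply, h2, map_zero] at h3
  exact h3.symm

/-- A form killed by `δ₀` and `δ₀ d` is killed by `□` itself. Conversely, `d` commutes with `P`, so
`δ₀ P = 0` also gives `δ₀ d P = 0`. -/
lemma range_projection (hδ : ∀ α, B.δ₀.op (P α) = 0) :
    LinearMap.range P = LinearMap.ker B.δ₀.op ⊓ LinearMap.ker (B.δ₀.op * deRham) := by
  apply le_antisymm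
  · rintro _ ⟨α, rfl⟩
    have := LinearMap.congr_fun (hP.commute B.commute_deRham_box).eq α
    rw [Module.End.mul_apply, Module.End.mul_apply] at this
    refine ⟨hδ α, ?_⟩
    change B.δ₀.op (deRham (P α)) = 0
    rw [← this, hδ]
  · rintro α ⟨h1, h2⟩
    refine ⟨α, hP.apply_of_pow_eq_zero ?_⟩
    have h3 : B.box α = 0 := by
      have h1 : B.δ₀.op α = 0 := h1
      have h2 : B.δ₀.op (deRham α) = 0 := h2
      change deRham (B.δ₀.op α) + B.δ₀.op (deRham α) = 0
      rw [h1, h2, map_zero, add_zero]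
    rw [pow_succ, Module.End.mul_apply, h3, map_zero]

lemma ker_projection (hδ : ∀ α, B.δ₀.op (P α) = 0) :
    LinearMap.ker P = LinearMap.range B.δ₀.op ⊔ LinearMap.range (deRham * B.δ₀.op) := by
  have h1 : ∀ α, P (B.δ₀.op α) = 0 := fun α =>
    (LinearMap.congr_fun (hP.commute B.commute_δ₀_box).eq α).trans (hδ α)
  apply le_antisymm
  · rw [hP.ker_eq]
    rintro _ ⟨α, rfl⟩
    rw [pow_succ', sup_comm]
    exact Submodule.add_mem_sup (LinearMap.mem_range_self (deRham * B.δ₀.op) _)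
      (LinearMap.mem_range_self B.δ₀.op _)
  · refine sup_le ?_ ?_
    · rintro _ ⟨α, rfl⟩
      exact h1 α
    · rintro _ ⟨α, rfl⟩
      have := LinearMap.congr_fun (hP.commute B.commute_deRham_box).eq (B.δ₀.op α)
      rw [Module.End.mul_apply, Module.End.mul_apply, h1, map_zero] at this
      exact this

end Projections
end BasePair
end FilteredManifold

end

end

/-! ### Assembly of the theorem. -/

theorem mainTheorem7 {n : ℕ} {M : Type*} [TopologicalSpace M] [T2Space M]
    [ChartedSpace (EuclideanSpace ℝ (Fin n)) M] [IsManifold (𝓡 n) ∞ M]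
    (F : TangentFiltration n M)
    (g : Bundle.ContMDiffRiemannianMetric (𝓡 n) ∞ (EuclideanSpace ℝ (Fin n))
      (fun x : M => Tan n x))
    (B : BasePair F g)
    (hrank : IsLocallyConstant fun x : M => Module.finrank ℝ (LinearMap.ker (F.oscBox g x))) :
    (∃ N₀, F.IsNilpotencyBound N₀) ∧
    (∃! Q₀, B.IsBaseKernelProjection Q₀) ∧
    (∃! P, B.IsContourProjection P) ∧
    ∀ (N₀ : ℕ) (Q₀ : AlgebraicMap n M) (P : Module.End ℝ (Forms n M)),
      F.IsNilpotencyBound N₀ → B.IsBaseKernelProjection Q₀ → B.IsContourProjection P →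
      -- where a uniform contour exists, `P` is the contour integral of the resolvent on `Ω^•(M)`
      (∀ ε > 0, (∀ (x : M) (μ : ℝ), Module.End.HasEigenvalue (F.oscBox g x) μ → μ = 0 ∨ ε < μ) →
        CircleInResolventSet B.box ε ∧
        ∀ α x, IsContourValue B.box ε (evalAt n x) α ((P α).val x)) ∧
      -- the operator `P`
      (IsDifferentialOperator P ∧
        F.RespectsDegreeAndFiltration P ∧
        F.HasGr P (F.oscProj g) ∧
        Commute P B.box ∧ Commute P deRham ∧ Commute P B.δ₀.op) ∧
      -- the projection `P`, its image and its kernel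
      (B.box ^ N₀ * P = 0 ∧
        Set.BijOn B.box (LinearMap.range (B.box ^ N₀)) (LinearMap.range (B.box ^ N₀)) ∧
        P * P = P ∧
        LinearMap.range P = LinearMap.ker B.δ₀.op ⊓ LinearMap.ker (B.δ₀.op * deRham) ∧
        LinearMap.range P = LinearMap.ker (B.box ^ N₀) ∧
        LinearMap.ker P = LinearMap.range B.δ₀.op ⊔ LinearMap.range (deRham * B.δ₀.op) ∧
        LinearMap.ker P = LinearMap.range (B.box ^ N₀)) ∧
      -- the graded spaces of `E`, `F`, `E₀` and `F₀`
      (F.HasGrSubspace (LinearMap.range P) (fun x => LinearMap.ker (F.oscBox g x)) ∧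
        F.HasGrSubspace (LinearMap.ker P) (fun x => LinearMap.range (F.oscBox g x)) ∧
        F.HasGrSubspace B.E₀ (fun x => LinearMap.ker (F.oscBox g x)) ∧
        F.HasGrSubspace B.F₀ (fun x => LinearMap.range (F.oscBox g x))) ∧
      -- the operator `L`
      (IsDifferentialOperator (opL Q₀ P) ∧
        F.RespectsDegreeAndFiltration (opL Q₀ P) ∧
        F.HasGr (opL Q₀ P) (fun _ => 1) ∧
        P * opL Q₀ P = P * Q₀.op ∧ P * Q₀.op = opL Q₀ P * Q₀.op ∧
        Submodule.map (opL Q₀ P) (LinearMap.ker Q₀.op) = LinearMap.ker P ∧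
        Submodule.map (opL Q₀ P) B.F₀ = LinearMap.ker P ∧
        Submodule.map (opL Q₀ P) (LinearMap.range Q₀.op) = LinearMap.range P ∧
        Submodule.map (opL Q₀ P) B.E₀ = LinearMap.range P ∧
        ∃ L' : Module.End ℝ (Forms n M), opL Q₀ P * L' = 1 ∧ L' * opL Q₀ P = 1 ∧
          IsDifferentialOperator L' ∧
          P = opL Q₀ P * Q₀.op * L' ∧
          (L' * B.box * opL Q₀ P) * Q₀.op = Q₀.op * (L' * B.box * opL Q₀ P)) := by
  obtain ⟨ρ, π, hs⟩ := TangentFiltration.exists_isSpectralPair B.hasGr_box₀Map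
  obtain ⟨Q₁, hQ₁, hQ₁fib⟩ := B.exists_baseProjection hs hrank
  obtain ⟨⟨P₁, hP₁⟩, hker, hrange⟩ :=
    TangentFiltration.exists_isFittingProjection B.hasGr_box₀Map hrank B.hasGr_box
  have hQ₁' := B.isBaseKernelProjection_of_fib hs hQ₁fib
  have hP₁' := B.isContourProjection_of_fitting hs hP₁
  refine ⟨⟨_, TangentFiltration.isNilpotencyBound⟩,
    ⟨Q₁, hQ₁', fun Q h => B.isBaseKernelProjection_unique h hQ₁'⟩,
    ⟨P₁, hP₁', fun P h => B.isContourProjection_unique h hP₁'⟩, fun N₀ Q₀ P hN hQ₀ hP => ?_⟩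
  -- By uniqueness the given projections are the constructed Fitting projections.
  obtain rfl := B.isBaseKernelProjection_unique hQ₁' hQ₀
  obtain rfl := B.isContourProjection_unique hP₁' hP
  have hord := hasOrderLE_box B.δ₀
  have hord₀ := B.box₀Map.hasOrderLE.succ
  have hPd := hs.isDifferentialOperator B.hasGr_box₀Map B.hasGr_box hord hP₁
  have hPg := hs.hasGr B.hasGr_box₀Map B.hasGr_box hord hP₁
  have hPr := hs.respects B.hasGr_box₀Map B.hasGr_box hord hP₁ B.respects_box
  have hQd := hs.isDifferentialOperator B.hasGr_box₀Map B.hasGr_box₀Map hord₀ hQ₁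
  have hQg := hs.hasGr B.hasGr_box₀Map B.hasGr_box₀Map hord₀ hQ₁
  have hQr := hs.respects B.hasGr_box₀Map B.hasGr_box₀Map hord₀ hQ₁ B.respects_box₀Map
  -- `□ P` has associated graded `oscBox * oscProj = 0`, so it raises weights and the nilpotency
  -- bound applies to it.
  have hbox : B.box ^ N₀ * P₁ = 0 := hP₁.pow_mul_eq_zero <| hN _ fun w α hα => by
    have h := ((B.hasGr_box.mul hPg).congr TangentFiltration.oscBox_mul_oscProj).sub_raises
      (TangentFiltration.hasGr_zero g) hα
    rwa [sub_zero] at h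
  have hrangeN := hP₁.range_eq_ker_pow (hker N₀) hbox
  have hkerN := hP₁.ker_eq_range_pow (hrange N₀) hbox
  have hLg := TangentFiltration.hasGr_opL hPg hQg
  have hLd : IsDifferentialOperator (opL Q₁ P₁) := (hPd.mul hQd).add (hPd.one_sub.mul hQd.one_sub)
  have hPL : P₁ * opL Q₁ P₁ = P₁ * Q₁.op := idem_mul_intertwiner hP₁.idem
  have hLQ : opL Q₁ P₁ * Q₁.op = P₁ * Q₁.op := intertwiner_mul_idem hQ₁.idem
  have hL : P₁ * opL Q₁ P₁ = opL Q₁ P₁ * Q₁.op := hPL.trans hLQ.symm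
  have hnil := hLg.pow_one_sub_eq_zero (g := g)
  -- The inverse of the unipotent `L` is a finite geometric series in `1 - L`, hence a differential
  -- operator.
  let L' := ∑ j ∈ Finset.range (n * F.s + 1), (1 - opL Q₁ P₁) ^ j
  have hLL' : opL Q₁ P₁ * L' = 1 := by
    have h := mul_neg_geom_sum (1 - opL Q₁ P₁) (n * F.s + 1)
    rwa [sub_sub_cancel, hnil, sub_zero] at h
  have hL'L : L' * opL Q₁ P₁ = 1 := by
    have h := geom_sum_mul_neg (1 - opL Q₁ P₁) (n * F.s + 1)
    rwa [sub_sub_cancel, hnil, sub_zero] at h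
  have hδ := B.δ₀_projection hP₁ hQ₁ hL'L
  have hE₀ := B.range_eq_E₀ hQ₁
  have hF₀ := B.ker_eq_F₀ hQ₁
  have hmk := map_ker_of_intertwining hL hLL' hL'L
  have hmr := map_range_of_intertwining hL hLL'
  refine ⟨fun ε hε h => ?_, ⟨hPd, hPr, hPg, hP₁.commute_self,
      hP₁.commute B.commute_deRham_box, hP₁.commute B.commute_δ₀_box⟩,
    ⟨hbox, ?_, hP₁.idem, B.range_projection hP₁ hδ, hrangeN, B.ker_projection hP₁ hδ, hkerN⟩,
    ⟨hPg.hasGrSubspace_range hP₁.idem, hPg.hasGrSubspace_ker hP₁.idem,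
      hE₀ ▸ hQg.hasGrSubspace_range hQ₁.idem, hF₀ ▸ hQg.hasGrSubspace_ker hQ₁.idem⟩,
    ⟨hLd, (hPr.mul hQr).add (hPr.one_sub.mul hQr.one_sub), hLg, hPL, hLQ.symm, hmk, hF₀ ▸ hmk, hmr,
      hE₀ ▸ hmr, L', hLL', hL'L, hLd.one_sub.geom_sum _, eq_conj_of_intertwining hL hLL',
      conj_commutes_of_intertwining hL hLL' hL'L hP₁.commute_self.eq⟩⟩
  · have h' : ∀ (x : M) (μ : ℝ), Module.End.HasEigenvalue (F.oscBox g x) μ → μ ≠ 0 → ε < |μ| :=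
      fun x μ hμ h0 => ((h x μ hμ).resolve_left h0).trans_le (le_abs_self μ)
    exact ⟨B.circleInResolventSet_box hε h', fun α x => B.isContourValue_box hs hε h' hP₁ α x⟩
  · rw [← hkerN]
    -- Injectivity on the kernel of `P` needs a nonzero exponent; `F.exponent` is a successor by
    -- definition.
    exact hP₁.bijOn (Nat.succ_ne_zero _) (hrange _)
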